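/- **Setting.** $N\ge 1$ agents act in a discounted MDP ($0\le\gamma<1$) with finite product spaces $\mathcal S=\prod_i\mathcal S_i$, $\mathcal A=\prod_i\mathcal A_i$, transition law $P$ and initial distribution $\xi$. Policies factorize, $\pi_\theta(a|s)=\prod_i\pi^{(i)}_{\theta_i}(a_{(i)}|s)$, $\theta=(\theta_i)_i$, $\theta_i\in\mathbb R^{p_i}$. Let $\lambda^{\pi}(s,a)=\sum_t\gamma^t\,\mathbb P(s^t=s,a^t=a\mid\pi,\xi)$, let $\lambda_{(i)}$ denote its marginal on $\mathcal S_i\times\mathcal A_i$, let $F(\lambda)=\frac1N\sum_iF_i(\lambda_{(i)})$ with $F_i:\mathbb R^{\mathcal S_i\times\mathcal A_i}\to\mathbb R$, and write $J(\theta)=F(\lambda^{\pi_\theta})$. The shadow Q function $Q_F^{\pi}$ (local shadow Q function $Q_i^\pi$) is the Q function of $\pi$ for the reward $\partial F/\partial\lambda(s,a)$ at $\lambda^\pi$ (resp. $\partial F_i/\partial\lambda_{(i)}(s_{(i)},a_{(i)})$ at $\lambda_{(i)}^\pi$). With features $\phi(s,a)\in\mathbb R^d$ put $Q_w=\langle\phi,w\rangle$,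 $\ell(w;\pi)=\frac12\sum_{s,a}\lambda^\pi(s,a)(Q_w-Q_F^\pi)^2(s,a)$, $\ell_i$ likewise with $Q_i^\pi$, and let $w^*(\theta)$ be a minimizer of $\frac1N\sum_i\ell_i(\cdot;\pi_\theta)$. **DSAC.** Start from $\theta^0$ and $w_i^0=w^0$ for all $i$. In iteration $k=0,1,\dots$ draw a batch $\mathcal B_k$ of $B$ independent trajectories $s^0,a^0,\dots,s^H,a^H$ under $\pi_{\theta^k}$, $\xi$. Each agent forms $\hat\lambda_i=\frac1B\sum_\tau\sum_{t\le H}\gamma^t\mathbf e(s^t_{(i)},a^t_{(i)})$ and $\hat r_i=\nabla F_i(\hat\lambda_i)$, takes the critic step $$\tilde w_i=w_i^k-\eta_w\frac1B\sum_\tau\sum_{t\le H}\gamma^t\Big(Q_{w_i^k}(s^t,a^t)-\sum_{t'=t}^H\gamma^{t'-t}\hat r_i(s^{t'}_{(i)},a^{t'}_{(i)})\Big)\phi(s^t,a^t),$$ all agents mix $m$ times, $w_i^{k+1}=\sum_j(M^m)_{ji}\tilde w_j$, and each takes the actor step $\theta_i^{k+1}=\theta_i^k+\eta_\theta\frac1B\sum_\tau\sum_{t\le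 H}\gamma^tQ_{w_i^{k+1}}(s^t,a^t)\nabla_{\theta_i}\log\pi^{(i)}_{\theta_i^k}(a^t_{(i)}|s^t)$. **Assumptions.** 1. $\|\nabla F_i(\lambda^{\pi_\theta}_{(i)})\|_\infty\le C_F$ for all $\theta$; on the set of nonnegative vectors of total mass at most $1/(1-\gamma)$, $F_i$ is differentiable with $\|\nabla F_i(x)-\nabla F_i(y)\|_\infty\le L_\lambda\|x-y\|$; $J$ is differentiable with $L_\theta$-Lipschitz gradient. 2. $\pi^{(i)}_{\theta_i}(a_{(i)}|s)>0$ is differentiable in $\theta_i$ with $\|\nabla_{\theta_i}\log\pi^{(i)}_{\theta_i}\|\le C_\pi$; $\|\lambda^{\pi_\theta}-\lambda^{\pi_{\theta'}}\|\le\ell_\theta\|\theta-\theta'\|$, $|\lambda^{\pi_\theta}(s,a)-\lambda^{\pi_{\theta'}}(s,a)|\le\ell_\lambda\|\theta-\theta'\|$, $|Q_F^{\pi_\theta}(s,a)-Q_F^{\pi_{\theta'}}(s,a)|\le\ell_Q\|\theta-\theta'\|$. 3. $M$ is symmetric and doubly stochastic, for $i\ne j$ one has $M_{ij}>0$ iff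 $i,j$ are neighbours in the network, and its eigenvalues $1=\sigma_1\ge\dots\ge\sigma_N$ satisfy $\rho:=\max\{|\sigma_2|,|\sigma_N|\}<1$ ($\rho:=0$ if $N=1$). 4. For all $\theta$, $\sum_i\|\nabla_{\theta_i}J(\theta)-\mathbb E[\sum_t\gamma^tQ_{w^*(\theta)}(s^t,a^t)\nabla_{\theta_i}\log\pi^{(i)}_{\theta_i}(a^t_{(i)}|s^t)\mid\xi,\pi_\theta]\|^2\le W$. 5. $\|\phi(s,a)\|\le C_\phi$. 6. Along the run, almost surely, $\ell(\cdot;\pi_{\theta^k})$ is $\mu_w$-strongly convex for all $k\le T$. All of $C_F,L_\lambda,L_\theta,C_\pi,\ell_\theta,\ell_\lambda,\ell_Q,C_\phi,\mu_w$ are positive. Put $L_w=C_\phi^2/(1-\gamma)$. **Claim.** (a) There is $C_w>0$, depending only on the constants above and on the index sets and dimensions, such that $\|w^*(\theta)-w^*(\theta')\|\le C_w\|\theta-\theta'\|$ whenever $\ell(\cdot;\pi_\theta)$ and $\ell(\cdot;\pi_{\theta'})$ are $\mu_w$-strongly convex. (b) For every $C_w>0$ and $c\ge1$ there is a constant $C>0$,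 depending only on $C_w$, $c$, $w^0$, the constants above (but not on $W$ or $\rho$), and the index sets and dimensions, such that the following holds for all $\varepsilon,\delta\in(0,1)$. Let $T=\lceil\varepsilon^{-1}\rceil$, $B=\lceil\varepsilon^{-1}\log(1/\delta_k)\rceil$ with $\delta_k=\frac{\delta}{3N(T+1)}$, let $$\tfrac{\log(1/\varepsilon)}{1-\gamma}\le H\le c\Big(1+\tfrac{\log(1/\varepsilon)}{1-\gamma}\Big),\qquad \tfrac{\log(1/\varepsilon)}{1-\rho}\le m\le c\Big(1+\tfrac{\log(1/\varepsilon)}{1-\rho}\Big),$$ $$\eta_w=\frac1{L_w},\qquad\eta_\theta=\min\Big\{\frac{(1-\gamma)\mu_w/L_w}{C_wC_\phi C_\pi}\cdot\frac1{\max\{4\sqrt{3N},6\sqrt{10}\}},\frac1{4L_\theta}\Big\}.$$ If almost surely $\|w^*(\theta^{k+1})-w^*(\theta^k)\|\le C_w\|\theta^{k+1}-\theta^k\|$ for all $k<T$ (which holds for the $C_w$ of (a)), then with probability at least $1-\delta$ $$\frac1T\sum_{k=1}^T\|\nabla_\theta J(\theta^k)\|^2\le C(\varepsilon+W),$$ and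 the total number of sampled state-action pairs satisfies $$(T+1)B(H+1)\le C\,\varepsilon^{-2}\,(1+\log\tfrac1\varepsilon)\,(1+\log\tfrac1{\varepsilon\delta}),$$ that is, the sample complexity is $\tilde{\mathcal O}(\varepsilon^{-2})$. -/

import Mathlib

namespace DSAC

/-- The global space: a product of the local spaces of the agents. -/
abbrev Joint {ι : Type*} (X : ι → Type*) : Type _ := ∀ i, X i

/-- Global parameters `θ = (θ_i)_i`, with the Euclidean norm of the concatenated vector. -/
abbrev Param {ι : Type*} (p : ι → ℕ) : Type _ :=
  PiLp 2 (fun i => EuclideanSpace ℝ (Fin (p i)))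

/-- A trajectory `s^0, a^0, …, s^h, a^h` of global states and actions. -/
abbrev Trajectory {ι : Type*} (S A : ι → Type*) (h : ℕ) : Type _ :=
  Fin (h + 1) → Joint S × Joint A

/-- A batch of `b` trajectories. -/
abbrev Batch {ι : Type*} (S A : ι → Type*) (b h : ℕ) : Type _ := Fin b → Trajectory S A h

/-- A decentralized Markov decision problem with discount factor `γ`: agents `i : ι` with finite
local state spaces `S i` and action spaces `A i`, local policies parametrized by `ℝ ^ p i`,
local utilities, a common `d`-dimensional feature map, and a network with a mixing matrix. -/
structure Problem {ι : Type*} [Fintype ι] [DecidableEq ι] (S A : ι → Type*)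
    [∀ i, Fintype (S i)] [∀ i, Fintype (A i)] (p : ι → ℕ) (d : ℕ) (γ : ℝ) where
  /-- `trans s a s'` is the probability of moving from `s` to `s'` under the joint action `a`. -/
  trans : Joint S → Joint A → Joint S → ℝ
  trans_nonneg : ∀ s a s', 0 ≤ trans s a s'
  trans_sum : ∀ s a, ∑ s', trans s a s' = 1
  /-- the initial distribution of the global state -/
  init : Joint S → ℝ
  init_nonneg : ∀ s, 0 ≤ init s
  init_sum : ∑ s, init s = 1
  /-- `pol i ϑ s x` is the probability that agent `i` with parameter `ϑ` plays `x` in the global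
  state `s`. -/
  pol : ∀ i, EuclideanSpace ℝ (Fin (p i)) → Joint S → A i → ℝ
  pol_nonneg : ∀ i ϑ s x, 0 ≤ pol i ϑ s x
  pol_sum : ∀ i ϑ s, ∑ x, pol i ϑ s x = 1
  /-- the local utilities, functions of the local occupancy measures -/
  util : ∀ i, EuclideanSpace ℝ (S i × A i) → ℝ
  /-- the feature vectors of the linear critic -/
  feat : Joint S → Joint A → EuclideanSpace ℝ (Fin d)
  /-- the communication network -/
  graph : SimpleGraph ι
  /-- the symmetric mixing matrix -/
  mix : Matrix ι ι ℝ
  mix_symm : mix.IsHermitian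

/-- The numerical constants of the assumptions. -/
structure Constants where
  γ : ℝ
  C_F : ℝ
  L_lam : ℝ
  L_θ : ℝ
  C_π : ℝ
  l_θ : ℝ
  l_Q : ℝ
  l_lam : ℝ
  C_φ : ℝ
  μ_w : ℝ
  γ_nonneg : 0 ≤ γ
  γ_lt_one : γ < 1
  C_F_pos : 0 < C_F
  L_lam_pos : 0 < L_lam
  L_θ_pos : 0 < L_θ
  C_π_pos : 0 < C_π
  l_θ_pos : 0 < l_θ
  l_Q_pos : 0 < l_Q
  l_lam_pos : 0 < l_lam
  C_φ_pos : 0 < C_φ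
  μ_w_pos : 0 < μ_w

/-- The input of the algorithm: initial parameters, the common initial critic, step sizes, batch
sizes, episode lengths, and the number of mixing rounds per iteration. -/
structure Input {ι : Type*} (p : ι → ℕ) (d : ℕ) where
  θ₀ : Param p
  w₀ : EuclideanSpace ℝ (Fin d)
  stepθ : ℕ → ℝ
  stepw : ℕ → ℝ
  batch : ℕ → ℕ
  len : ℕ → ℕ
  rounds : ℕ

namespace Problem

variable {ι : Type*} [Fintype ι] [DecidableEq ι] {S A : ι → Type*}
  [∀ i, Fintype (S i)] [∀ i, DecidableEq (S i)] [∀ i, Fintype (A i)] [∀ i, DecidableEq (A i)]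
  {p : ι → ℕ} {d : ℕ} {γ : ℝ}

/-- The global policy `π_θ(a|s)`, the product of the local policies. -/
noncomputable def policy (G : Problem S A p d γ) (θ : Param p) (s : Joint S) (a : Joint A) : ℝ :=
  ∏ i, G.pol i (θ i) s (a i)

/-- The distribution of `(s^t, a^t)` under `π_θ`, if `(s^0, a^0)` has distribution `q`. -/
noncomputable def saDist (G : Problem S A p d γ) (θ : Param p) (q : Joint S × Joint A → ℝ) :
    ℕ → Joint S × Joint A → ℝ
  | 0 => q
  | t + 1 => fun y => ∑ x, saDist G θ q t x * G.trans x.1 x.2 y.1 * G.policy θ y.1 y.2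

/-- The discounted state-action occupancy measure `λ^{π_θ}`. -/
noncomputable def occ (G : Problem S A p d γ) (θ : Param p) :
    EuclideanSpace ℝ (Joint S × Joint A) :=
  WithLp.toLp 2 fun y =>
    ∑' t : ℕ, γ ^ t * G.saDist θ (fun x => G.init x.1 * G.policy θ x.1 x.2) t y

/-- Marginalization of a measure on global state-action pairs to those of agent `i`. -/
noncomputable def marg (i : ι) (v : EuclideanSpace ℝ (Joint S × Joint A)) :
    EuclideanSpace ℝ (S i × A i) :=
  WithLp.toLp 2 fun z => ∑ y : Joint S × Joint A, if y.1 i = z.1 ∧ y.2 i = z.2 then v y else 0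

/-- The local occupancy measure of agent `i`. -/
noncomputable def locOcc (G : Problem S A p d γ) (θ : Param p) (i : ι) :
    EuclideanSpace ℝ (S i × A i) := marg i (G.occ θ)

/-- The global utility `F`, the average of the local ones. -/
noncomputable def globalUtil (G : Problem S A p d γ)
    (v : EuclideanSpace ℝ (Joint S × Joint A)) : ℝ :=
  (1 / (Fintype.card ι : ℝ)) * ∑ i, G.util i (marg i v)

/-- The objective `θ ↦ F(λ^{π_θ})`. -/
noncomputable def objective (G : Problem S A p d γ) (θ : Param p) : ℝ := G.globalUtil (G.occ θ)

/-- The expected discounted sum of the reward `r` under `π_θ` from `(s^0, a^0) = x`. -/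
noncomputable def qValue (G : Problem S A p d γ) (θ : Param p) (r : Joint S × Joint A → ℝ)
    (x : Joint S × Joint A) : ℝ :=
  ∑' t : ℕ, γ ^ t * ∑ y, G.saDist θ (fun z => if z = x then 1 else 0) t y * r y

/-- The shadow Q function `Q_F^{π_θ}`, whose reward is the shadow reward `∂F/∂λ(s,a)` at
`λ^{π_θ}`. -/
noncomputable def shadowQ (G : Problem S A p d γ) (θ : Param p) (x : Joint S × Joint A) : ℝ :=
  G.qValue θ (fun y => gradient G.globalUtil (G.occ θ) y) x

/-- The local shadow Q function `Q_i^{π_θ}`, whose reward is the local shadow reward. -/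
noncomputable def locShadowQ (G : Problem S A p d γ) (θ : Param p) (i : ι)
    (x : Joint S × Joint A) : ℝ :=
  G.qValue θ (fun y => gradient (G.util i) (G.locOcc θ i) (y.1 i, y.2 i)) x

/-- The linear critic `Q_w(s,a) = ⟨φ(s,a), w⟩`. -/
noncomputable def critic (G : Problem S A p d γ) (w : EuclideanSpace ℝ (Fin d))
    (x : Joint S × Joint A) : ℝ :=
  inner ℝ (G.feat x.1 x.2) w

/-- The critic objective `ℓ(w; π_θ)`. -/
noncomputable def criticObj (G : Problem S A p d γ) (θ : Param p)
    (w : EuclideanSpace ℝ (Fin d)) : ℝ :=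
  (1 / 2) * ∑ x, G.occ θ x * (G.critic w x - G.shadowQ θ x) ^ 2

/-- The local critic objective `ℓ_i(w; π_θ)`. -/
noncomputable def locCriticObj (G : Problem S A p d γ) (θ : Param p) (i : ι)
    (w : EuclideanSpace ℝ (Fin d)) : ℝ :=
  (1 / 2) * ∑ x, G.occ θ x * (G.critic w x - G.locShadowQ θ i x) ^ 2

/-- `w` is an optimal critic parameter `w^*(θ)`: a minimizer of the average of the local critic
objectives. -/
def IsOptCritic (G : Problem S A p d γ) (θ : Param p) (w : EuclideanSpace ℝ (Fin d)) : Prop :=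
  IsMinOn (fun v => (1 / (Fintype.card ι : ℝ)) * ∑ i, G.locCriticObj θ i v) Set.univ w

/-- The score function `∇_{θ_i} log π^{(i)}_{θ_i}(x|s)`. -/
noncomputable def score (G : Problem S A p d γ) (i : ι) (ϑ : EuclideanSpace ℝ (Fin (p i)))
    (s : Joint S) (x : A i) : EuclideanSpace ℝ (Fin (p i)) :=
  gradient (fun ϑ' => Real.log (G.pol i ϑ' s x)) ϑ

/-- The policy gradient of agent `i` computed with the critic `w`, the expectation of
`∑ γ^t Q_w(s^t,a^t) ∇_{θ_i} log π^{(i)}_{θ_i}(a^t_(i)|s^t)`. -/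
noncomputable def polGrad (G : Problem S A p d γ) (θ : Param p)
    (w : EuclideanSpace ℝ (Fin d)) (i : ι) : EuclideanSpace ℝ (Fin (p i)) :=
  ∑ x, (G.occ θ x * G.critic w x) • G.score i (θ i) x.1 (x.2 i)

/-- `max {|σ_2|, |σ_N|}` for the eigenvalues `σ_1 ≥ … ≥ σ_N` of the mixing matrix
(`0` for a single agent); `eigenvalues₀` lists them in decreasing order. -/
noncomputable def rho (G : Problem S A p d γ) : ℝ :=
  ⨆ k : {k : Fin (Fintype.card ι) // 0 < k.val}, |G.mix_symm.eigenvalues₀ k.1|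

/-- Nonnegative vectors of mass at most `1 / (1 - γ)`. All local occupancy measures and all
their empirical estimates (which are truncated) lie in this set. -/
def massRegion (i : ι) (S A : ι → Type*) [∀ i, Fintype (S i)] [∀ i, Fintype (A i)] (γ : ℝ) :
    Set (EuclideanSpace ℝ (S i × A i)) :=
  {v | (∀ z, 0 ≤ v z) ∧ ∑ z, v z ≤ 1 / (1 - γ)}

/-- The assumptions on the problem, with constants `K` and mis-specification error `W`. -/
structure Assumptions (K : Constants) (G : Problem S A p d K.γ) (W : ℝ) : Prop where
  /-- bounded gradients of the local utilities at occupancy measures -/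
  util_bound : ∀ θ i z, |gradient (G.util i) (G.locOcc θ i) z| ≤ K.C_F
  /-- smoothness of the local utilities -/
  util_diff : ∀ i, ∀ v ∈ massRegion i S A K.γ, DifferentiableAt ℝ (G.util i) v
  util_lip : ∀ i, ∀ v ∈ massRegion i S A K.γ, ∀ v' ∈ massRegion i S A K.γ, ∀ z,
    |gradient (G.util i) v z - gradient (G.util i) v' z| ≤ K.L_lam * ‖v - v'‖
  /-- `F ∘ λ` is smooth in the policy parameter. -/
  obj_diff : Differentiable ℝ G.objective
  obj_lip : ∀ θ θ', ‖gradient G.objective θ - gradient G.objective θ'‖ ≤ K.L_θ * ‖θ - θ'‖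
  /-- The score functions exist and are bounded. -/
  pol_pos : ∀ i ϑ s x, 0 < G.pol i ϑ s x
  pol_diff : ∀ i s x, Differentiable ℝ (fun ϑ => G.pol i ϑ s x)
  score_bound : ∀ i ϑ s x, ‖G.score i ϑ s x‖ ≤ K.C_π
  /-- The occupancy measure and the shadow Q function are Lipschitz in the policy parameter. -/
  occ_lip : ∀ θ θ', ‖G.occ θ - G.occ θ'‖ ≤ K.l_θ * ‖θ - θ'‖
  shadowQ_lip : ∀ θ θ' x, |G.shadowQ θ x - G.shadowQ θ' x| ≤ K.l_Q * ‖θ - θ'‖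
  occ_entry_lip : ∀ θ θ' x, |G.occ θ x - G.occ θ' x| ≤ K.l_lam * ‖θ - θ'‖
  /-- The features are bounded. -/
  feat_bound : ∀ s a, ‖G.feat s a‖ ≤ K.C_φ
  /-- The mixing matrix is doubly stochastic, respects the network, and has a spectral gap. -/
  mix_stoch : G.mix ∈ doublyStochastic ℝ ι
  mix_graph : ∀ i j, i ≠ j → (0 < G.mix i j ↔ G.graph.Adj i j)
  rho_lt_one : G.rho < 1
  /-- The feature mis-specification error is bounded by `W`. -/
  misspec : ∀ θ w, G.IsOptCritic θ w →
    ∑ i, ‖gradient G.objective θ i - G.polGrad θ w i‖ ^ 2 ≤ W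

/-! The algorithm. -/

/-- The empirical local occupancy measure of agent `i`. -/
noncomputable def empOcc (_G : Problem S A p d γ) {b h : ℕ} (x : Batch S A b h) (i : ι) :
    EuclideanSpace ℝ (S i × A i) :=
  (1 / (b : ℝ)) • ∑ j, ∑ t : Fin (h + 1),
    γ ^ t.val • EuclideanSpace.single ((x j t).1 i, (x j t).2 i) (1 : ℝ)

/-- The estimated shadow reward of agent `i`. -/
noncomputable def empReward (G : Problem S A p d γ) {b h : ℕ} (x : Batch S A b h) (i : ι) :
    EuclideanSpace ℝ (S i × A i) :=
  gradient (G.util i) (G.empOcc x i)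

/-- `G_{w_i}(τ, r_i, w)`: the stochastic critic gradient along the trajectory `y`, where the shadow
Q function is replaced by the discounted sum of the remaining rewards. -/
noncomputable def criticGradTraj (G : Problem S A p d γ) {h : ℕ} (y : Trajectory S A h) (i : ι)
    (r : EuclideanSpace ℝ (S i × A i)) (w : EuclideanSpace ℝ (Fin d)) :
    EuclideanSpace ℝ (Fin d) :=
  ∑ t : Fin (h + 1),
    (γ ^ t.val * (G.critic w (y t)
      - ∑ t' ∈ Finset.Ici t, γ ^ (t'.val - t.val) * r ((y t').1 i, (y t').2 i)))
    • G.feat (y t).1 (y t).2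

/-- `G_{θ_i}(τ, w)`: the stochastic actor gradient along the trajectory `y`. -/
noncomputable def actorGradTraj (G : Problem S A p d γ) {h : ℕ} (y : Trajectory S A h) (i : ι)
    (ϑ : EuclideanSpace ℝ (Fin (p i))) (w : EuclideanSpace ℝ (Fin d)) :
    EuclideanSpace ℝ (Fin (p i)) :=
  ∑ t : Fin (h + 1), (γ ^ t.val * G.critic w (y t)) • G.score i ϑ (y t).1 ((y t).2 i)

/-- One mixing round. Entries of the mixing matrix between distinct agents that are not
neighbours vanish, so each agent averages only over itself and its neighbours. -/
noncomputable def mixRound (G : Problem S A p d γ) (w : ι → EuclideanSpace ℝ (Fin d)) :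
    ι → EuclideanSpace ℝ (Fin d) :=
  fun i => ∑ j, G.mix j i • w j

/-- The critic update: a local gradient step, then `m` mixing rounds. -/
noncomputable def criticUpdate (G : Problem S A p d γ) {b h : ℕ} (x : Batch S A b h) (η : ℝ)
    (m : ℕ) (w : ι → EuclideanSpace ℝ (Fin d)) : ι → EuclideanSpace ℝ (Fin d) :=
  G.mixRound^[m] fun i =>
    w i - η • (1 / (b : ℝ)) • ∑ j, G.criticGradTraj (x j) i (G.empReward x i) (w i)

/-- The actor update, with the critics `w` of the agents. -/
noncomputable def actorUpdate (G : Problem S A p d γ) {b h : ℕ} (x : Batch S A b h) (η : ℝ)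
    (θ : Param p) (w : ι → EuclideanSpace ℝ (Fin d)) : Param p :=
  WithLp.toLp 2 fun i =>
    θ i + η • (1 / (b : ℝ)) • ∑ j, G.actorGradTraj (x j) i (θ i) (w i)

/-- The iterates `(θ^k, (w_i^k)_i)` as a function of the batches `x 0, x 1, …`; the `k`-th iterate
depends only on the batches before `k`. -/
noncomputable def iter (G : Problem S A p d γ) (I : Input p d)
    (x : ∀ k, Batch S A (I.batch k) (I.len k)) :
    ℕ → Param p × (ι → EuclideanSpace ℝ (Fin d))
  | 0 => (I.θ₀, fun _ => I.w₀)
  | k + 1 =>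
    let cur := iter G I x k
    let w := G.criticUpdate (x k) (I.stepw k) I.rounds cur.2
    (G.actorUpdate (x k) (I.stepθ k) cur.1 w, w)

/-- The probability of the trajectory `y` under `π_θ` and the initial distribution. -/
noncomputable def trajProb (G : Problem S A p d γ) (θ : Param p) {h : ℕ}
    (y : Trajectory S A h) : ℝ :=
  G.init (y 0).1 * (∏ t, G.policy θ (y t).1 (y t).2) *
    ∏ t : Fin h, G.trans (y t.castSucc).1 (y t.castSucc).2 (y t.succ).1

/-- The random batches `τ 0, τ 1, …` on the probability space `(Ω, μ)` are those of a run of the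
algorithm: given the batches before `k`, the trajectories of the batch `k` are independent, and
each has the law of a trajectory under the policy with parameter `θ^k`. -/
structure IsRun (G : Problem S A p d γ) (I : Input p d) {Ω : Type*} [MeasurableSpace Ω]
    (μ : MeasureTheory.Measure Ω) (τ : ∀ k, Ω → Batch S A (I.batch k) (I.len k)) : Prop where
  measurable : ∀ k x, MeasurableSet {ω | τ k ω = x}
  law : ∀ (k : ℕ) (x : ∀ k, Batch S A (I.batch k) (I.len k)),
    μ.real {ω | ∀ j ≤ k, τ j ω = x j} =
      μ.real {ω | ∀ j < k, τ j ω = x j} * ∏ b, G.trajProb (G.iter I x k).1 (x k b)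

/-- The policy parameter `θ^k` of a run, as a random variable. -/
noncomputable def runParam (G : Problem S A p d γ) (I : Input p d) {Ω : Type*}
    (τ : ∀ k, Ω → Batch S A (I.batch k) (I.len k)) (k : ℕ) (ω : Ω) : Param p :=
  (G.iter I (fun j => τ j ω) k).1

end Problem

/-- The number of state-action samples drawn in the iterations `0, …, T`. -/
def Input.totalSamples {ι : Type*} {p : ι → ℕ} {d : ℕ} (I : Input p d) (T : ℕ) : ℕ :=
  ∑ k ∈ Finset.range (T + 1), I.batch k * (I.len k + 1)

/-- The smoothness constant `L_w = C_φ² / (1 - γ)` of the critic objective. -/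
noncomputable def Constants.L_w (K : Constants) : ℝ := K.C_φ ^ 2 / (1 - K.γ)

/-- The constant actor step size, for `N` agents and the Lipschitz constant `C_w` of the optimal
critic parameter. -/
noncomputable def Constants.actorStep (K : Constants) (N : ℕ) (C_w : ℝ) : ℝ :=
  min (((1 - K.γ) * K.μ_w / K.L_w) / (C_w * K.C_φ * K.C_π) *
      (1 / max (4 * Real.sqrt (3 * N)) (6 * Real.sqrt 10)))
    (1 / (4 * K.L_θ))

end DSAC

/-! All randomness is confined to one event per iteration. A batch is `Accurate` if finitely many
statistics, the discounted visits to each pair `y` and the discounted ordered visits to each two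
pairs `y`, `z`, are within `r = κ√ε` of their exact values `λ(y)` and `λ(y) R(y,z)`, where `R` is
the resolvent of the state-action chain. Hoeffding's inequality, the geometric truncation bias and a
union bound show that a batch of about `log(1/q)/ε` trajectories fails with probability at most `q`
for every fixed policy (`exists_sum_not_accurate_le`). Splitting by the history transfers this to
the random `θ^k` (`IsRun.measureReal_le`), and a union bound over `k ≤ T` costs at most `δ`. The
critic and actor directions are explicit functions of these statistics. Since accuracy is a uniform
statement about all of them, it does not matter that the estimated rewards come from the same batch
as the returns.

The rest is deterministic. The average of the local critic objectives is a quadratic whose Hessian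
is the feature covariance `D(θ)` under `λ`, so `w^*` solves the normal equation `D(θ) w = b(θ)`.
Coercivity of `D` and Lipschitz continuity of `D` and `b` give (a).

For (b), mixing preserves the average critic and multiplies the disagreement by at most `ρ^(2m) ≤
ε²`. On an accurate batch the average critic contracts towards `w^*(θ^k)` by `1 - α`, with `α` a
fixed fraction of `μ_w / L_w`, up to noise of order `√ε`. Between iterations the target moves by at
most `C_w η_θ ‖v_k‖`, where `v_k` is the actor direction. Hence the sum of squared critic errors is
bounded by a multiple of `∑ (C_w η_θ ‖v_k‖)²` plus terms of order `1 + Tε`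
(`sum_sq_le_of_contraction`). Smoothness of the objective gives an ascent inequality with the
surplus `3/8 η_θ ‖v_k‖²`, and `η_θ` is so small that this surplus pays for the drift of the target
(`sum_sq_le_of_descent`). Telescoping and dividing by `T ≥ 1/ε` leaves `O(ε + W)`.

This argument needs `ε` below a threshold `ε₀` that depends only on the constants. Above it, the a
priori bound on the gradient of the objective suffices. -/

set_option linter.unusedSectionVars false

namespace DSAC

open Finset

/-! ### Path sums of finite Markov chains -/

section Chain

variable {X : Type*}

/-- The weight of a path of a chain with initial weights `q` and transition matrix `k`. -/
def pathWeight (k : Matrix X X ℝ) (q : X → ℝ) (h : ℕ) (y : Fin (h + 1) → X) : ℝ :=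
  q (y 0) * ∏ t : Fin h, k (y t.castSucc) (y t.succ)

/-- First-step decomposition: once the first state `x` is fixed, the remaining path belongs to the
chain with initial weights `k x`. Hence the inductions on the length below generalize over the
initial weights. -/
theorem pathWeight_cons (k : Matrix X X ℝ) (q : X → ℝ) (h : ℕ) (x : X) (y : Fin (h + 1) → X) :
    pathWeight k q (h + 1) (Fin.cons x y) = q x * pathWeight k (k x) h y := by
  simp only [pathWeight, Fin.prod_univ_succ, Fin.cons_zero, Fin.cons_succ, Fin.castSucc_zero,
    ← Fin.succ_castSucc]

variable [Fintype X]

theorem sum_path_succ (h : ℕ) (f : (Fin (h + 2) → X) → ℝ) :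
    ∑ y, f y = ∑ x, ∑ y : Fin (h + 1) → X, f (Fin.cons x y) := by
  rw [← Fintype.sum_prod_type']
  exact ((Fin.consEquiv fun _ : Fin (h + 2) => X).sum_comp f).symm

theorem sum_path_zero (f : (Fin 1 → X) → ℝ) : ∑ y, f y = ∑ x, f (fun _ => x) := by
  refine (Equiv.sum_comp (Equiv.funUnique (Fin 1) X).symm f).symm.trans ?_
  exact Finset.sum_congr rfl fun x _ => congrArg f (by ext; rfl)

theorem sum_pathWeight (k : Matrix X X ℝ) (hk : ∀ x, ∑ y, k x y = 1) (q : X → ℝ) (h : ℕ) :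
    ∑ y, pathWeight k q h y = ∑ x, q x := by
  induction h generalizing q with
  | zero => rw [sum_path_zero]; simp [pathWeight]
  | succ h ih =>
    rw [sum_path_succ]
    simp_rw [pathWeight_cons, ← Finset.mul_sum, ih, hk, mul_one]

variable [DecidableEq X]

theorem sum_pathWeight_mul (k : Matrix X X ℝ) (hk : ∀ x, ∑ y, k x y = 1) (q : X → ℝ) (h : ℕ)
    (t : Fin (h + 1)) (g : X → ℝ) :
    ∑ y, pathWeight k q h y * g (y t) = ∑ z, (∑ x, q x * (k ^ t.val) x z) * g z := by
  induction h generalizing q with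
  | zero =>
    rw [sum_path_zero]
    have : t = 0 := Fin.fin_one_eq_zero t
    subst this
    simp [pathWeight, Matrix.one_apply]
  | succ h ih =>
    rw [sum_path_succ]
    simp_rw [pathWeight_cons]
    refine Fin.cases ?_ (fun t => ?_) t
    · simp [mul_right_comm _ _ (g _), ← Finset.mul_sum, sum_pathWeight k hk, hk, Matrix.one_apply]
    · simp_rw [Fin.cons_succ, mul_assoc, ← Finset.mul_sum, ih, Fin.val_succ, pow_succ',
        Matrix.mul_apply, Finset.sum_mul, Finset.mul_sum, Finset.sum_mul]
      rw [Finset.sum_comm]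
      simp_rw [mul_assoc]

/-- The Markov property at two times: given the state at time `t`, the state at time `t'` is
governed by the power `k ^ (t' - t)`. This evaluates the mean of the Monte Carlo returns in the
critic step. -/
theorem sum_pathWeight_mul_mul (k : Matrix X X ℝ) (hk : ∀ x, ∑ y, k x y = 1) (q : X → ℝ) (h : ℕ)
    (t t' : Fin (h + 1)) (htt : t ≤ t') (f g : X → ℝ) :
    ∑ y, pathWeight k q h y * (f (y t) * g (y t')) =
      ∑ x, (∑ x₀, q x₀ * (k ^ t.val) x₀ x) * f x * ∑ z, (k ^ (t'.val - t.val)) x z * g z := by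
  induction h generalizing q with
  | zero =>
    rw [sum_path_zero]
    have : t = 0 := Fin.fin_one_eq_zero t
    subst this
    have : t' = 0 := Fin.fin_one_eq_zero t'
    subst this
    simp [pathWeight, Matrix.one_apply, mul_assoc]
  | succ h ih =>
    rw [sum_path_succ]
    simp_rw [pathWeight_cons]
    induction t using Fin.cases with
    | zero =>
      induction t' using Fin.cases with
      | zero => simp [← Finset.mul_sum, ← Finset.sum_mul, sum_pathWeight k hk, hk, Matrix.one_apply,
          mul_assoc]
      | succ t' =>
        have (x : X) (y : Fin (h + 1) → X) : q x * pathWeight k (k x) h y * (f x * g (y t')) =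
          q x * f x * (pathWeight k (k x) h y * g (y t')) := by ring
        simp_rw [Fin.cons_succ, Fin.cons_zero, this, ← Finset.mul_sum,
          sum_pathWeight_mul k hk]
        simp [Matrix.one_apply, pow_succ', Matrix.mul_apply]
    | succ t =>
      induction t' using Fin.cases with
      | zero => simp at htt
      | succ t' =>
        simp_rw [Fin.cons_succ, mul_assoc, ← Finset.mul_sum,
          ih _ _ _ (Fin.succ_le_succ_iff.mp htt), Fin.val_succ, pow_succ', Nat.add_sub_add_right,
          Matrix.mul_apply, Finset.mul_sum (s := univ) (f := fun z => _ * g z), Finset.sum_mul,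
          Finset.mul_sum, Finset.sum_mul]
        rw [Finset.sum_comm]
        refine Finset.sum_congr rfl fun x _ => ?_
        refine Finset.sum_congr rfl fun x _ => ?_
        simp_rw [mul_assoc]

end Chain

/-! ### Hoeffding's inequality on finite product spaces -/

section Chernoff

variable {Y : Type*} [Fintype Y]

/-- Hoeffding's lemma: on `[-M, M]` the convex function `exp (s ·)` lies below its chord, the linear
part of the chord has mean zero, and the constant part is `cosh (s M)`. -/
theorem sum_mul_exp_le {P f : Y → ℝ} (hP : ∀ y, 0 ≤ P y) (hP1 : ∑ y, P y = 1) {M : ℝ}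
    (hM : 0 < M) (hf : ∀ y, |f y| ≤ M) (hmean : ∑ y, P y * f y = 0) (s : ℝ) :
    ∑ y, P y * Real.exp (s * f y) ≤ Real.exp ((s * M) ^ 2 / 2) := by
  refine le_trans ?_ (Real.cosh_le_exp_half_sq _)
  have key (y : Y) : Real.exp (s * f y) ≤ Real.cosh (s * M) + f y * (Real.sinh (s * M) / M) := by
    have h1 := abs_le.mp (hf y)
    have hconv := convexOn_exp.2
    have := hconv (Set.mem_univ (s * M)) (Set.mem_univ (-(s * M)))
      (a := (1 + f y / M) / 2) (b := (1 - f y / M) / 2)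
      (by have : -1 ≤ f y / M := by rw [le_div_iff₀ hM]; linarith
          linarith)
      (by have : f y / M ≤ 1 := by rw [div_le_iff₀ hM]; linarith
          linarith) (by ring)
    have e : ((1 + f y / M) / 2) • (s * M) + ((1 - f y / M) / 2) • (-(s * M)) = s * f y := by
      simp only [smul_eq_mul]; field_simp; ring
    rw [e] at this
    refine this.trans (le_of_eq ?_)
    rw [Real.cosh_eq, Real.sinh_eq]
    simp only [smul_eq_mul]; field_simp; ring
  calc ∑ y, P y * Real.exp (s * f y)
      ≤ ∑ y, P y * (Real.cosh (s * M) + f y * (Real.sinh (s * M) / M)) :=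
        Finset.sum_le_sum fun y _ => mul_le_mul_of_nonneg_left (key y) (hP y)
    _ = (∑ y, P y) * Real.cosh (s * M) + (∑ y, P y * f y) * (Real.sinh (s * M) / M) := by
        rw [Finset.sum_mul, Finset.sum_mul, ← Finset.sum_add_distrib]
        exact Finset.sum_congr rfl fun y _ => by ring
    _ = Real.cosh (s * M) := by rw [hP1, hmean]; ring

theorem sum_prod_tail_le {P f : Y → ℝ} (hP : ∀ y, 0 ≤ P y) (hP1 : ∑ y, P y = 1) {M : ℝ}
    (hM : 0 < M) (hf : ∀ y, |f y| ≤ M) (hmean : ∑ y, P y * f y = 0) (b : ℕ) {t : ℝ} (ht : 0 ≤ t) :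
    ∑ z : Fin b → Y with (b : ℝ) * t < ∑ j, f (z j), ∏ j, P (z j)
      ≤ Real.exp (-(b * (t ^ 2 / (2 * M ^ 2)))) := by
  classical
  -- The minimizer of the Chernoff exponent `-s b t + b (s M)² / 2`.
  set s := t / M ^ 2
  have hs : 0 ≤ s := by positivity
  calc ∑ z : Fin b → Y with (b : ℝ) * t < ∑ j, f (z j), ∏ j, P (z j)
      ≤ ∑ z : Fin b → Y with (b : ℝ) * t < ∑ j, f (z j),
          Real.exp (-(s * (b * t))) * ∏ j, (P (z j) * Real.exp (s * f (z j))) := by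
        refine Finset.sum_le_sum fun z hz => ?_
        rw [Finset.prod_mul_distrib, ← Real.exp_sum, ← Finset.mul_sum, mul_left_comm,
          ← Real.exp_add]
        refine le_mul_of_one_le_right (Finset.prod_nonneg fun j _ => hP _) ?_
        rw [Real.one_le_exp_iff]
        have := mul_le_mul_of_nonneg_left (Finset.mem_filter.mp hz).2.le hs
        linarith
    _ ≤ ∑ z : Fin b → Y, Real.exp (-(s * (b * t))) * ∏ j, (P (z j) * Real.exp (s * f (z j))) :=
        Finset.sum_le_sum_of_subset_of_nonneg (Finset.filter_subset _ _) fun z _ _ =>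
          mul_nonneg (Real.exp_nonneg _) (Finset.prod_nonneg fun j _ =>
            mul_nonneg (hP _) (Real.exp_nonneg _))
    _ = Real.exp (-(s * (b * t))) * (∑ y, P y * Real.exp (s * f y)) ^ b := by
        rw [← Finset.mul_sum, Fintype.sum_pow]
    _ ≤ Real.exp (-(s * (b * t))) * (Real.exp ((s * M) ^ 2 / 2)) ^ b := by
        gcongr
        · exact Finset.sum_nonneg fun y _ => mul_nonneg (hP y) (Real.exp_nonneg _)
        · exact sum_mul_exp_le hP hP1 hM hf hmean s
    _ = Real.exp (-(b * (t ^ 2 / (2 * M ^ 2)))) := by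
        rw [← Real.exp_nat_mul, ← Real.exp_add]
        congr 1
        simp only [s]; field_simp; ring

/-- The empirical mean of a bounded function over `b` independent samples concentrates. -/
theorem sum_prod_abs_tail_le {P f : Y → ℝ} (hP : ∀ y, 0 ≤ P y) (hP1 : ∑ y, P y = 1) {M : ℝ}
    (hM : 0 < M) (hf : ∀ y, |f y| ≤ M) {b : ℕ} (hb : 0 < b) {t : ℝ} (ht : 0 ≤ t) :
    ∑ z : Fin b → Y with t < |1 / (b : ℝ) * ∑ j, f (z j) - ∑ y, P y * f y|, ∏ j, P (z j)
      ≤ 2 * Real.exp (-(b * (t ^ 2 / (8 * M ^ 2)))) := by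
  classical
  set m := ∑ y, P y * f y with hm
  have hmM : |m| ≤ M := by
    calc |m| ≤ ∑ y, |P y * f y| := Finset.abs_sum_le_sum_abs _ _
      _ ≤ ∑ y, P y * M := Finset.sum_le_sum fun y _ => by
          rw [abs_mul, abs_of_nonneg (hP y)]; exact mul_le_mul_of_nonneg_left (hf y) (hP y)
      _ = M := by rw [← Finset.sum_mul, hP1, one_mul]
  have hb' : (0 : ℝ) < b := by exact_mod_cast hb
  -- Centring doubles the range: `f - m` is bounded by `2 M`, hence the `8 M²` in the exponent.
  have e8 : 2 * (2 * M) ^ 2 = 8 * M ^ 2 := by ring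
  have h1 := sum_prod_tail_le hP hP1 (M := 2 * M) (f := fun y => f y - m) (by linarith)
    (fun y => by have := abs_le.mp (hf y); have := abs_le.mp hmM; rw [abs_le]; constructor <;> linarith)
    (by simp_rw [mul_sub, Finset.sum_sub_distrib, ← Finset.sum_mul, hP1]; linarith) b ht
  have h2 := sum_prod_tail_le hP hP1 (M := 2 * M) (f := fun y => m - f y) (by linarith)
    (fun y => by have := abs_le.mp (hf y); have := abs_le.mp hmM; rw [abs_le]; constructor <;> linarith)
    (by simp_rw [mul_sub, Finset.sum_sub_distrib, ← Finset.sum_mul, hP1]; linarith) b ht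
  rw [e8] at h1 h2
  have hsub : (univ.filter fun z : Fin b → Y => t < |1 / (b : ℝ) * ∑ j, f (z j) - m|) ⊆
      (univ.filter fun z : Fin b → Y => (b : ℝ) * t < ∑ j, (f (z j) - m)) ∪
      (univ.filter fun z : Fin b → Y => (b : ℝ) * t < ∑ j, (m - f (z j))) := by
    intro z hz
    simp only [Finset.mem_filter, Finset.mem_union, Finset.mem_univ, true_and,
      Finset.sum_sub_distrib, Finset.sum_const, Finset.card_univ, Fintype.card_fin,
      nsmul_eq_mul] at hz ⊢
    rcases lt_abs.mp hz with h | h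
    · left
      have := mul_lt_mul_of_pos_left h hb'
      rw [mul_sub, ← mul_assoc, mul_one_div_cancel hb'.ne'] at this
      linarith
    · right
      have := mul_lt_mul_of_pos_left h hb'
      rw [neg_sub, mul_sub, ← mul_assoc, mul_one_div_cancel hb'.ne'] at this
      linarith
  have hnn (z : Fin b → Y) : 0 ≤ ∏ j, P (z j) := Finset.prod_nonneg fun j _ => hP _
  calc _ ≤ _ := Finset.sum_le_sum_of_subset_of_nonneg hsub fun z _ _ => hnn z
    _ ≤ _ := by
      have := Finset.sum_union_inter (f := fun z : Fin b → Y => ∏ j, P (z j))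
        (s₁ := univ.filter fun z : Fin b → Y => (b : ℝ) * t < ∑ j, (f (z j) - m))
        (s₂ := univ.filter fun z : Fin b → Y => (b : ℝ) * t < ∑ j, (m - f (z j)))
      have h0 := Finset.sum_nonneg (f := fun z : Fin b → Y => ∏ j, P (z j))
        (s := (univ.filter fun z : Fin b → Y => (b : ℝ) * t < ∑ j, (f (z j) - m)) ∩
          (univ.filter fun z : Fin b → Y => (b : ℝ) * t < ∑ j, (m - f (z j))))
        fun z _ => hnn z
      linarith

end Chernoff

end DSAC

namespace DSAC

open Finset
namespace Problem

variable {ι : Type*} [Fintype ι] [DecidableEq ι] {S A : ι → Type*}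
  [∀ i, Fintype (S i)] [∀ i, DecidableEq (S i)] [∀ i, Fintype (A i)] [∀ i, DecidableEq (A i)]
  {p : ι → ℕ} {d : ℕ} {γ : ℝ}

/-! ### The Markov chain of state-action pairs -/

section Kernel

variable (G : Problem S A p d γ) (θ : Param p)

/-- The transition matrix of the chain of state-action pairs under `π_θ`. -/
noncomputable def kernel : Matrix (Joint S × Joint A) (Joint S × Joint A) ℝ :=
  fun x y => G.trans x.1 x.2 y.1 * G.policy θ y.1 y.2

/-- The distribution of the first state-action pair under `π_θ`. -/
noncomputable def initSA (x : Joint S × Joint A) : ℝ := G.init x.1 * G.policy θ x.1 x.2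

theorem policy_nonneg (s : Joint S) (a : Joint A) : 0 ≤ G.policy θ s a :=
  Finset.prod_nonneg fun i _ => G.pol_nonneg i _ s _

theorem sum_policy (s : Joint S) : ∑ a, G.policy θ s a = 1 := by
  have := Finset.prod_univ_sum (fun i => (univ : Finset (A i))) (fun i x => G.pol i (θ i) s x)
  rw [Fintype.piFinset_univ] at this
  simp only [policy]
  rw [← this]
  exact Finset.prod_eq_one fun i _ => G.pol_sum i _ s

theorem kernel_nonneg (x y : Joint S × Joint A) : 0 ≤ G.kernel θ x y :=
  mul_nonneg (G.trans_nonneg _ _ _) (G.policy_nonneg θ _ _)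

theorem sum_kernel (x : Joint S × Joint A) : ∑ y, G.kernel θ x y = 1 := by
  rw [Fintype.sum_prod_type]
  simp_rw [kernel, ← Finset.mul_sum, sum_policy, mul_one]
  exact G.trans_sum _ _

theorem initSA_nonneg (x : Joint S × Joint A) : 0 ≤ G.initSA θ x :=
  mul_nonneg (G.init_nonneg _) (G.policy_nonneg θ _ _)

theorem sum_initSA : ∑ x, G.initSA θ x = 1 := by
  rw [Fintype.sum_prod_type]
  simp_rw [initSA, ← Finset.mul_sum, sum_policy, mul_one]
  exact G.init_sum

theorem kernel_pow_nonneg (t : ℕ) (x y : Joint S × Joint A) : 0 ≤ (G.kernel θ ^ t) x y := by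
  induction t generalizing x y with
  | zero => rw [pow_zero, Matrix.one_apply]; split_ifs <;> norm_num
  | succ t ih =>
    rw [pow_succ, Matrix.mul_apply]
    exact Finset.sum_nonneg fun z _ => mul_nonneg (ih _ _) (G.kernel_nonneg θ _ _)

theorem sum_kernel_pow (t : ℕ) (x : Joint S × Joint A) : ∑ y, (G.kernel θ ^ t) x y = 1 := by
  induction t generalizing x with
  | zero => simp [Matrix.one_apply]
  | succ t ih =>
    simp_rw [pow_succ', Matrix.mul_apply]
    rw [Finset.sum_comm]
    simp_rw [← Finset.mul_sum, ih, mul_one]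
    exact G.sum_kernel θ x

theorem kernel_pow_le_one (t : ℕ) (x y : Joint S × Joint A) : (G.kernel θ ^ t) x y ≤ 1 :=
  (Finset.single_le_sum (fun z _ => G.kernel_pow_nonneg θ t x z) (Finset.mem_univ y)).trans_eq
    (G.sum_kernel_pow θ t x)

theorem saDist_eq (q : Joint S × Joint A → ℝ) (t : ℕ) (y : Joint S × Joint A) :
    G.saDist θ q t y = ∑ x, q x * (G.kernel θ ^ t) x y := by
  induction t generalizing y with
  | zero => simp [saDist, Matrix.one_apply]
  | succ t ih =>
    simp_rw [saDist, ih, pow_succ, Matrix.mul_apply, Finset.mul_sum, Finset.sum_mul, kernel]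
    rw [Finset.sum_comm]
    simp_rw [mul_assoc]

/-- The probability that `(s^t, a^t) = y`. -/
noncomputable def saProb (t : ℕ) (y : Joint S × Joint A) : ℝ :=
  ∑ x, G.initSA θ x * (G.kernel θ ^ t) x y

theorem saProb_nonneg (t : ℕ) (y : Joint S × Joint A) : 0 ≤ G.saProb θ t y :=
  Finset.sum_nonneg fun x _ => mul_nonneg (G.initSA_nonneg θ x) (G.kernel_pow_nonneg θ t x y)

theorem sum_saProb (t : ℕ) : ∑ y, G.saProb θ t y = 1 := by
  simp_rw [saProb]
  rw [Finset.sum_comm]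
  simp_rw [← Finset.mul_sum, sum_kernel_pow, mul_one, sum_initSA]

theorem saProb_le_one (t : ℕ) (y : Joint S × Joint A) : G.saProb θ t y ≤ 1 :=
  (Finset.single_le_sum (fun z _ => G.saProb_nonneg θ t z) (Finset.mem_univ y)).trans_eq
    (G.sum_saProb θ t)

theorem trajProb_eq {h : ℕ} (y : Trajectory S A h) :
    G.trajProb θ y = pathWeight (G.kernel θ) (G.initSA θ) h y := by
  simp only [trajProb, pathWeight, kernel, initSA, Finset.prod_mul_distrib]
  rw [Fin.prod_univ_succ]
  ring

theorem trajProb_nonneg {h : ℕ} (y : Trajectory S A h) : 0 ≤ G.trajProb θ y := by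
  rw [trajProb_eq]
  exact mul_nonneg (G.initSA_nonneg θ _) (Finset.prod_nonneg fun t _ => G.kernel_nonneg θ _ _)

theorem sum_trajProb (h : ℕ) : ∑ y : Trajectory S A h, G.trajProb θ y = 1 := by
  simp_rw [trajProb_eq]
  rw [sum_pathWeight _ (G.sum_kernel θ), sum_initSA]

end Kernel

/-! ### Discounted series and their tails -/

section Discount

variable (hγ : 0 ≤ γ) (hγ' : γ < 1)

include hγ hγ'

theorem summable_discount {a : ℕ → ℝ} (h0 : ∀ t, 0 ≤ a t) (h1 : ∀ t, a t ≤ 1) :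
    Summable fun t => γ ^ t * a t :=
  (summable_geometric_of_lt_one hγ hγ').of_nonneg_of_le
    (fun t => mul_nonneg (pow_nonneg hγ t) (h0 t))
    fun t => mul_le_of_le_one_right (pow_nonneg hγ t) (h1 t)

theorem tsum_sub_sum_discount {a : ℕ → ℝ} (h0 : ∀ t, 0 ≤ a t) (h1 : ∀ t, a t ≤ 1) (n : ℕ) :
    0 ≤ ∑' t, γ ^ t * a t - ∑ t ∈ range n, γ ^ t * a t ∧
      ∑' t, γ ^ t * a t - ∑ t ∈ range n, γ ^ t * a t ≤ γ ^ n / (1 - γ) := by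
  have hs := summable_discount hγ hγ' h0 h1
  have hg := (summable_geometric_of_lt_one hγ hγ').mul_left (γ ^ n)
  rw [← hs.sum_add_tsum_nat_add n, add_sub_cancel_left]
  refine ⟨tsum_nonneg fun t => mul_nonneg (pow_nonneg hγ _) (h0 _), ?_⟩
  rw [div_eq_mul_inv, ← tsum_geometric_of_lt_one hγ hγ', ← tsum_mul_left]
  refine ((summable_nat_add_iff n).mpr hs).tsum_le_tsum (fun t => ?_) hg
  rw [← pow_add, add_comm n]
  exact mul_le_of_le_one_right (pow_nonneg hγ _) (h1 _)

theorem sum_range_geom_le (n : ℕ) : ∑ t ∈ range n, γ ^ t ≤ 1 / (1 - γ) := by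
  rw [one_div, ← tsum_geometric_of_lt_one hγ hγ']
  exact (summable_geometric_of_lt_one hγ hγ').sum_le_tsum _ fun t _ => pow_nonneg hγ t

end Discount

/-! ### Occupancy measure, resolvent and Q functions -/

section Occupancy

variable (G : Problem S A p d γ) (θ : Param p)

theorem occ_eq (y : Joint S × Joint A) : G.occ θ y = ∑' t : ℕ, γ ^ t * G.saProb θ t y := by
  simp only [occ, saDist_eq, saProb, initSA]

/-- The discounted number of visits to `y` of the chain that starts in `x`. -/
noncomputable def resolvent (x y : Joint S × Joint A) : ℝ :=
  ∑' t : ℕ, γ ^ t * (G.kernel θ ^ t) x y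

variable {G} (hγ : 0 ≤ γ) (hγ' : γ < 1)

include hγ hγ'

theorem occ_nonneg (y : Joint S × Joint A) : 0 ≤ G.occ θ y := by
  rw [occ_eq]
  exact tsum_nonneg fun t => mul_nonneg (pow_nonneg hγ t) (G.saProb_nonneg θ t y)

theorem sum_occ : ∑ y, G.occ θ y = 1 / (1 - γ) := by
  simp_rw [occ_eq]
  rw [← Summable.tsum_finsetSum fun y _ => summable_discount hγ hγ'
    (fun t => G.saProb_nonneg θ t y) (fun t => G.saProb_le_one θ t y)]
  simp_rw [← Finset.mul_sum, sum_saProb, mul_one]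
  rw [tsum_geometric_of_lt_one hγ hγ', one_div]

theorem resolvent_nonneg (x y : Joint S × Joint A) : 0 ≤ G.resolvent θ x y :=
  tsum_nonneg fun t => mul_nonneg (pow_nonneg hγ t) (G.kernel_pow_nonneg θ t x y)

theorem sum_resolvent (x : Joint S × Joint A) : ∑ y, G.resolvent θ x y = 1 / (1 - γ) := by
  simp_rw [resolvent]
  rw [← Summable.tsum_finsetSum fun y _ => summable_discount hγ hγ'
    (fun t => G.kernel_pow_nonneg θ t x y) (fun t => G.kernel_pow_le_one θ t x y)]
  simp_rw [← Finset.mul_sum, sum_kernel_pow, mul_one]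
  rw [tsum_geometric_of_lt_one hγ hγ', one_div]

/-- Exchanging the series with the finite sum makes the Q function a finite linear form in the
reward. Errors in the coefficients and errors in the reward can then be estimated separately. -/
theorem qValue_eq (r : Joint S × Joint A → ℝ) (x : Joint S × Joint A) :
    G.qValue θ r x = ∑ y, G.resolvent θ x y * r y := by
  simp_rw [qValue, saDist_eq, resolvent, ← tsum_mul_right]
  rw [← Summable.tsum_finsetSum fun y _ => (summable_discount hγ hγ'
    (fun t => G.kernel_pow_nonneg θ t x y) (fun t => G.kernel_pow_le_one θ t x y)).mul_right _]
  simp [Finset.mul_sum, mul_assoc]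

theorem abs_qValue_le {r : Joint S × Joint A → ℝ} {C : ℝ} (hr : ∀ y, |r y| ≤ C)
    (x : Joint S × Joint A) : |G.qValue θ r x| ≤ C / (1 - γ) := by
  rw [qValue_eq θ hγ hγ']
  calc |∑ y, G.resolvent θ x y * r y| ≤ ∑ y, |G.resolvent θ x y * r y| :=
        Finset.abs_sum_le_sum_abs _ _
    _ ≤ ∑ y, G.resolvent θ x y * C := Finset.sum_le_sum fun y _ => by
        rw [abs_mul, abs_of_nonneg (resolvent_nonneg θ hγ hγ' x y)]
        exact mul_le_mul_of_nonneg_left (hr y) (resolvent_nonneg θ hγ hγ' x y)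
    _ = C / (1 - γ) := by rw [← Finset.sum_mul, sum_resolvent θ hγ hγ']; ring

end Occupancy

/-! ### Local marginals and the region of bounded mass -/

section Marginal

theorem marg_apply (i : ι) (v : EuclideanSpace ℝ (Joint S × Joint A)) (z : S i × A i) :
    marg i v z = ∑ y : Joint S × Joint A, if y.1 i = z.1 ∧ y.2 i = z.2 then v y else 0 := rfl

/-- Marginalization as a linear map. -/
noncomputable def margL (i : ι) :
    EuclideanSpace ℝ (Joint S × Joint A) →L[ℝ] EuclideanSpace ℝ (S i × A i) :=
  LinearMap.toContinuousLinearMap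
    { toFun := marg i
      map_add' := fun v w => by
        ext z
        simp [marg_apply, ← Finset.sum_add_distrib, ite_add_ite]
      map_smul' := fun c v => by
        ext z
        simp [marg_apply, Finset.mul_sum] }

theorem margL_apply (i : ι) (v : EuclideanSpace ℝ (Joint S × Joint A)) : margL i v = marg i v := rfl

theorem sum_marg_mul (i : ι) (v : EuclideanSpace ℝ (Joint S × Joint A)) (f : S i × A i → ℝ) :
    ∑ z, marg i v z * f z = ∑ y, v y * f (y.1 i, y.2 i) := by
  simp_rw [marg_apply, Finset.sum_mul, ite_mul, zero_mul]
  rw [Finset.sum_comm]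
  refine Finset.sum_congr rfl fun y _ => ?_
  rw [Finset.sum_eq_single (y.1 i, y.2 i)]
  · simp
  · intro z _ hz
    rw [if_neg]
    rintro ⟨h1, h2⟩
    exact hz (Prod.ext h1.symm h2.symm)
  · simp

theorem sum_marg (i : ι) (v : EuclideanSpace ℝ (Joint S × Joint A)) :
    ∑ z, marg i v z = ∑ y, v y := by
  simpa using sum_marg_mul i v fun _ => 1

theorem norm_le_sum_abs {X : Type*} [Fintype X] (v : EuclideanSpace ℝ X) : ‖v‖ ≤ ∑ z, |v z| := by
  have h0 : 0 ≤ ∑ z, |v z| := Finset.sum_nonneg fun z _ => abs_nonneg _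
  rw [← abs_of_nonneg (norm_nonneg v), ← abs_of_nonneg h0, ← sq_le_sq, EuclideanSpace.norm_sq_eq]
  exact Finset.sum_sq_le_sq_sum_of_nonneg fun z _ => abs_nonneg _

theorem norm_marg_le (i : ι) (v : EuclideanSpace ℝ (Joint S × Joint A)) :
    ‖marg i v‖ ≤ ∑ y, |v y| := by
  refine (norm_le_sum_abs _).trans ?_
  calc ∑ z, |marg i v z| ≤ ∑ z, marg i (WithLp.toLp 2 fun y => |v y|) z :=
        Finset.sum_le_sum fun z _ => (Finset.abs_sum_le_sum_abs _ _).trans_eq <|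
          Finset.sum_congr rfl fun y _ => by split_ifs <;> simp
    _ = ∑ y, |v y| := sum_marg i _

theorem marg_mem_massRegion (i : ι) {v : EuclideanSpace ℝ (Joint S × Joint A)} (h0 : ∀ y, 0 ≤ v y)
    (h1 : ∑ y, v y ≤ 1 / (1 - γ)) : marg i v ∈ massRegion i S A γ := by
  refine ⟨fun z => Finset.sum_nonneg fun y _ => ?_, (sum_marg i v).trans_le h1⟩
  split_ifs
  · exact h0 y
  · exact le_rfl

theorem convex_massRegion (i : ι) : Convex ℝ (massRegion i S A γ) := by
  intro v hv w hw a b ha hb hab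
  refine ⟨fun z => ?_, ?_⟩
  · have := mul_nonneg ha (hv.1 z)
    have := mul_nonneg hb (hw.1 z)
    simpa using by linarith
  · have := mul_le_mul_of_nonneg_left hv.2 ha
    have := mul_le_mul_of_nonneg_left hw.2 hb
    simp only [PiLp.add_apply, PiLp.smul_apply, smul_eq_mul, Finset.sum_add_distrib,
      ← Finset.mul_sum]
    calc _ ≤ a * (1 / (1 - γ)) + b * (1 / (1 - γ)) := by linarith
      _ = _ := by rw [← add_mul, hab, one_mul]

theorem locOcc_mem_massRegion {G : Problem S A p d γ} (hγ : 0 ≤ γ) (hγ' : γ < 1) (θ : Param p)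
    (i : ι) : G.locOcc θ i ∈ massRegion i S A γ :=
  marg_mem_massRegion i (occ_nonneg θ hγ hγ') (sum_occ θ hγ hγ').le

theorem norm_sub_le_of_mem_massRegion {i : ι} {v w : EuclideanSpace ℝ (S i × A i)}
    (hv : v ∈ massRegion i S A γ) (hw : w ∈ massRegion i S A γ) : ‖v - w‖ ≤ 2 / (1 - γ) := by
  calc ‖v - w‖ ≤ ‖v‖ + ‖w‖ := norm_sub_le _ _
    _ ≤ ∑ z, |v z| + ∑ z, |w z| := add_le_add (norm_le_sum_abs v) (norm_le_sum_abs w)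
    _ = ∑ z, v z + ∑ z, w z := by
      congr 1 <;> refine Finset.sum_congr rfl fun z _ => abs_of_nonneg ?_
      exacts [hv.1 z, hw.1 z]
    _ ≤ 1 / (1 - γ) + 1 / (1 - γ) := add_le_add hv.2 hw.2
    _ = 2 / (1 - γ) := by ring

end Marginal

end Problem
end DSAC

/-! ### Smoothness of the utilities and of the objective -/

namespace DSAC

open Finset

section Gradient

variable {E : Type*} [NormedAddCommGroup E] [InnerProductSpace ℝ E] [CompleteSpace E]

theorem norm_gradient (f : E → ℝ) (x : E) : ‖gradient f x‖ = ‖fderiv ℝ f x‖ :=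
  LinearIsometryEquiv.norm_map _ _

theorem gradient_euclidean_apply {X : Type*} [Fintype X] [DecidableEq X]
    (f : EuclideanSpace ℝ X → ℝ) (v : EuclideanSpace ℝ X) (x : X) :
    gradient f v x = fderiv ℝ f v (EuclideanSpace.single x 1) := by
  have h : inner ℝ (gradient f v) (EuclideanSpace.single x (1 : ℝ)) =
      fderiv ℝ f v (EuclideanSpace.single x 1) := inner_gradient_left
  rw [← h, EuclideanSpace.inner_single_right]
  simp

/-- A function with Lipschitz gradient is bounded below by its quadratic model. -/
theorem quadratic_lower_bound {f : E → ℝ} (hf : Differentiable ℝ f) {L : ℝ}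
    (hL : ∀ x y, ‖gradient f x - gradient f y‖ ≤ L * ‖x - y‖) (x v : E) :
    f x + inner ℝ (gradient f x) v - L / 2 * ‖v‖ ^ 2 ≤ f (x + v) := by
  -- The claim compares `g 0` with `g 1`. The derivative of `g` is `⟪∇f(x + t v) - ∇f(x), v⟫ + L t
  -- ‖v‖²`, which is nonnegative by Cauchy-Schwarz and the Lipschitz bound.
  let g : ℝ → ℝ := fun t => f (x + t • v) - t * inner ℝ (gradient f x) v + L / 2 * t ^ 2 * ‖v‖ ^ 2
  have hd (t : ℝ) : HasDerivAt g
      (inner ℝ (gradient f (x + t • v)) v - 1 * inner ℝ (gradient f x) v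
        + L / 2 * (2 * t) * ‖v‖ ^ 2) t := by
    have h1 : HasDerivAt (fun t : ℝ => x + t • v) v t := by
      simpa using ((hasDerivAt_id t).smul_const v).const_add x
    have h2 := (hf (x + t • v)).hasFDerivAt.comp_hasDerivAt t h1
    rw [← inner_gradient_left] at h2
    refine (h2.sub ((hasDerivAt_id t).mul_const _)).add ?_
    have := (((hasDerivAt_pow 2 t).const_mul (L / 2)).mul_const (‖v‖ ^ 2))
    simpa using this
  have hmono : MonotoneOn g (Set.Icc 0 1) := by
    refine monotoneOn_of_deriv_nonneg (convex_Icc 0 1)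
      (fun t _ => (hd t).continuousAt.continuousWithinAt)
      (fun t _ => (hd t).differentiableAt.differentiableWithinAt) fun t ht => ?_
    rw [interior_Icc] at ht
    rw [(hd t).deriv, one_mul, ← inner_sub_left]
    have h1 := abs_real_inner_le_norm (gradient f (x + t • v) - gradient f x) v
    have h2 := hL (x + t • v) x
    rw [add_sub_cancel_left, norm_smul, Real.norm_of_nonneg ht.1.le] at h2
    have h3 := mul_le_mul_of_nonneg_right h2 (norm_nonneg v)
    have h4 := neg_le_of_abs_le h1
    nlinarith
  have := hmono (Set.left_mem_Icc.mpr zero_le_one) (Set.right_mem_Icc.mpr zero_le_one) zero_le_one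
  simp only [g, zero_smul, add_zero, one_smul] at this
  linarith

end Gradient

namespace Problem

variable {ι : Type*} [Fintype ι] [DecidableEq ι] {S A : ι → Type*}
  [∀ i, Fintype (S i)] [∀ i, DecidableEq (S i)] [∀ i, Fintype (A i)] [∀ i, DecidableEq (A i)]
  {p : ι → ℕ} {d : ℕ}

variable {K : Constants} {G : Problem S A p d K.γ} {W : ℝ}

theorem hasFDerivAt_globalUtil (hG : G.Assumptions K W)
    {v : EuclideanSpace ℝ (Joint S × Joint A)} (hv : ∀ i, marg i v ∈ massRegion i S A K.γ) :
    HasFDerivAt G.globalUtil ((1 / (Fintype.card ι : ℝ)) •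
      ∑ i, (fderiv ℝ (G.util i) (marg i v)).comp (margL i)) v := by
  refine HasFDerivAt.const_mul (HasFDerivAt.fun_sum fun i _ => ?_) _
  exact HasFDerivAt.comp (g := G.util i) v (hG.util_diff i _ (hv i)).hasFDerivAt
    (margL i).hasFDerivAt

theorem gradient_globalUtil_apply (hG : G.Assumptions K W)
    {v : EuclideanSpace ℝ (Joint S × Joint A)} (hv : ∀ i, marg i v ∈ massRegion i S A K.γ)
    (y : Joint S × Joint A) :
    gradient G.globalUtil v y =
      (1 / (Fintype.card ι : ℝ)) * ∑ i, gradient (G.util i) (marg i v) (y.1 i, y.2 i) := by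
  rw [gradient_euclidean_apply, (hasFDerivAt_globalUtil hG hv).fderiv]
  simp only [_root_.smul_apply, _root_.sum_apply, smul_eq_mul,
    ContinuousLinearMap.comp_apply]
  congr 1
  refine Finset.sum_congr rfl fun i _ => ?_
  rw [gradient_euclidean_apply]
  congr 1
  ext z
  rw [margL_apply, marg_apply, Finset.sum_eq_single y]
  · simp [Prod.ext_iff, eq_comm]
  · intro b _ hb
    simp [hb]
  · simp

/-- By the chain rule the gradient of `F` averages the local gradients, and Q functions are linear
in the reward. The bounds assumed for the shadow Q function thereby apply to the average of the
local ones, which is what determines the optimal critic. -/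
theorem shadowQ_eq (hG : G.Assumptions K W) (θ : Param p) (x : Joint S × Joint A) :
    G.shadowQ θ x = (1 / (Fintype.card ι : ℝ)) * ∑ i, G.locShadowQ θ i x := by
  simp_rw [shadowQ, locShadowQ, qValue_eq θ K.γ_nonneg K.γ_lt_one,
    gradient_globalUtil_apply hG fun i => locOcc_mem_massRegion K.γ_nonneg K.γ_lt_one θ i]
  rw [Finset.sum_comm, Finset.mul_sum]
  refine Finset.sum_congr rfl fun y _ => ?_
  rw [← Finset.mul_sum, mul_left_comm]
  rfl

theorem abs_locShadowQ_le (hG : G.Assumptions K W) (θ : Param p) (i : ι) (x : Joint S × Joint A) :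
    |G.locShadowQ θ i x| ≤ K.C_F / (1 - K.γ) :=
  abs_qValue_le θ K.γ_nonneg K.γ_lt_one (fun _ => hG.util_bound θ i _) x

variable (S A K) in
/-- A Lipschitz constant of the local utilities on the set of nonnegative vectors of mass at most
`1 / (1 - γ)`. -/
noncomputable def utilLip : ℝ :=
  (∑ i, (Fintype.card (S i × A i) : ℝ)) * (K.C_F + K.L_lam * (2 / (1 - K.γ)))

omit [DecidableEq ι] [∀ i, DecidableEq (S i)] [∀ i, DecidableEq (A i)] in
theorem utilLip_nonneg : 0 ≤ utilLip S A K := by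
  have := K.C_F_pos
  have := K.L_lam_pos
  have : 0 < 1 - K.γ := by linarith [K.γ_lt_one]
  exact mul_nonneg (Finset.sum_nonneg fun i _ => Nat.cast_nonneg _) (by positivity)

/-- The bound `C_F` is assumed only at occupancy measures. The region has diameter at most `2 / (1 -
γ)`, so the Lipschitz bound carries it from one occupancy measure to the whole region; the parameter
`0` is an arbitrary reference. -/
theorem norm_gradient_util_le (hG : G.Assumptions K W) (i : ι) {v : EuclideanSpace ℝ (S i × A i)}
    (hv : v ∈ massRegion i S A K.γ) : ‖gradient (G.util i) v‖ ≤ utilLip S A K := by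
  have h1 : 0 < 1 - K.γ := by linarith [K.γ_lt_one]
  have hC := K.C_F_pos
  have hL := K.L_lam_pos
  have hθ := locOcc_mem_massRegion (G := G) K.γ_nonneg K.γ_lt_one 0 i
  calc ‖gradient (G.util i) v‖ ≤ ∑ z, |gradient (G.util i) v z| := norm_le_sum_abs _
    _ ≤ ∑ z : S i × A i, (K.C_F + K.L_lam * (2 / (1 - K.γ))) := by
        refine Finset.sum_le_sum fun z _ => ?_
        have h2 := hG.util_bound 0 i z
        have h3 := (hG.util_lip i v hv _ hθ z).trans
          (mul_le_mul_of_nonneg_left (norm_sub_le_of_mem_massRegion hv hθ) hL.le)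
        have h4 := abs_sub_abs_le_abs_sub (gradient (G.util i) v z)
          (gradient (G.util i) (G.locOcc 0 i) z)
        linarith
    _ = (Fintype.card (S i × A i) : ℝ) * (K.C_F + K.L_lam * (2 / (1 - K.γ))) := by
        rw [Finset.sum_const, Finset.card_univ, nsmul_eq_mul]
    _ ≤ _ := mul_le_mul_of_nonneg_right
        (Finset.single_le_sum (f := fun i => (Fintype.card (S i × A i) : ℝ))
          (fun i _ => Nat.cast_nonneg _) (Finset.mem_univ i)) (by positivity)

theorem abs_util_sub_le (hG : G.Assumptions K W) (i : ι) {v v' : EuclideanSpace ℝ (S i × A i)}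
    (hv : v ∈ massRegion i S A K.γ) (hv' : v' ∈ massRegion i S A K.γ) :
    |G.util i v - G.util i v'| ≤ utilLip S A K * ‖v - v'‖ := by
  refine (convex_massRegion i).norm_image_sub_le_of_norm_fderiv_le (𝕜 := ℝ) (hG.util_diff i)
    (fun x hx => ?_) hv' hv
  rw [← norm_gradient]
  exact norm_gradient_util_le hG i hx

theorem abs_objective_sub_le [Nonempty ι] (hG : G.Assumptions K W) (θ θ' : Param p) :
    |G.objective θ - G.objective θ'| ≤ utilLip S A K * ∑ y, |G.occ θ y - G.occ θ' y| := by
  have hN : (0 : ℝ) < Fintype.card ι := by exact_mod_cast Fintype.card_pos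
  have hi (i : ι) : |G.util i (marg i (G.occ θ)) - G.util i (marg i (G.occ θ'))| ≤
      utilLip S A K * ∑ y, |G.occ θ y - G.occ θ' y| := by
    refine (abs_util_sub_le hG i (locOcc_mem_massRegion K.γ_nonneg K.γ_lt_one θ i)
      (locOcc_mem_massRegion K.γ_nonneg K.γ_lt_one θ' i)).trans
      (mul_le_mul_of_nonneg_left ?_ utilLip_nonneg)
    have := norm_marg_le i (G.occ θ - G.occ θ')
    rwa [← margL_apply, map_sub] at this
  rw [objective, objective, globalUtil, globalUtil, ← mul_sub, ← Finset.sum_sub_distrib, abs_mul,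
    abs_of_nonneg (by positivity)]
  calc _ ≤ 1 / (Fintype.card ι : ℝ) * ∑ i : ι, utilLip S A K * ∑ y, |G.occ θ y - G.occ θ' y| := by
        refine mul_le_mul_of_nonneg_left ?_ (by positivity)
        exact (Finset.abs_sum_le_sum_abs _ _).trans (Finset.sum_le_sum fun i _ => hi i)
    _ = _ := by
        rw [Finset.sum_const, Finset.card_univ, nsmul_eq_mul]
        field_simp

theorem abs_objective_sub_le_const [Nonempty ι] (hG : G.Assumptions K W) (θ θ' : Param p) :
    |G.objective θ - G.objective θ'| ≤ utilLip S A K * (2 / (1 - K.γ)) := by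
  refine (abs_objective_sub_le hG θ θ').trans (mul_le_mul_of_nonneg_left ?_ utilLip_nonneg)
  calc ∑ y, |G.occ θ y - G.occ θ' y| ≤ ∑ y, (G.occ θ y + G.occ θ' y) := by
        refine Finset.sum_le_sum fun y _ => ?_
        have h1 := occ_nonneg (G := G) θ K.γ_nonneg K.γ_lt_one y
        have h2 := occ_nonneg (G := G) θ' K.γ_nonneg K.γ_lt_one y
        rw [abs_le]; constructor <;> linarith
    _ = 2 / (1 - K.γ) := by
        rw [Finset.sum_add_distrib, sum_occ θ K.γ_nonneg K.γ_lt_one,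
          sum_occ θ' K.γ_nonneg K.γ_lt_one]
        ring

/-- The entrywise Lipschitz bound on the occupancy measure makes the objective Lipschitz. This a
priori estimate handles the regime in which `ε` is not small. -/
theorem norm_gradient_objective_le [Nonempty ι] (hG : G.Assumptions K W) (θ : Param p) :
    ‖gradient G.objective θ‖ ≤
      utilLip S A K * (Fintype.card (Joint S × Joint A) * K.l_lam) := by
  have hl := K.l_lam_pos
  rw [norm_gradient]
  refine norm_fderiv_le_of_lip' ℝ (mul_nonneg utilLip_nonneg (by positivity))
    (Filter.Eventually.of_forall fun θ' => ?_)
  rw [mul_assoc]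
  refine (abs_objective_sub_le hG θ' θ).trans (mul_le_mul_of_nonneg_left ?_ utilLip_nonneg)
  refine (Finset.sum_le_sum fun y _ => hG.occ_entry_lip θ' θ y).trans_eq ?_
  rw [Finset.sum_const, Finset.card_univ, nsmul_eq_mul, mul_assoc]

end Problem
end DSAC

/-! ### The linear critic as a least squares problem -/

namespace DSAC

open Finset

section LeastSquares

variable {X E : Type*} [Fintype X] [NormedAddCommGroup E] [InnerProductSpace ℝ E]

/-- The weighted covariance operator `∑ v(x) φ(x) φ(x)ᵀ` of the features. -/
noncomputable def featCov (φ : X → E) (v : X → ℝ) : E →ₗ[ℝ] E where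
  toFun w := ∑ x, (v x * inner ℝ (φ x) w) • φ x
  map_add' w u := by
    simp only [inner_add_right, mul_add, add_smul, Finset.sum_add_distrib]
  map_smul' c w := by
    simp only [inner_smul_right, RingHom.id_apply, Finset.smul_sum, smul_smul]
    exact Finset.sum_congr rfl fun x _ => by ring_nf

/-- The weighted sum `∑ v(x) φ(x)` of the features. -/
noncomputable def featSum (φ : X → E) (v : X → ℝ) : E := ∑ x, v x • φ x

theorem featCov_apply (φ : X → E) (v : X → ℝ) (w : E) :
    featCov φ v w = ∑ x, (v x * inner ℝ (φ x) w) • φ x := rfl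

theorem inner_featCov (φ : X → E) (v : X → ℝ) (w u : E) :
    inner ℝ (featCov φ v w) u = ∑ x, v x * inner ℝ (φ x) w * inner ℝ (φ x) u := by
  simp [featCov_apply, sum_inner, inner_smul_left]

theorem inner_featSum (φ : X → E) (v : X → ℝ) (u : E) :
    inner ℝ (featSum φ v) u = ∑ x, v x * inner ℝ (φ x) u := by
  simp [featSum, sum_inner, inner_smul_left]

theorem featCov_sub (φ : X → E) (v v' : X → ℝ) (w : E) :
    featCov φ v w - featCov φ v' w = featCov φ (fun x => v x - v' x) w := by
  simp only [featCov_apply, sub_mul, sub_smul, Finset.sum_sub_distrib]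

theorem featSum_sub (φ : X → E) (v v' : X → ℝ) :
    featSum φ v - featSum φ v' = featSum φ (fun x => v x - v' x) := by
  simp only [featSum, sub_smul, Finset.sum_sub_distrib]

variable {φ : X → E} {C : ℝ}

theorem norm_featSum_le (hφ : ∀ x, ‖φ x‖ ≤ C) (v : X → ℝ) :
    ‖featSum φ v‖ ≤ (∑ x, |v x|) * C := by
  rw [Finset.sum_mul]
  refine (norm_sum_le _ _).trans (Finset.sum_le_sum fun x _ => ?_)
  rw [norm_smul, Real.norm_eq_abs]
  exact mul_le_mul_of_nonneg_left (hφ x) (abs_nonneg _)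

theorem abs_inner_feat_le (hφ : ∀ x, ‖φ x‖ ≤ C) (x : X) (w : E) : |inner ℝ (φ x) w| ≤ C * ‖w‖ :=
  (abs_real_inner_le_norm _ _).trans (mul_le_mul_of_nonneg_right (hφ x) (norm_nonneg w))

theorem norm_featCov_le (hφ : ∀ x, ‖φ x‖ ≤ C) (v : X → ℝ) (w : E) :
    ‖featCov φ v w‖ ≤ (∑ x, |v x|) * (C ^ 2 * ‖w‖) := by
  rw [Finset.sum_mul]
  refine (norm_sum_le _ _).trans (Finset.sum_le_sum fun x _ => ?_)
  rw [norm_smul, Real.norm_eq_abs, abs_mul, mul_assoc]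
  refine mul_le_mul_of_nonneg_left ?_ (abs_nonneg _)
  calc |inner ℝ (φ x) w| * ‖φ x‖ ≤ (C * ‖w‖) * C :=
        mul_le_mul (abs_inner_feat_le hφ x w) (hφ x) (norm_nonneg _)
          ((abs_nonneg _).trans (abs_inner_feat_le hφ x w))
    _ = _ := by ring

theorem inner_featCov_self_nonneg {v : X → ℝ} (hv : ∀ x, 0 ≤ v x) (w : E) :
    0 ≤ inner ℝ (featCov φ v w) w := by
  rw [inner_featCov]
  exact Finset.sum_nonneg fun x _ => by
    rw [mul_assoc]; exact mul_nonneg (hv x) (mul_self_nonneg _)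

/-- Cocoercivity of the covariance operator. -/
theorem norm_featCov_sq_le (hφ : ∀ x, ‖φ x‖ ≤ C) {v : X → ℝ} (hv : ∀ x, 0 ≤ v x) {s : ℝ}
    (hs : ∑ x, v x ≤ s) (w : E) :
    ‖featCov φ v w‖ ^ 2 ≤ C ^ 2 * s * inner ℝ (featCov φ v w) w := by
  have h1 : ‖featCov φ v w‖ ≤ C * ∑ x, v x * |inner ℝ (φ x) w| := by
    rw [Finset.mul_sum]
    refine (norm_sum_le _ _).trans (Finset.sum_le_sum fun x _ => ?_)
    rw [norm_smul, Real.norm_eq_abs, abs_mul, abs_of_nonneg (hv x), mul_comm C]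
    exact mul_le_mul_of_nonneg_left (hφ x) (mul_nonneg (hv x) (abs_nonneg _))
  have h2 : (∑ x, v x * |inner ℝ (φ x) w|) ^ 2 ≤
      (∑ x, v x) * ∑ x, v x * inner ℝ (φ x) w * inner ℝ (φ x) w := by
    refine Finset.sum_sq_le_sum_mul_sum_of_sq_le_mul _ (fun x _ => hv x)
      (fun x _ => ?_) fun x _ => le_of_eq ?_
    · rw [mul_assoc]; exact mul_nonneg (hv x) (mul_self_nonneg _)
    · rw [mul_pow, sq_abs]; ring
  rw [← inner_featCov] at h2
  calc ‖featCov φ v w‖ ^ 2 ≤ (C * ∑ x, v x * |inner ℝ (φ x) w|) ^ 2 := by gcongr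
    _ = C ^ 2 * (∑ x, v x * |inner ℝ (φ x) w|) ^ 2 := by ring
    _ ≤ C ^ 2 * ((∑ x, v x) * inner ℝ (featCov φ v w) w) := by gcongr
    _ ≤ C ^ 2 * (s * inner ℝ (featCov φ v w) w) := by
        gcongr
        exact inner_featCov_self_nonneg hv w
    _ = _ := by ring

/-- With the step `1 / (C² s)`, cocoercivity bounds the second-order term of the expanded square by
half of the cross term, so one full multiple of the inner product survives. For `s = 1 / (1 - γ)`
and `C = C_φ` this step is `1 / L_w`. -/
theorem norm_sub_smul_featCov_sq_le (hφ : ∀ x, ‖φ x‖ ≤ C) {v : X → ℝ} (hv : ∀ x, 0 ≤ v x) {s : ℝ}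
    (hs : ∑ x, v x ≤ s) (hL : 0 < C ^ 2 * s) (w : E) :
    ‖w - (1 / (C ^ 2 * s)) • featCov φ v w‖ ^ 2 ≤
      ‖w‖ ^ 2 - 1 / (C ^ 2 * s) * inner ℝ (featCov φ v w) w := by
  have h := norm_featCov_sq_le hφ hv hs w
  rw [norm_sub_sq_real, inner_smul_right, real_inner_comm, norm_smul, mul_pow, Real.norm_eq_abs,
    sq_abs]
  have : (1 / (C ^ 2 * s)) ^ 2 * ‖featCov φ v w‖ ^ 2 ≤
      (1 / (C ^ 2 * s)) ^ 2 * (C ^ 2 * s * inner ℝ (featCov φ v w) w) := by gcongr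
  have e : (1 / (C ^ 2 * s)) ^ 2 * (C ^ 2 * s * inner ℝ (featCov φ v w) w) =
      1 / (C ^ 2 * s) * inner ℝ (featCov φ v w) w := by
    field_simp
  linarith

theorem norm_sub_smul_featCov_le (hφ : ∀ x, ‖φ x‖ ≤ C) {v : X → ℝ} (hv : ∀ x, 0 ≤ v x) {s : ℝ}
    (hs : ∑ x, v x ≤ s) (hL : 0 < C ^ 2 * s) (w : E) :
    ‖w - (1 / (C ^ 2 * s)) • featCov φ v w‖ ≤ ‖w‖ := by
  rw [← abs_of_nonneg (norm_nonneg w), ← abs_of_nonneg (norm_nonneg (w - _)), ← sq_le_sq]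
  have := norm_sub_smul_featCov_sq_le hφ hv hs hL w
  have := mul_nonneg (one_div_pos.mpr hL).le (inner_featCov_self_nonneg (φ := φ) hv w)
  linarith

theorem bijective_featCov [FiniteDimensional ℝ E] {v : X → ℝ} {μ : ℝ} (hμ : 0 < μ)
    (h : ∀ w, μ * ‖w‖ ^ 2 ≤ inner ℝ (featCov φ v w) w) : Function.Bijective (featCov φ v) := by
  have hinj : Function.Injective (featCov φ v) := by
    rw [← LinearMap.ker_eq_bot, LinearMap.ker_eq_bot']
    intro w hw
    have := h w
    rw [hw, inner_zero_left] at this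
    have : ‖w‖ ^ 2 ≤ 0 := by
      by_contra hc
      push Not at hc
      have := mul_pos hμ hc
      linarith
    exact norm_eq_zero.mp (pow_eq_zero_iff two_ne_zero |>.mp (le_antisymm this (sq_nonneg _)))
  exact ⟨hinj, LinearMap.injective_iff_surjective.mp hinj⟩

theorem norm_le_of_coercive {v : X → ℝ} {μ : ℝ} (hμ : 0 < μ)
    (h : ∀ w, μ * ‖w‖ ^ 2 ≤ inner ℝ (featCov φ v w) w) (w : E) :
    ‖w‖ ≤ ‖featCov φ v w‖ / μ := by
  rw [le_div_iff₀ hμ]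
  rcases (norm_nonneg w).eq_or_lt with h0 | h0
  · rw [← h0]; simp
  · have := (h w).trans (real_inner_le_norm _ _)
    refine le_of_mul_le_mul_right ?_ h0
    linarith [this]

end LeastSquares

namespace Problem

variable {ι : Type*} [Fintype ι] [DecidableEq ι] {S A : ι → Type*}
  [∀ i, Fintype (S i)] [∀ i, DecidableEq (S i)] [∀ i, Fintype (A i)] [∀ i, DecidableEq (A i)]
  {p : ι → ℕ} {d : ℕ}

section

variable {γ : ℝ} (G : Problem S A p d γ)

/-- The feature map on state-action pairs. -/
def featSA (x : Joint S × Joint A) : EuclideanSpace ℝ (Fin d) := G.feat x.1 x.2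

/-- The average of the local shadow Q functions. -/
noncomputable def avgQ (θ : Param p) (x : Joint S × Joint A) : ℝ :=
  (1 / (Fintype.card ι : ℝ)) * ∑ i, G.locShadowQ θ i x

theorem critic_add (w u : EuclideanSpace ℝ (Fin d)) (x : Joint S × Joint A) :
    G.critic (w + u) x = G.critic w x + G.critic u x := inner_add_right _ _ _

theorem critic_eq (w : EuclideanSpace ℝ (Fin d)) (x : Joint S × Joint A) :
    G.critic w x = inner ℝ (G.featSA x) w := rfl

/-- The second-order expansion is exact because the objective is quadratic. The linear term sees the
local Q functions only through their average, and the Hessian does not see them at all. -/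
theorem avg_locCriticObj_add [Nonempty ι] (θ : Param p) (w u : EuclideanSpace ℝ (Fin d)) :
    (1 / (Fintype.card ι : ℝ)) * ∑ i, G.locCriticObj θ i (w + u) =
      (1 / (Fintype.card ι : ℝ)) * ∑ i, G.locCriticObj θ i w +
      inner ℝ (featCov G.featSA (G.occ θ) w - featSum G.featSA fun x => G.occ θ x * G.avgQ θ x) u +
      1 / 2 * inner ℝ (featCov G.featSA (G.occ θ) u) u := by
  have hN : (Fintype.card ι : ℝ) ≠ 0 := by exact_mod_cast Fintype.card_ne_zero
  have key (x : Joint S × Joint A) :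
      (1 / (Fintype.card ι : ℝ)) * ∑ i, (1 / 2) * (G.occ θ x *
        (G.critic (w + u) x - G.locShadowQ θ i x) ^ 2) =
      (1 / (Fintype.card ι : ℝ)) * ∑ i, (1 / 2) * (G.occ θ x *
        (G.critic w x - G.locShadowQ θ i x) ^ 2) +
      (G.occ θ x * G.critic w x * G.critic u x - G.occ θ x * G.avgQ θ x * G.critic u x) +
      1 / 2 * (G.occ θ x * G.critic u x * G.critic u x) := by
    have h (i : ι) : (1 / 2) * (G.occ θ x * (G.critic (w + u) x - G.locShadowQ θ i x) ^ 2) =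
        (1 / 2) * (G.occ θ x * (G.critic w x - G.locShadowQ θ i x) ^ 2) +
        ((G.occ θ x * G.critic w x * G.critic u x + 1 / 2 * (G.occ θ x * G.critic u x * G.critic u x))
        - G.occ θ x * G.critic u x * G.locShadowQ θ i x) := by
      rw [critic_add]; ring
    simp_rw [h]
    rw [Finset.sum_add_distrib, Finset.sum_sub_distrib, Finset.sum_const, Finset.card_univ,
      nsmul_eq_mul, ← Finset.mul_sum (f := fun i => G.locShadowQ θ i x), avgQ]
    field_simp
    ring
  simp_rw [locCriticObj, Finset.mul_sum (s := (univ : Finset (Joint S × Joint A)))]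
  rw [Finset.sum_comm, Finset.sum_comm (s := (univ : Finset ι)), inner_sub_left, inner_featCov,
    inner_featSum, inner_featCov, Finset.mul_sum, Finset.mul_sum, Finset.mul_sum,
    ← Finset.sum_sub_distrib, ← Finset.sum_add_distrib, ← Finset.sum_add_distrib]
  exact Finset.sum_congr rfl fun x _ => key x

/-- The normal equation. The gradient at a minimizer vanishes, and conversely a critical point is a
minimizer because the Hessian is positive semidefinite. -/
theorem isOptCritic_iff [Nonempty ι] (hγ : 0 ≤ γ) (hγ' : γ < 1) (θ : Param p)
    (w : EuclideanSpace ℝ (Fin d)) :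
    G.IsOptCritic θ w ↔
      featCov G.featSA (G.occ θ) w = featSum G.featSA fun x => G.occ θ x * G.avgQ θ x := by
  set v := featCov G.featSA (G.occ θ) w - featSum G.featSA fun x => G.occ θ x * G.avgQ θ x with hv
  rw [IsOptCritic, ← sub_eq_zero, ← hv]
  constructor
  · intro h
    set q := inner ℝ (featCov G.featSA (G.occ θ) v) v
    have key (t : ℝ) : 0 ≤ t * ‖v‖ ^ 2 + 1 / 2 * (t ^ 2 * q) := by
      have h1 : (1 / (Fintype.card ι : ℝ)) * ∑ i, G.locCriticObj θ i w ≤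
        (1 / (Fintype.card ι : ℝ)) * ∑ i, G.locCriticObj θ i (w + t • v) := h (Set.mem_univ _)
      rw [avg_locCriticObj_add, ← hv, map_smul, inner_smul_left, inner_smul_right,
        inner_smul_right, real_inner_self_eq_norm_sq] at h1
      simp only [conj_trivial] at h1
      nlinarith
    have hq : 0 ≤ q := inner_featCov_self_nonneg (occ_nonneg θ hγ hγ') v
    rcases (sq_nonneg ‖v‖).eq_or_lt with h0 | h0
    · exact norm_eq_zero.mp (pow_eq_zero_iff two_ne_zero |>.mp h0.symm)
    · exfalso
      -- A step against the gradient `v`, short enough for the linear term to win; the `1` in the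
      -- denominator covers `q = 0`.
      have h2 := key (-(‖v‖ ^ 2 / (1 + q)))
      have e : -(‖v‖ ^ 2 / (1 + q)) * ‖v‖ ^ 2 + 1 / 2 * ((-(‖v‖ ^ 2 / (1 + q))) ^ 2 * q) =
          -(‖v‖ ^ 2) ^ 2 * (2 + q) / (2 * (1 + q) ^ 2) := by
        field_simp; ring
      rw [e] at h2
      have : 0 < (‖v‖ ^ 2) ^ 2 * (2 + q) / (2 * (1 + q) ^ 2) := by positivity
      rw [neg_mul, neg_div] at h2
      linarith
  · intro h u _
    show _ ≤ (1 / (Fintype.card ι : ℝ)) * ∑ i, G.locCriticObj θ i u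
    have := G.avg_locCriticObj_add θ w (u - w)
    rw [add_sub_cancel, ← hv, h, inner_zero_left] at this
    have h2 : 0 ≤ inner ℝ (featCov G.featSA (G.occ θ) (u - w)) (u - w) :=
      inner_featCov_self_nonneg (occ_nonneg θ hγ hγ') _
    linarith

/-- For a quadratic, strong convexity tested at the midpoint of `w` and `0` is a lower bound on the
Hessian: both defects carry the factor `1/8`. -/
theorem coercive_of_strongConvexOn {θ : Param p} {μ : ℝ}
    (h : StrongConvexOn Set.univ μ (G.criticObj θ)) (w : EuclideanSpace ℝ (Fin d)) :
    μ * ‖w‖ ^ 2 ≤ inner ℝ (featCov G.featSA (G.occ θ) w) w := by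
  have hc := h.2
  have h1 := hc (Set.mem_univ w) (Set.mem_univ 0) (a := 1 / 2) (b := 1 / 2) (by norm_num)
    (by norm_num) (by norm_num)
  simp only [smul_zero, add_zero, sub_zero, smul_eq_mul] at h1
  have e : G.criticObj θ ((1 / 2 : ℝ) • w) = 1 / 2 * G.criticObj θ w + 1 / 2 * G.criticObj θ 0
      - 1 / 8 * inner ℝ (featCov G.featSA (G.occ θ) w) w := by
    simp only [criticObj, inner_featCov, Finset.mul_sum, ← Finset.sum_add_distrib,
      ← Finset.sum_sub_distrib]
    refine Finset.sum_congr rfl fun x _ => ?_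
    simp only [critic_eq, inner_smul_right, inner_zero_right]
    ring
  rw [e] at h1
  linarith

end

variable {K : Constants} {G : Problem S A p d K.γ} {W : ℝ}

theorem avgQ_eq_shadowQ (hG : G.Assumptions K W) (θ : Param p) : G.avgQ θ = G.shadowQ θ :=
  funext fun x => (shadowQ_eq hG θ x).symm

theorem abs_shadowQ_le [Nonempty ι] (hG : G.Assumptions K W) (θ : Param p) (x : Joint S × Joint A) :
    |G.shadowQ θ x| ≤ K.C_F / (1 - K.γ) := by
  have hN : (0 : ℝ) < Fintype.card ι := by exact_mod_cast Fintype.card_pos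
  rw [shadowQ_eq hG, abs_mul, abs_of_nonneg (by positivity)]
  calc _ ≤ 1 / (Fintype.card ι : ℝ) * ∑ i : ι, K.C_F / (1 - K.γ) := by
        refine mul_le_mul_of_nonneg_left ?_ (by positivity)
        exact (Finset.abs_sum_le_sum_abs _ _).trans
          (Finset.sum_le_sum fun i _ => abs_locShadowQ_le hG θ i x)
    _ = _ := by
        rw [Finset.sum_const, Finset.card_univ, nsmul_eq_mul]
        field_simp

theorem norm_featSA_le (hG : G.Assumptions K W) (x : Joint S × Joint A) : ‖G.featSA x‖ ≤ K.C_φ :=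
  hG.feat_bound _ _

theorem exists_isOptCritic [Nonempty ι] {θ : Param p}
    (h : StrongConvexOn Set.univ K.μ_w (G.criticObj θ)) : ∃ w, G.IsOptCritic θ w := by
  obtain ⟨w, hw⟩ := (bijective_featCov K.μ_w_pos (G.coercive_of_strongConvexOn h)).2
    (featSum G.featSA fun x => G.occ θ x * G.avgQ θ x)
  exact ⟨w, (G.isOptCritic_iff K.γ_nonneg K.γ_lt_one θ w).mpr hw⟩

theorem norm_isOptCritic_le [Nonempty ι] (hG : G.Assumptions K W) {θ : Param p}
    (h : StrongConvexOn Set.univ K.μ_w (G.criticObj θ)) {w : EuclideanSpace ℝ (Fin d)}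
    (hw : G.IsOptCritic θ w) : ‖w‖ ≤ K.C_F * K.C_φ / ((1 - K.γ) ^ 2 * K.μ_w) := by
  have hμ := K.μ_w_pos
  have h1 : 0 < 1 - K.γ := by linarith [K.γ_lt_one]
  refine (norm_le_of_coercive hμ (G.coercive_of_strongConvexOn h) w).trans ?_
  rw [(G.isOptCritic_iff K.γ_nonneg K.γ_lt_one θ w).mp hw, div_le_iff₀ hμ]
  refine (norm_featSum_le (norm_featSA_le hG) _).trans ?_
  have : ∑ x, |G.occ θ x * G.avgQ θ x| ≤ ∑ x, G.occ θ x * (K.C_F / (1 - K.γ)) := by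
    refine Finset.sum_le_sum fun x _ => ?_
    have h0 := occ_nonneg (G := G) θ K.γ_nonneg K.γ_lt_one x
    rw [abs_mul, abs_of_nonneg h0, avgQ_eq_shadowQ hG]
    exact mul_le_mul_of_nonneg_left (abs_shadowQ_le hG θ x) h0
  rw [← Finset.sum_mul, sum_occ θ K.γ_nonneg K.γ_lt_one] at this
  calc _ ≤ 1 / (1 - K.γ) * (K.C_F / (1 - K.γ)) * K.C_φ :=
        mul_le_mul_of_nonneg_right this K.C_φ_pos.le
    _ = _ := by field_simp

/-- The optimal critic is Lipschitz in the policy parameter. -/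
theorem exists_lipschitz_isOptCritic [Nonempty ι] (S A : ι → Type*)
    [∀ i, Fintype (S i)] [∀ i, DecidableEq (S i)] [∀ i, Fintype (A i)] [∀ i, DecidableEq (A i)]
    (p : ι → ℕ) (d : ℕ) (K : Constants) :
    ∃ C_w : ℝ, 0 < C_w ∧ ∀ (G : Problem S A p d K.γ) (W : ℝ), G.Assumptions K W →
      ∀ θ θ' w w', StrongConvexOn Set.univ K.μ_w (G.criticObj θ) →
        StrongConvexOn Set.univ K.μ_w (G.criticObj θ') →
        G.IsOptCritic θ w → G.IsOptCritic θ' w' → ‖w' - w‖ ≤ C_w * ‖θ' - θ‖ := by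
  have hμ := K.μ_w_pos
  have hl := K.l_lam_pos
  have hQ := K.l_Q_pos
  have hφ := K.C_φ_pos
  have hF := K.C_F_pos
  have h1 : 0 < 1 - K.γ := by linarith [K.γ_lt_one]
  set n : ℝ := (Fintype.card (Joint S × Joint A) : ℝ)
  set R := K.C_F * K.C_φ / ((1 - K.γ) ^ 2 * K.μ_w) with hR
  have hRpos : 0 < R := by positivity
  set Cb := n * K.l_lam * (K.C_F / (1 - K.γ)) + 1 / (1 - K.γ) * K.l_Q
  have hCb : 0 < Cb := by positivity
  refine ⟨(n * K.l_lam * (K.C_φ ^ 2 * R) + Cb * K.C_φ) / K.μ_w, by positivity, ?_⟩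
  intro G W hG θ θ' w w' hθ hθ' hw hw'
  refine (norm_le_of_coercive hμ (G.coercive_of_strongConvexOn hθ) (w' - w)).trans ?_
  rw [div_mul_eq_mul_div]
  refine div_le_div_of_nonneg_right ?_ hμ.le
  -- Subtracting the normal equations `D w = b` and `D' w' = b'` gives `D (w' - w) = (D - D') w' +
  -- (b' - b)`.
  have e : featCov G.featSA (G.occ θ) (w' - w) =
      featCov G.featSA (fun x => G.occ θ x - G.occ θ' x) w' +
      featSum G.featSA (fun x => G.occ θ' x * G.avgQ θ' x - G.occ θ x * G.avgQ θ x) := by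
    rw [map_sub, (G.isOptCritic_iff K.γ_nonneg K.γ_lt_one θ w).mp hw, ← featCov_sub, ← featSum_sub,
      (G.isOptCritic_iff K.γ_nonneg K.γ_lt_one θ' w').mp hw']
    abel
  have hocc (x : Joint S × Joint A) := hG.occ_entry_lip θ' θ x
  have hs1 : ∑ x, |G.occ θ x - G.occ θ' x| ≤ n * K.l_lam * ‖θ' - θ‖ := by
    refine (Finset.sum_le_sum fun x _ => (abs_sub_comm _ _).trans_le (hocc x)).trans_eq ?_
    rw [Finset.sum_const, Finset.card_univ, nsmul_eq_mul, mul_assoc]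
  have hs2 : ∑ x, |G.occ θ' x * G.avgQ θ' x - G.occ θ x * G.avgQ θ x| ≤ Cb * ‖θ' - θ‖ := by
    calc _ ≤ ∑ x, (K.l_lam * ‖θ' - θ‖ * (K.C_F / (1 - K.γ)) +
          G.occ θ x * (K.l_Q * ‖θ' - θ‖)) := by
          refine Finset.sum_le_sum fun x _ => ?_
          rw [avgQ_eq_shadowQ hG, avgQ_eq_shadowQ hG]
          have e : G.occ θ' x * G.shadowQ θ' x - G.occ θ x * G.shadowQ θ x =
            (G.occ θ' x - G.occ θ x) * G.shadowQ θ' x +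
              G.occ θ x * (G.shadowQ θ' x - G.shadowQ θ x) := by ring
          have h0 := occ_nonneg (G := G) θ K.γ_nonneg K.γ_lt_one x
          rw [e]
          refine (abs_add_le _ _).trans (add_le_add ?_ ?_)
          · rw [abs_mul]
            exact mul_le_mul (hocc x) (abs_shadowQ_le hG θ' x) (abs_nonneg _) (by positivity)
          · rw [abs_mul, abs_of_nonneg h0]
            exact mul_le_mul_of_nonneg_left (hG.shadowQ_lip θ' θ x) h0
      _ = Cb * ‖θ' - θ‖ := by
          rw [Finset.sum_add_distrib, Finset.sum_const, Finset.card_univ, nsmul_eq_mul,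
            ← Finset.sum_mul, sum_occ θ K.γ_nonneg K.γ_lt_one]
          ring
  rw [e]
  have hw'R := norm_isOptCritic_le hG hθ' hw'
  calc _ ≤ _ := norm_add_le _ _
    _ ≤ (∑ x, |G.occ θ x - G.occ θ' x|) * (K.C_φ ^ 2 * ‖w'‖) +
        (∑ x, |G.occ θ' x * G.avgQ θ' x - G.occ θ x * G.avgQ θ x|) * K.C_φ :=
        add_le_add (norm_featCov_le (norm_featSA_le hG) _ _) (norm_featSum_le (norm_featSA_le hG) _)
    _ ≤ (n * K.l_lam * ‖θ' - θ‖) * (K.C_φ ^ 2 * R) + (Cb * ‖θ' - θ‖) * K.C_φ := by gcongr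
    _ = _ := by ring

end Problem
end DSAC

/-! ### Consensus through the mixing matrix -/

namespace DSAC

open Finset

namespace Problem

variable {ι : Type*} [Fintype ι] [DecidableEq ι] {S A : ι → Type*}
  [∀ i, Fintype (S i)] [∀ i, DecidableEq (S i)] [∀ i, Fintype (A i)] [∀ i, DecidableEq (A i)]
  {p : ι → ℕ} {d : ℕ} {γ : ℝ} (G : Problem S A p d γ)

theorem rho_nonneg : 0 ≤ G.rho := Real.iSup_nonneg fun _ => abs_nonneg _

theorem abs_eigenvalue_le_rho (k : Fin (Fintype.card ι)) (hk : 0 < k.val) :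
    |G.mix_symm.eigenvalues₀ k| ≤ G.rho :=
  le_ciSup (f := fun k : {k : Fin (Fintype.card ι) // 0 < k.val} => |G.mix_symm.eigenvalues₀ k.1|)
    (Set.finite_range _).bddAbove ⟨k, hk⟩

theorem inner_eigenvectorBasis_mulVec (k : ι) (v : ι → ℝ) :
    inner ℝ (G.mix_symm.eigenvectorBasis k) (WithLp.toLp 2 (G.mix.mulVec v)) =
      G.mix_symm.eigenvalues k *
        inner ℝ (G.mix_symm.eigenvectorBasis k) (WithLp.toLp 2 v : EuclideanSpace ℝ ι) := by
  have ht : G.mix.transpose = G.mix := by simpa [Matrix.IsHermitian] using G.mix_symm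
  have h1 (x : EuclideanSpace ℝ ι) (y : ι → ℝ) :
      inner ℝ x (WithLp.toLp 2 y : EuclideanSpace ℝ ι) = dotProduct (x : ι → ℝ) y := by
    simp [PiLp.inner_apply, dotProduct, mul_comm]
  rw [h1, h1, Matrix.dotProduct_mulVec, ← Matrix.mulVec_transpose, ht,
    G.mix_symm.mulVec_eigenvectorBasis]
  simp [smul_dotProduct]

variable [Nonempty ι]

/-- On vectors with zero sum, the mixing matrix contracts by the factor `ρ`. -/
theorem sum_mulVec_sq_le (hM : G.mix ∈ doublyStochastic ℝ ι) (hρ : G.rho < 1) (v : ι → ℝ)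
    (hv : ∑ i, v i = 0) : ∑ i, (G.mix.mulVec v i) ^ 2 ≤ G.rho ^ 2 * ∑ i, v i ^ 2 := by
  set b := G.mix_symm.eigenvectorBasis with hb
  set e : Fin (Fintype.card ι) ≃ ι := Fintype.equivOfCardEq (Fintype.card_fin _) with he
  set k₀ : ι := e ⟨0, Fintype.card_pos⟩ with hk₀
  set x : EuclideanSpace ℝ ι := WithLp.toLp 2 v with hx
  set one : EuclideanSpace ℝ ι := WithLp.toLp 2 1 with hone
  have hσ (k : ι) (hk : k ≠ k₀) : |G.mix_symm.eigenvalues k| ≤ G.rho := by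
    refine G.abs_eigenvalue_le_rho (e.symm k) (Nat.pos_of_ne_zero fun h => hk ?_)
    rw [hk₀, ← e.symm_apply_eq]
    exact Fin.ext h
  -- The all-ones vector is fixed by the matrix, while every eigenvalue other than that of `k₀` has
  -- absolute value at most `ρ < 1`. Hence these eigenvectors are orthogonal to it.
  have hb1 (k : ι) (hk : k ≠ k₀) : inner ℝ (b k) one = 0 := by
    have h1 : G.mix.mulVec 1 = 1 := mulVec_one_of_mem_doublyStochastic hM
    have h2 := G.inner_eigenvectorBasis_mulVec k 1
    rw [h1] at h2
    have h3 : G.mix_symm.eigenvalues k ≠ 1 := fun h => by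
      have := hσ k hk
      rw [h, abs_one] at this
      linarith
    have h4 : (1 - G.mix_symm.eigenvalues k) * inner ℝ (b k) one = 0 := by
      rw [sub_mul, one_mul, sub_eq_zero]; exact h2
    exact (mul_eq_zero.mp h4).resolve_left (sub_ne_zero.mpr h3.symm)
  -- By Parseval the all-ones vector lies along `b k₀`, so a vector of zero sum has no component
  -- there. The eigenvalue of `k₀` itself need not be computed.
  have hbx : inner ℝ (b k₀) x = 0 := by
    have h1 := b.sum_inner_mul_inner one x
    have h2 := b.sum_inner_mul_inner one one
    rw [Finset.sum_eq_single k₀ (fun k _ hk => by rw [real_inner_comm, hb1 k hk, zero_mul])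
      (by simp)] at h1 h2
    have h3 : inner ℝ one x = 0 := by simpa [hone, hx, PiLp.inner_apply] using hv
    have h4 : inner ℝ one one = (Fintype.card ι : ℝ) := by
      rw [PiLp.inner_apply]; simp [hone]
    rw [h3] at h1
    rw [h4] at h2
    refine (mul_eq_zero.mp h1).resolve_left fun h => ?_
    rw [h, zero_mul] at h2
    exact Fintype.card_ne_zero (α := ι) (by exact_mod_cast h2.symm)
  have e1 : ∑ i, (G.mix.mulVec v i) ^ 2 = ‖(WithLp.toLp 2 (G.mix.mulVec v) : EuclideanSpace ℝ ι)‖ ^ 2 := by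
    rw [EuclideanSpace.norm_sq_eq]; simp
  have e2 : ∑ i, v i ^ 2 = ‖x‖ ^ 2 := by
    rw [EuclideanSpace.norm_sq_eq]; simp [hx]
  rw [e1, e2, ← b.sum_sq_norm_inner_right, ← b.sum_sq_norm_inner_right, Finset.mul_sum]
  refine Finset.sum_le_sum fun k _ => ?_
  rw [G.inner_eigenvectorBasis_mulVec, norm_mul, mul_pow, Real.norm_eq_abs]
  rcases eq_or_ne k k₀ with rfl | hk
  · rw [← hb, ← hx, hbx]; simp
  · exact mul_le_mul_of_nonneg_right (pow_le_pow_left₀ (abs_nonneg _) (hσ k hk) 2) (sq_nonneg _)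

/-- The average of the vectors of the agents. -/
noncomputable def avg (w : ι → EuclideanSpace ℝ (Fin d)) : EuclideanSpace ℝ (Fin d) :=
  (1 / (Fintype.card ι : ℝ)) • ∑ i, w i

/-- The disagreement of the agents. -/
noncomputable def disagreement (w : ι → EuclideanSpace ℝ (Fin d)) : ℝ := ∑ i, ‖w i - avg w‖ ^ 2

theorem sum_eq_smul_avg (w : ι → EuclideanSpace ℝ (Fin d)) :
    ∑ i, w i = (Fintype.card ι : ℝ) • avg w := by
  have hN : (Fintype.card ι : ℝ) ≠ 0 := by exact_mod_cast Fintype.card_ne_zero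
  rw [avg, smul_smul, mul_one_div_cancel hN, one_smul]

theorem sum_sub_avg (w : ι → EuclideanSpace ℝ (Fin d)) : ∑ i, (w i - avg w) = 0 := by
  rw [Finset.sum_sub_distrib, sum_eq_smul_avg, Finset.sum_const, Finset.card_univ,
    ← Nat.cast_smul_eq_nsmul ℝ, sub_self]

theorem avg_mixRound (hM : G.mix ∈ doublyStochastic ℝ ι) (w : ι → EuclideanSpace ℝ (Fin d)) :
    avg (G.mixRound w) = avg w := by
  simp only [avg, mixRound]
  rw [Finset.sum_comm]
  simp_rw [← Finset.sum_smul, sum_row_of_mem_doublyStochastic hM, one_smul]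

/-- Mixing acts on each coordinate of the critics separately, so the scalar contraction can be
summed over the coordinates. -/
theorem sum_norm_mixRound_sq_le (hM : G.mix ∈ doublyStochastic ℝ ι) (hρ : G.rho < 1)
    (w : ι → EuclideanSpace ℝ (Fin d)) (hw : ∑ i, w i = 0) :
    ∑ i, ‖G.mixRound w i‖ ^ 2 ≤ G.rho ^ 2 * ∑ i, ‖w i‖ ^ 2 := by
  have ht (i j : ι) : G.mix j i = G.mix i j := by simpa using G.mix_symm.apply i j
  have h1 (i : ι) (c : Fin d) : G.mixRound w i c = G.mix.mulVec (fun j => w j c) i := by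
    simp [mixRound, Matrix.mulVec, dotProduct, ht]
  simp_rw [EuclideanSpace.norm_sq_eq, Real.norm_eq_abs, sq_abs, h1]
  rw [Finset.sum_comm, Finset.sum_comm (s := (univ : Finset ι)), Finset.mul_sum]
  refine Finset.sum_le_sum fun c _ => G.sum_mulVec_sq_le hM hρ _ ?_
  simpa using congrArg (fun u : EuclideanSpace ℝ (Fin d) => u c) hw

theorem mixRound_sub_const (hM : G.mix ∈ doublyStochastic ℝ ι)
    (w : ι → EuclideanSpace ℝ (Fin d)) (u : EuclideanSpace ℝ (Fin d)) :
    G.mixRound (fun i => w i - u) = fun i => G.mixRound w i - u := by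
  funext i
  simp only [mixRound, smul_sub, Finset.sum_sub_distrib, ← Finset.sum_smul,
    sum_col_of_mem_doublyStochastic hM, one_smul]

theorem disagreement_mixRound_le (hM : G.mix ∈ doublyStochastic ℝ ι) (hρ : G.rho < 1)
    (w : ι → EuclideanSpace ℝ (Fin d)) :
    disagreement (G.mixRound w) ≤ G.rho ^ 2 * disagreement w := by
  have := G.sum_norm_mixRound_sq_le hM hρ _ (sum_sub_avg w)
  rw [G.mixRound_sub_const hM] at this
  rwa [disagreement, G.avg_mixRound hM]

theorem avg_mixRound_iterate (hM : G.mix ∈ doublyStochastic ℝ ι) (m : ℕ)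
    (w : ι → EuclideanSpace ℝ (Fin d)) : avg (G.mixRound^[m] w) = avg w := by
  induction m with
  | zero => rfl
  | succ m ih => rw [Function.iterate_succ_apply', G.avg_mixRound hM, ih]

theorem disagreement_mixRound_iterate_le (hM : G.mix ∈ doublyStochastic ℝ ι) (hρ : G.rho < 1)
    (m : ℕ) (w : ι → EuclideanSpace ℝ (Fin d)) :
    disagreement (G.mixRound^[m] w) ≤ (G.rho ^ m) ^ 2 * disagreement w := by
  induction m with
  | zero => simp
  | succ m ih =>
    rw [Function.iterate_succ_apply']
    refine (G.disagreement_mixRound_le hM hρ _).trans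
      ((mul_le_mul_of_nonneg_left ih (sq_nonneg _)).trans_eq ?_)
    ring

/-- The disagreement is the minimal sum of squared distances to a common point. -/
theorem sum_norm_sub_sq (w : ι → EuclideanSpace ℝ (Fin d)) (u : EuclideanSpace ℝ (Fin d)) :
    ∑ i, ‖w i - u‖ ^ 2 = disagreement w + Fintype.card ι * ‖avg w - u‖ ^ 2 := by
  have h (i : ι) : ‖w i - u‖ ^ 2 =
      ‖w i - avg w‖ ^ 2 + 2 * inner ℝ (w i - avg w) (avg w - u) + ‖avg w - u‖ ^ 2 := by
    rw [← norm_add_sq_real, sub_add_sub_cancel]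
  simp_rw [h]
  rw [Finset.sum_add_distrib, Finset.sum_add_distrib, ← Finset.mul_sum, ← sum_inner, sum_sub_avg,
    inner_zero_left, Finset.sum_const, Finset.card_univ, nsmul_eq_mul, disagreement]
  ring

theorem disagreement_le_sum_norm_sub_sq (w : ι → EuclideanSpace ℝ (Fin d))
    (u : EuclideanSpace ℝ (Fin d)) : disagreement w ≤ ∑ i, ‖w i - u‖ ^ 2 := by
  rw [sum_norm_sub_sq]
  exact le_add_of_nonneg_right (by positivity)

end Problem

/-- Enough mixing rounds, or enough time steps, reduce the geometric factor below `ε`. -/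
theorem pow_le_of_log_le {r ε : ℝ} (h0 : 0 ≤ r) (h1 : r < 1) (hε : 0 < ε) {m : ℕ}
    (hm : Real.log (1 / ε) / (1 - r) ≤ m) : r ^ m ≤ ε := by
  have h2 : 0 < 1 - r := by linarith
  calc r ^ m ≤ Real.exp (-(1 - r)) ^ m := by
        gcongr
        have := Real.add_one_le_exp (-(1 - r))
        linarith
    _ = Real.exp (-(m * (1 - r))) := by rw [← Real.exp_nat_mul]; ring_nf
    _ ≤ Real.exp (Real.log ε) := by
        rw [Real.exp_le_exp]
        rw [div_le_iff₀ h2, one_div, Real.log_inv] at hm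
        linarith
    _ = ε := Real.exp_log hε

end DSAC

/-! ### Visit statistics and accurate batches -/

namespace DSAC

open Finset

theorem sum_filter_exists_le {X J : Type*} [Fintype X] [Fintype J] {w : X → ℝ} (hw : ∀ x, 0 ≤ w x)
    (P : J → X → Prop) [∀ j, DecidablePred (P j)] [DecidablePred fun x => ∃ j, P j x] :
    ∑ x with ∃ j, P j x, w x ≤ ∑ j, ∑ x with P j x, w x := by
  simp_rw [Finset.sum_filter]
  rw [Finset.sum_comm]
  refine Finset.sum_le_sum fun x _ => ?_
  have h0 (j : J) : 0 ≤ if P j x then w x else 0 := by split_ifs <;> simp [hw]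
  split_ifs with h
  · obtain ⟨j, hj⟩ := h
    refine le_trans (le_of_eq ?_) (Finset.single_le_sum (fun j _ => h0 j) (Finset.mem_univ j))
    rw [if_pos hj]
  · exact Finset.sum_nonneg fun j _ => h0 j

theorem sum_Ici_sub {n : ℕ} (t : Fin n) (g : ℕ → ℝ) :
    ∑ t' ∈ Finset.Ici t, g (t'.val - t.val) = ∑ u ∈ range (n - t.val), g u := by
  have h := Finset.sum_map (Finset.Ici t) Fin.valEmbedding fun m => g (m - t.val)
  rw [Fin.map_valEmbedding_Ici, Finset.sum_Ico_eq_sum_range] at h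
  simpa using h.symm

namespace Problem

variable {ι : Type*} [Fintype ι] [DecidableEq ι] {S A : ι → Type*}
  [∀ i, Fintype (S i)] [∀ i, DecidableEq (S i)] [∀ i, Fintype (A i)] [∀ i, DecidableEq (A i)]
  {p : ι → ℕ} {d : ℕ} {γ : ℝ}

section Visits

variable {h : ℕ}

variable (γ) in
/-- The discounted number of visits of a trajectory to `x`. -/
noncomputable def visits (x : Joint S × Joint A) (y : Trajectory S A h) : ℝ :=
  ∑ t : Fin (h + 1), γ ^ t.val * if y t = x then 1 else 0

variable (γ) in
/-- The discounted number of pairs of visits of a trajectory to `x` and, at that time or later,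
to `z`. -/
noncomputable def pairVisits (x z : Joint S × Joint A) (y : Trajectory S A h) : ℝ :=
  ∑ t : Fin (h + 1), ∑ t' ∈ Finset.Ici t, γ ^ t.val * γ ^ (t'.val - t.val) *
    ((if y t = x then 1 else 0) * if y t' = z then 1 else 0)

variable (hγ : 0 ≤ γ) (hγ' : γ < 1)

include hγ

theorem visits_nonneg (x : Joint S × Joint A) (y : Trajectory S A h) : 0 ≤ visits γ x y :=
  Finset.sum_nonneg fun t _ => mul_nonneg (pow_nonneg hγ _) (by split_ifs <;> norm_num)

theorem pairVisits_nonneg (x z : Joint S × Joint A) (y : Trajectory S A h) :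
    0 ≤ pairVisits γ x z y :=
  Finset.sum_nonneg fun t _ => Finset.sum_nonneg fun t' _ =>
    mul_nonneg (mul_nonneg (pow_nonneg hγ _) (pow_nonneg hγ _))
      (mul_nonneg (by split_ifs <;> norm_num) (by split_ifs <;> norm_num))

include hγ'

theorem sum_visits_le (y : Trajectory S A h) : ∑ x, visits γ x y ≤ 1 / (1 - γ) := by
  simp_rw [visits]
  rw [Finset.sum_comm]
  simp_rw [← Finset.mul_sum, Finset.sum_ite_eq, Finset.mem_univ, if_true, mul_one]
  rw [Fin.sum_univ_eq_sum_range fun t => γ ^ t]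
  exact sum_range_geom_le hγ hγ' _

theorem one_le_inv_one_sub : 1 ≤ 1 / (1 - γ) := by
  rw [le_div_iff₀ (by linarith)]; linarith

/-- The exponent `2` is not sharp; it lets single and pair visits share one range in the
concentration bound. -/
theorem abs_visits_le (x : Joint S × Joint A) (y : Trajectory S A h) :
    |visits γ x y| ≤ (1 / (1 - γ)) ^ 2 := by
  have h1 := one_le_inv_one_sub hγ hγ'
  rw [abs_of_nonneg (visits_nonneg hγ x y)]
  have h2 := Finset.single_le_sum (f := fun x => visits γ x y) (fun x _ => visits_nonneg hγ x y)
    (Finset.mem_univ x)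
  refine (h2.trans (sum_visits_le hγ hγ' y)).trans ?_
  nlinarith

theorem abs_pairVisits_le (x z : Joint S × Joint A) (y : Trajectory S A h) :
    |pairVisits γ x z y| ≤ (1 / (1 - γ)) ^ 2 := by
  have h1 := one_le_inv_one_sub hγ hγ'
  rw [abs_of_nonneg (pairVisits_nonneg hγ x z y)]
  calc pairVisits γ x z y
      ≤ ∑ t : Fin (h + 1), ∑ t' ∈ Finset.Ici t, γ ^ t.val * γ ^ (t'.val - t.val) := by
        refine Finset.sum_le_sum fun t _ => Finset.sum_le_sum fun t' _ =>
          mul_le_of_le_one_right (mul_nonneg (pow_nonneg hγ _) (pow_nonneg hγ _)) ?_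
        split_ifs <;> norm_num
    _ = ∑ t : Fin (h + 1), γ ^ t.val * ∑ u ∈ range (h + 1 - t.val), γ ^ u := by
        simp_rw [← Finset.mul_sum, sum_Ici_sub _ fun u => γ ^ u]
    _ ≤ ∑ t : Fin (h + 1), γ ^ t.val * (1 / (1 - γ)) :=
        Finset.sum_le_sum fun t _ =>
          mul_le_mul_of_nonneg_left (sum_range_geom_le hγ hγ' _) (pow_nonneg hγ _)
    _ = (∑ t ∈ range (h + 1), γ ^ t) * (1 / (1 - γ)) := by
        rw [← Finset.sum_mul, Fin.sum_univ_eq_sum_range fun t => γ ^ t]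
    _ ≤ (1 / (1 - γ)) ^ 2 := by
        rw [sq]
        exact mul_le_mul_of_nonneg_right (sum_range_geom_le hγ hγ' _) (by linarith)

variable (G : Problem S A p d γ) (θ : Param p)

theorem abs_mean_visits_sub_occ_le (x : Joint S × Joint A) :
    |∑ y : Trajectory S A h, G.trajProb θ y * visits γ x y - G.occ θ x| ≤
      γ ^ (h + 1) / (1 - γ) := by
  have e : ∑ y : Trajectory S A h, G.trajProb θ y * visits γ x y =
      ∑ t ∈ range (h + 1), γ ^ t * G.saProb θ t x := by
    simp_rw [visits, Finset.mul_sum, mul_left_comm (G.trajProb θ _)]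
    rw [Finset.sum_comm, ← Fin.sum_univ_eq_sum_range fun t => γ ^ t * G.saProb θ t x]
    refine Finset.sum_congr rfl fun t _ => ?_
    simp_rw [← Finset.mul_sum, trajProb_eq]
    rw [sum_pathWeight_mul _ (G.sum_kernel θ) _ _ _ fun z => if z = x then 1 else 0]
    simp [saProb]
  have := tsum_sub_sum_discount hγ hγ' (fun t => G.saProb_nonneg θ t x)
    (fun t => G.saProb_le_one θ t x) (h + 1)
  rw [e, occ_eq, abs_sub_comm, abs_of_nonneg this.1]
  exact this.2

/-- Two truncations contribute. Cutting off the first time leaves a tail of `λ(x)`, multiplied by a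
resolvent entry at most `1 / (1 - γ)`. Cutting off the second time at the horizon costs `γ^t
γ^(h+1-t) / (1 - γ)` for each first time `t`, which does not depend on `t`; hence the factor `h +
1`. -/
theorem abs_mean_pairVisits_sub_le (x z : Joint S × Joint A) :
    |∑ y : Trajectory S A h, G.trajProb θ y * pairVisits γ x z y -
      G.occ θ x * G.resolvent θ x z| ≤
      γ ^ (h + 1) / (1 - γ) ^ 2 + (h + 1) * γ ^ (h + 1) / (1 - γ) := by
  have h1 : 0 < 1 - γ := by linarith
  set B : ℕ → ℝ := fun n => ∑ u ∈ range n, γ ^ u * (G.kernel θ ^ u) x z with hB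
  have e : ∑ y : Trajectory S A h, G.trajProb θ y * pairVisits γ x z y =
      ∑ t ∈ range (h + 1), γ ^ t * G.saProb θ t x * B (h + 1 - t) := by
    simp_rw [pairVisits, Finset.mul_sum]
    rw [Finset.sum_comm, ← Fin.sum_univ_eq_sum_range
      fun t => γ ^ t * G.saProb θ t x * B (h + 1 - t)]
    refine Finset.sum_congr rfl fun t _ => ?_
    rw [Finset.sum_comm]
    calc _ = ∑ t' ∈ Finset.Ici t, γ ^ t.val * G.saProb θ t x *
          (γ ^ (t'.val - t.val) * (G.kernel θ ^ (t'.val - t.val)) x z) := by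
          refine Finset.sum_congr rfl fun t' ht' => ?_
          simp_rw [mul_left_comm (G.trajProb θ _) (γ ^ t.val * γ ^ (t'.val - t.val)),
            ← Finset.mul_sum, trajProb_eq]
          rw [sum_pathWeight_mul_mul _ (G.sum_kernel θ) _ _ _ _ (Finset.mem_Ici.mp ht')
            (fun w => if w = x then 1 else 0) fun w => if w = z then 1 else 0]
          simp only [mul_ite, mul_one, mul_zero, ite_mul, zero_mul, Finset.sum_ite_eq',
            Finset.mem_univ, if_true, saProb]
          ring
      _ = _ := by
          rw [← Finset.mul_sum,
            sum_Ici_sub _ fun u => γ ^ u * (G.kernel θ ^ u) x z]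
  have ho := tsum_sub_sum_discount hγ hγ' (fun t => G.saProb_nonneg θ t x)
    (fun t => G.saProb_le_one θ t x) (h + 1)
  rw [← occ_eq] at ho
  have hr (n : ℕ) := tsum_sub_sum_discount hγ hγ' (fun t => G.kernel_pow_nonneg θ t x z)
    (fun t => G.kernel_pow_le_one θ t x z) n
  change ∀ n, 0 ≤ G.resolvent θ x z - B n ∧ G.resolvent θ x z - B n ≤ γ ^ n / (1 - γ) at hr
  have hR0 := resolvent_nonneg (G := G) θ hγ hγ' x z
  have hR1 : G.resolvent θ x z ≤ 1 / (1 - γ) := by simpa [hB] using (hr 0).2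
  have hterm (t : ℕ) (ht : t ∈ range (h + 1)) :
      0 ≤ γ ^ t * G.saProb θ t x * (G.resolvent θ x z - B (h + 1 - t)) ∧
      γ ^ t * G.saProb θ t x * (G.resolvent θ x z - B (h + 1 - t)) ≤ γ ^ (h + 1) / (1 - γ) := by
    have hg := pow_nonneg hγ t
    have hp := G.saProb_nonneg θ t x
    refine ⟨mul_nonneg (mul_nonneg hg hp) (hr _).1, ?_⟩
    calc _ ≤ γ ^ t * 1 * (γ ^ (h + 1 - t) / (1 - γ)) :=
          mul_le_mul (mul_le_mul_of_nonneg_left (G.saProb_le_one θ t x) hg) (hr _).2 (hr _).1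
            (by positivity)
      _ = γ ^ (h + 1) / (1 - γ) := by
          rw [mul_one, ← mul_div_assoc, ← pow_add,
            Nat.add_sub_cancel' (Finset.mem_range.mp ht).le]
  have hsplit : G.occ θ x * G.resolvent θ x z -
      ∑ t ∈ range (h + 1), γ ^ t * G.saProb θ t x * B (h + 1 - t) =
      (G.occ θ x - ∑ t ∈ range (h + 1), γ ^ t * G.saProb θ t x) * G.resolvent θ x z +
      ∑ t ∈ range (h + 1), γ ^ t * G.saProb θ t x * (G.resolvent θ x z - B (h + 1 - t)) := by
    simp_rw [mul_sub]
    rw [Finset.sum_sub_distrib, ← Finset.sum_mul]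
    ring
  rw [e, abs_sub_comm, hsplit, abs_of_nonneg (add_nonneg (mul_nonneg ho.1 hR0)
    (Finset.sum_nonneg fun t ht => (hterm t ht).1))]
  refine add_le_add ?_ ?_
  · calc _ ≤ γ ^ (h + 1) / (1 - γ) * (1 / (1 - γ)) := mul_le_mul ho.2 hR1 hR0 (by positivity)
      _ = _ := by field_simp
  · refine (Finset.sum_le_sum fun t ht => (hterm t ht).2).trans_eq ?_
    rw [Finset.sum_const, Finset.card_range, nsmul_eq_mul]
    push_cast
    ring

end Visits

section Accuracy

variable {b h : ℕ}

/-- The mean of a statistic of trajectories over a batch. -/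
noncomputable def batchMean (f : Trajectory S A h → ℝ) (x : Batch S A b h) : ℝ :=
  1 / (b : ℝ) * ∑ j, f (x j)

/-- A batch is accurate if its visit statistics are close to those of the policy. -/
def Accurate (G : Problem S A p d γ) (θ : Param p) (r : ℝ) (x : Batch S A b h) : Prop :=
  (∀ y, |batchMean (visits γ y) x - G.occ θ y| ≤ r) ∧
  ∀ y z, |batchMean (pairVisits γ y z) x - G.occ θ y * G.resolvent θ y z| ≤ r

/-- The factor `h + 1` is absorbed by writing `γ^h = √γ^h √γ^h`. One copy makes `(h + 1) √γ^h` at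
most a geometric sum of ratio `√γ`, the other is at most `√ε`, the order of the sampling error. -/
theorem truncation_le (hγ : 0 ≤ γ) (hγ' : γ < 1) {ε : ℝ} (hε : 0 ≤ ε) (hε1 : ε ≤ 1)
    (hh : γ ^ h ≤ ε) :
    γ ^ (h + 1) / (1 - γ) ^ 2 + (h + 1) * γ ^ (h + 1) / (1 - γ) ≤
      (1 / (1 - γ) ^ 2 + 1 / ((1 - √γ) * (1 - γ))) * √ε := by
  have h1 : 0 < 1 - γ := by linarith
  have hs0 := Real.sqrt_nonneg γ
  have hs1 : √γ < 1 := by rw [Real.sqrt_lt' one_pos]; simpa using hγ'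
  have hs2 : √γ ^ 2 = γ := Real.sq_sqrt hγ
  have hsub : 0 < 1 - √γ := by linarith
  have hpow : √γ ^ h ≤ √ε := by
    refine Real.le_sqrt_of_sq_le ?_
    rw [← pow_mul, mul_comm, pow_mul, hs2]
    exact hh
  have hεs : ε ≤ √ε := Real.le_sqrt_of_sq_le (by nlinarith)
  have hA : γ ^ (h + 1) ≤ √ε :=
    ((pow_le_pow_of_le_one hγ hγ'.le (Nat.le_succ h)).trans hh).trans hεs
  have hB : (h + 1) * γ ^ (h + 1) ≤ 1 / (1 - √γ) * √ε := by
    have hgeo : ((h : ℝ) + 1) * √γ ^ h ≤ 1 / (1 - √γ) := by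
      refine le_trans ?_ (sum_range_geom_le hs0 hs1 (h + 1))
      have : ∑ _t ∈ range (h + 1), √γ ^ h ≤ ∑ t ∈ range (h + 1), √γ ^ t :=
        Finset.sum_le_sum fun t ht => pow_le_pow_of_le_one hs0 hs1.le
          (Nat.lt_succ_iff.mp (Finset.mem_range.mp ht))
      simpa using this
    calc (h + 1) * γ ^ (h + 1) ≤ (h + 1) * γ ^ h := by
          gcongr ?_ * ?_
          exact pow_le_pow_of_le_one hγ hγ'.le (Nat.le_succ h)
      _ = ((h + 1) * √γ ^ h) * √γ ^ h := by
          rw [mul_assoc, ← pow_add, ← two_mul, pow_mul, hs2]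
      _ ≤ 1 / (1 - √γ) * √ε := mul_le_mul hgeo hpow (by positivity) (by positivity)
  calc _ ≤ √ε / (1 - γ) ^ 2 + (1 / (1 - √γ) * √ε) / (1 - γ) := by gcongr
    _ = _ := by field_simp

open Classical in
/-- A batch of `log(1/q)/ε` trajectories is accurate up to order `√ε` with probability at least
`1 - q`. -/
theorem exists_sum_not_accurate_le (S A : ι → Type*)
    [∀ i, Fintype (S i)] [∀ i, DecidableEq (S i)] [∀ i, Fintype (A i)] [∀ i, DecidableEq (A i)]
    (p : ι → ℕ) (d : ℕ) (hγ : 0 ≤ γ) (hγ' : γ < 1) :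
    ∃ κ : ℝ, 0 < κ ∧ ∀ (G : Problem S A p d γ) (θ : Param p) (ε q : ℝ) (b h : ℕ), 0 < ε → ε ≤ 1 →
      γ ^ h ≤ ε → 0 < q → 1 ≤ Real.log (1 / q) → Real.log (1 / q) / ε ≤ b →
      ∑ x : Batch S A b h with ¬ G.Accurate θ (κ * √ε) x, ∏ j, G.trajProb θ (x j) ≤ q := by
  have h1 : 0 < 1 - γ := by linarith
  have hs1 : √γ < 1 := by rw [Real.sqrt_lt' one_pos]; simpa using hγ'
  have hs2 : 0 < 1 - √γ := by linarith
  set X := Joint S × Joint A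
  set M := (1 / (1 - γ)) ^ 2
  have hM : 0 < M := by positivity
  set n : ℝ := (Fintype.card (X ⊕ X × X) : ℝ) + 1
  have hn : 1 ≤ n := by
    have : (0 : ℝ) ≤ Fintype.card (X ⊕ X × X) := Nat.cast_nonneg _
    simp only [n]; linarith
  have hlog : 0 ≤ Real.log (2 * n) := Real.log_nonneg (by linarith)
  -- With this choice the Hoeffding exponent is `b ε (1 + log (2 n))`. Since `b ε ≥ log (1/q) ≥ 1`,
  -- it is at least `log (1/q) + log (2 n)`, which leaves room for the two tails and the union bound
  -- over the statistics.
  set κ₀ := √(8 * M ^ 2 * (1 + Real.log (2 * n))) with hκ₀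
  set κ₁ := 1 / (1 - γ) ^ 2 + 1 / ((1 - √γ) * (1 - γ))
  have hκ₁ : 0 < κ₁ := by positivity
  refine ⟨κ₀ + κ₁, by positivity, ?_⟩
  intro G θ ε q b h hε hε1 hh hq hL hb
  set L := Real.log (1 / q)
  have hb0 : 0 < b := by
    have : (0 : ℝ) < b := lt_of_lt_of_le (by positivity) hb
    exact_mod_cast this
  have hbias := truncation_le hγ hγ' hε.le hε1 hh
  let f : X ⊕ X × X → Trajectory S A h → ℝ :=
    Sum.elim (fun x => visits γ x) fun x => pairVisits γ x.1 x.2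
  let target : X ⊕ X × X → ℝ :=
    Sum.elim (fun x => G.occ θ x) fun x => G.occ θ x.1 * G.resolvent θ x.1 x.2
  have hfM (j) (y) : |f j y| ≤ M := by
    rcases j with x | x
    exacts [abs_visits_le hγ hγ' x y, abs_pairVisits_le hγ hγ' x.1 x.2 y]
  have hft (j) : |∑ y, G.trajProb θ y * f j y - target j| ≤ κ₁ * √ε := by
    rcases j with x | x
    · refine (abs_mean_visits_sub_occ_le hγ hγ' G θ x).trans (le_trans ?_ hbias)
      have e : γ ^ (h + 1) / (1 - γ) ≤ γ ^ (h + 1) / (1 - γ) ^ 2 := by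
        have := pow_nonneg hγ (h + 1)
        refine div_le_div_of_nonneg_left this (by positivity) ?_
        nlinarith
      have : 0 ≤ (h + 1) * γ ^ (h + 1) / (1 - γ) := by positivity
      linarith
    · exact (abs_mean_pairVisits_sub_le hγ hγ' G θ x.1 x.2).trans hbias
  have hsub : (univ.filter fun x : Batch S A b h => ¬ G.Accurate θ ((κ₀ + κ₁) * √ε) x) ⊆
      univ.filter fun x : Batch S A b h => ∃ j, κ₀ * √ε <
        |1 / (b : ℝ) * ∑ i, f j (x i) - ∑ y, G.trajProb θ y * f j y| := by
    intro x hx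
    simp only [Finset.mem_filter, Finset.mem_univ, true_and] at hx ⊢
    by_contra hc
    push Not at hc
    have hj (j) : |1 / (b : ℝ) * ∑ i, f j (x i) - target j| ≤ (κ₀ + κ₁) * √ε := by
      have := abs_sub_le (1 / (b : ℝ) * ∑ i, f j (x i)) (∑ y, G.trajProb θ y * f j y) (target j)
      have h3 := hc j
      have h4 := hft j
      linarith
    exact hx ⟨fun y => hj (Sum.inl y), fun y z => hj (Sum.inr (y, z))⟩
  have hexp : Real.exp (-(b * ((κ₀ * √ε) ^ 2 / (8 * M ^ 2)))) ≤ q / (2 * n) := by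
    have e : (κ₀ * √ε) ^ 2 / (8 * M ^ 2) = (1 + Real.log (2 * n)) * ε := by
      rw [mul_pow, Real.sq_sqrt hε.le, hκ₀, Real.sq_sqrt (by positivity)]
      field_simp
    have h2 : q / (2 * n) = Real.exp (-(L + Real.log (2 * n))) := by
      rw [neg_add, Real.exp_add, Real.exp_neg, Real.exp_neg, Real.exp_log (one_div_pos.mpr hq),
        Real.exp_log (by linarith : 0 < 2 * n)]
      field_simp
    rw [h2, Real.exp_le_exp, e, neg_le_neg_iff]
    have h3 : L ≤ b * ε := by rwa [div_le_iff₀ hε] at hb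
    nlinarith
  calc _ ≤ _ := Finset.sum_le_sum_of_subset_of_nonneg hsub fun x _ _ =>
        Finset.prod_nonneg fun j _ => G.trajProb_nonneg θ (x j)
    _ ≤ _ := sum_filter_exists_le
        (fun x => Finset.prod_nonneg fun j _ => G.trajProb_nonneg θ (x j)) _
    _ ≤ ∑ j : X ⊕ X × X, 2 * (q / (2 * n)) := by
        refine Finset.sum_le_sum fun j _ => ?_
        refine (sum_prod_abs_tail_le (fun y => G.trajProb_nonneg θ y) (G.sum_trajProb θ h) hM
          (hfM j) hb0 (by positivity)).trans ?_
        linarith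
    _ = (Fintype.card (X ⊕ X × X) : ℝ) * (q / n) := by
        rw [Finset.sum_const, Finset.card_univ, nsmul_eq_mul]
        field_simp
    _ ≤ n * (q / n) := by
        refine mul_le_mul_of_nonneg_right ?_ (by positivity)
        simp only [n]; linarith
    _ = q := by field_simp

end Accuracy

/-! ### Conditioning on the history of a run -/

section Run

variable (G : Problem S A p d γ) (I : Input p d)

/-- The iterates are adapted: fixing the batches before `k` fixes `θ^k`, so the conditional law of
batch `k` is that of a fixed policy. -/
theorem iter_congr {x x' : ∀ k, Batch S A (I.batch k) (I.len k)} {k : ℕ}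
    (h : ∀ j < k, x j = x' j) : G.iter I x k = G.iter I x' k := by
  induction k with
  | zero => rfl
  | succ k ih =>
    simp only [iter, ih fun j hj => h j (hj.trans (Nat.lt_succ_self k)), h k (Nat.lt_succ_self k)]

variable {G I} {Ω : Type*} [MeasurableSpace Ω] {μ : MeasureTheory.Measure Ω}
  [MeasureTheory.IsProbabilityMeasure μ] {τ : ∀ k, Ω → Batch S A (I.batch k) (I.len k)}

open Classical in
/-- An event about the policy parameter and the batch of the same iteration is as unlikely as it
is for each fixed parameter. -/
theorem IsRun.measureReal_le (hτ : G.IsRun I μ τ) (k : ℕ)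
    (P : Param p → Batch S A (I.batch k) (I.len k) → Prop) {q : ℝ}
    (hP : ∀ θ, ∑ x with P θ x, ∏ j, G.trajProb θ (x j) ≤ q) :
    μ.real {ω | P (G.runParam I τ k ω) (τ k ω)} ≤ q := by
  have hΩ : Nonempty Ω := MeasureTheory.nonempty_of_isProbabilityMeasure μ
  obtain ⟨ω₀⟩ := hΩ
  let Y := ∀ j : Fin k, Batch S A (I.batch j) (I.len j)
  -- A history is extended to a full sequence by the batches of an arbitrary sample point; the
  -- entries from `k` on do not affect `θ^k`.
  let ext : Y → ∀ j, Batch S A (I.batch j) (I.len j) :=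
    fun y j => if hj : j < k then y ⟨j, hj⟩ else τ j ω₀
  have hext (y : Y) (j : Fin k) : ext y j = y j := by simp [ext]
  let cyl : Y → Set Ω := fun y => {ω | ∀ j < k, τ j ω = ext y j}
  have hq : 0 ≤ q := le_trans (Finset.sum_nonneg fun x _ =>
    Finset.prod_nonneg fun j _ => G.trajProb_nonneg 0 (x j)) (hP 0)
  have hmeas (y : Y) : MeasurableSet (cyl y) := by
    have : cyl y = ⋂ j, ⋂ (_ : j < k), {ω | τ j ω = ext y j} := by
      ext ω; simp [cyl]
    rw [this]
    exact MeasurableSet.iInter fun j => MeasurableSet.iInter fun _ => hτ.measurable j _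
  have hdisj : Set.PairwiseDisjoint (↑(univ : Finset Y)) cyl := by
    intro y _ y' _ hne
    refine Set.disjoint_left.mpr fun ω h1 h2 => hne (funext fun j => ?_)
    rw [← hext y, ← hext y', ← h1 j j.2, ← h2 j j.2]
  have hsum : ∑ y, μ.real (cyl y) ≤ 1 := by
    rw [← MeasureTheory.measureReal_biUnion_finset hdisj fun y _ => hmeas y]
    exact MeasureTheory.measureReal_le_one
  have hcyl (y : Y) : μ.real ({ω | P (G.runParam I τ k ω) (τ k ω)} ∩ cyl y) ≤
      μ.real (cyl y) * q := by
    set θ := (G.iter I (ext y) k).1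
    -- On the cylinder of a history the parameter is the constant `θ`, so the event splits over the
    -- values `z` of the next batch, whose probabilities are given by the law of the run.
    have hsub : {ω | P (G.runParam I τ k ω) (τ k ω)} ∩ cyl y ⊆
        ⋃ z ∈ (univ.filter fun z => P θ z),
          {ω | ∀ j ≤ k, τ j ω = Function.update (ext y) k z j} := by
      rintro ω ⟨h1, h2⟩
      have e : G.runParam I τ k ω = θ := by
        rw [runParam, iter_congr G I (x' := ext y) h2]
      simp only [Set.mem_iUnion, Finset.mem_filter, Finset.mem_univ, true_and, Set.mem_ofPred_eq]
      refine ⟨τ k ω, by rw [← e]; exact h1, fun j hj => ?_⟩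
      rcases hj.eq_or_lt with rfl | hj
      · simp
      · rw [Function.update_of_ne hj.ne]; exact h2 j hj
    calc _ ≤ μ.real (⋃ z ∈ (univ.filter fun z => P θ z),
          {ω | ∀ j ≤ k, τ j ω = Function.update (ext y) k z j}) :=
          MeasureTheory.measureReal_mono hsub (MeasureTheory.measure_ne_top _ _)
      _ ≤ ∑ z with P θ z, μ.real {ω | ∀ j ≤ k, τ j ω = Function.update (ext y) k z j} :=
          MeasureTheory.measureReal_biUnion_finset_le _ _
      _ = ∑ z with P θ z, μ.real (cyl y) * ∏ b, G.trajProb θ (z b) := by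
          refine Finset.sum_congr rfl fun z _ => ?_
          rw [hτ.law k]
          have e1 : ∀ j < k, Function.update (ext y) k z j = ext y j := fun j hj =>
            Function.update_of_ne hj.ne _ _
          rw [iter_congr G I e1, Function.update_self]
          congr 2
          ext ω
          exact forall₂_congr fun j hj => by rw [e1 j hj]
      _ ≤ μ.real (cyl y) * q := by
          rw [← Finset.mul_sum]
          exact mul_le_mul_of_nonneg_left (hP θ) MeasureTheory.measureReal_nonneg
  have hcover : {ω | P (G.runParam I τ k ω) (τ k ω)} ⊆
      ⋃ y ∈ (univ : Finset Y), {ω | P (G.runParam I τ k ω) (τ k ω)} ∩ cyl y := by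
    intro ω hω
    simp only [Set.mem_iUnion, Finset.mem_univ, exists_true_left]
    exact ⟨fun j => τ j ω, hω, fun j hj => (hext (fun j => τ j ω) ⟨j, hj⟩).symm⟩
  calc _ ≤ _ := MeasureTheory.measureReal_mono hcover (MeasureTheory.measure_ne_top _ _)
    _ ≤ _ := MeasureTheory.measureReal_biUnion_finset_le _ _
    _ ≤ ∑ y, μ.real (cyl y) * q := Finset.sum_le_sum fun y _ => hcyl y
    _ ≤ 1 * q := by rw [← Finset.sum_mul]; exact mul_le_mul_of_nonneg_right hsum hq
    _ = q := one_mul q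

end Run

end Problem
end DSAC

/-! ### Deterministic consequences of accuracy -/

namespace DSAC

open Finset

namespace Problem

variable {ι : Type*} [Fintype ι] [DecidableEq ι] {S A : ι → Type*}
  [∀ i, Fintype (S i)] [∀ i, DecidableEq (S i)] [∀ i, Fintype (A i)] [∀ i, DecidableEq (A i)]
  {p : ι → ℕ} {d b h : ℕ}

section Empirical

variable {γ : ℝ}

variable (γ) in
/-- The empirical global occupancy measure of a batch. -/
noncomputable def batchOcc (x : Batch S A b h) (y : Joint S × Joint A) : ℝ :=
  batchMean (visits γ y) x

variable (γ) in
/-- The empirical discounted frequency of ordered pairs of visits in a batch. -/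
noncomputable def batchPair (x : Batch S A b h) (y z : Joint S × Joint A) : ℝ :=
  batchMean (pairVisits γ y z) x

/-- A discounted batch average is an integral against the empirical occupancy measure. Thus each
stochastic direction is its exact counterpart with `λ` replaced, and the trajectories can be
forgotten. -/
theorem sum_batchOcc_smul {V : Type*} [AddCommGroup V] [Module ℝ V] (x : Batch S A b h)
    (g : Joint S × Joint A → V) :
    ∑ y, batchOcc γ x y • g y = (1 / (b : ℝ)) • ∑ j, ∑ t : Fin (h + 1), γ ^ t.val • g (x j t) := by
  simp_rw [batchOcc, batchMean, mul_smul, ← Finset.smul_sum, visits, Finset.sum_smul]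
  rw [Finset.sum_comm]
  congr 1
  refine Finset.sum_congr rfl fun j _ => ?_
  rw [Finset.sum_comm]
  refine Finset.sum_congr rfl fun t _ => ?_
  simp

theorem sum_batchPair_smul {V : Type*} [AddCommGroup V] [Module ℝ V] (x : Batch S A b h)
    (g : Joint S × Joint A → Joint S × Joint A → V) :
    ∑ y, ∑ z, batchPair γ x y z • g y z = (1 / (b : ℝ)) • ∑ j, ∑ t : Fin (h + 1),
      ∑ t' ∈ Finset.Ici t, (γ ^ t.val * γ ^ (t'.val - t.val)) • g (x j t) (x j t') := by
  refine (Fintype.sum_prod_type' fun y z => batchPair γ x y z • g y z).symm.trans ?_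
  simp_rw [batchPair, batchMean, mul_smul, ← Finset.smul_sum, pairVisits, Finset.sum_smul]
  rw [Finset.sum_comm]
  congr 1
  refine Finset.sum_congr rfl fun j _ => ?_
  rw [Finset.sum_comm]
  refine Finset.sum_congr rfl fun t _ => ?_
  rw [Finset.sum_comm, Finset.smul_sum]
  refine Finset.sum_congr rfl fun t' _ => ?_
  simp_rw [mul_smul, ← Finset.smul_sum]
  rw [Fintype.sum_prod_type]
  simp only [ite_smul, one_smul, zero_smul, Finset.sum_ite_irrel, Finset.sum_const_zero,
    Finset.sum_ite_eq, Finset.mem_univ, if_true]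

theorem batchOcc_nonneg (hγ : 0 ≤ γ) (x : Batch S A b h) (y : Joint S × Joint A) :
    0 ≤ batchOcc γ x y :=
  mul_nonneg (by positivity) (Finset.sum_nonneg fun j _ => visits_nonneg hγ y (x j))

theorem mean_le {f : Fin b → ℝ} {M : ℝ} (hM : 0 ≤ M) (hf : ∀ j, f j ≤ M) :
    1 / (b : ℝ) * ∑ j, f j ≤ M := by
  -- The mean of an empty batch is `0`, since `1 / 0 = 0`; this case needs `0 ≤ M`.
  rcases Nat.eq_zero_or_pos b with rfl | hb
  · simpa using hM
  · have hb' : (0 : ℝ) < b := by exact_mod_cast hb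
    have := Finset.sum_le_sum fun j (_ : j ∈ univ) => hf j
    rw [Finset.sum_const, Finset.card_univ, Fintype.card_fin, nsmul_eq_mul] at this
    rw [one_div, inv_mul_le_iff₀ hb']
    exact this

theorem sum_batchOcc_le (hγ : 0 ≤ γ) (hγ' : γ < 1) (x : Batch S A b h) :
    ∑ y, batchOcc γ x y ≤ 1 / (1 - γ) := by
  have h1 : 0 < 1 - γ := by linarith
  have : ∑ y, batchOcc γ x y = 1 / (b : ℝ) * ∑ j, ∑ y, visits γ y (x j) := by
    simp_rw [batchOcc, batchMean]
    rw [← Finset.mul_sum, Finset.sum_comm]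
  rw [this]
  exact mean_le (by positivity) fun j => sum_visits_le hγ hγ' (x j)

theorem abs_batchPair_le (hγ : 0 ≤ γ) (hγ' : γ < 1) (x : Batch S A b h)
    (y z : Joint S × Joint A) : |batchPair γ x y z| ≤ (1 / (1 - γ)) ^ 2 := by
  have h0 : 0 ≤ batchPair γ x y z :=
    mul_nonneg (by positivity) (Finset.sum_nonneg fun j _ => pairVisits_nonneg hγ y z (x j))
  rw [abs_of_nonneg h0]
  exact mean_le (sq_nonneg _) fun j => (le_abs_self _).trans (abs_pairVisits_le hγ hγ' y z (x j))

variable (G : Problem S A p d γ) (x : Batch S A b h) (i : ι)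

theorem empOcc_eq : G.empOcc x i = marg i (WithLp.toLp 2 (batchOcc γ x)) := by
  ext z
  have h := sum_batchOcc_smul (γ := γ) x
    (fun y : Joint S × Joint A => if y.1 i = z.1 ∧ y.2 i = z.2 then (1 : ℝ) else 0)
  simp only [smul_eq_mul, mul_ite, mul_one, mul_zero] at h
  rw [marg_apply, h, empOcc]
  simp only [PiLp.smul_apply, smul_eq_mul, WithLp.ofLp_sum, WithLp.ofLp_smul, Finset.sum_apply,
    Pi.smul_apply, PiLp.ofLp_single]
  congr 1
  refine Finset.sum_congr rfl fun j _ => Finset.sum_congr rfl fun t _ => ?_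
  simp [Pi.single_apply, Prod.ext_iff, eq_comm]

theorem empOcc_mem_massRegion (hγ : 0 ≤ γ) (hγ' : γ < 1) : G.empOcc x i ∈ massRegion i S A γ := by
  rw [empOcc_eq]
  exact marg_mem_massRegion i (batchOcc_nonneg hγ x) (sum_batchOcc_le hγ hγ' x)

/-- The target vector of the stochastic critic step of agent `i`. -/
noncomputable def batchTarget : EuclideanSpace ℝ (Fin d) :=
  featSum G.featSA fun y => ∑ z, batchPair γ x y z * G.empReward x i (z.1 i, z.2 i)

/-- The exact counterpart of `batchTarget`. -/
noncomputable def critTarget (θ : Param p) : EuclideanSpace ℝ (Fin d) :=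
  featSum G.featSA fun y => G.occ θ y * G.locShadowQ θ i y

/-- The stochastic critic gradient is affine in `w`. Its linear part is the same for all agents;
only the target depends on the local rewards, through the pair frequencies. -/
theorem mean_criticGradTraj (w : EuclideanSpace ℝ (Fin d)) :
    (1 / (b : ℝ)) • ∑ j, G.criticGradTraj (x j) i (G.empReward x i) w =
      featCov G.featSA (batchOcc γ x) w - G.batchTarget x i := by
  have h1 := sum_batchOcc_smul (γ := γ) x fun y => G.critic w y • G.featSA y
  have h2 := sum_batchPair_smul (γ := γ) x fun y z =>
    G.empReward x i (z.1 i, z.2 i) • G.featSA y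
  have e1 : featCov G.featSA (batchOcc γ x) w =
      ∑ y, batchOcc γ x y • G.critic w y • G.featSA y := by
    simp_rw [featCov_apply, smul_smul]; rfl
  have e2 : G.batchTarget x i = ∑ y, ∑ z, batchPair γ x y z •
      G.empReward x i (z.1 i, z.2 i) • G.featSA y := by
    simp_rw [batchTarget, featSum, Finset.sum_smul, smul_smul]
  rw [e1, e2, h1, h2, ← smul_sub, ← Finset.sum_sub_distrib]
  congr 1
  refine Finset.sum_congr rfl fun j _ => ?_
  rw [criticGradTraj, ← Finset.sum_sub_distrib]
  refine Finset.sum_congr rfl fun t _ => ?_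
  simp_rw [smul_smul, ← Finset.sum_smul, ← sub_smul, mul_sub, Finset.mul_sum, mul_assoc]
  rfl

/-- The actor direction of agent `i` computed from a batch. -/
noncomputable def batchGrad (ϑ : EuclideanSpace ℝ (Fin (p i))) (w : EuclideanSpace ℝ (Fin d)) :
    EuclideanSpace ℝ (Fin (p i)) :=
  (1 / (b : ℝ)) • ∑ j, G.actorGradTraj (x j) i ϑ w

theorem batchGrad_eq (ϑ : EuclideanSpace ℝ (Fin (p i))) (w : EuclideanSpace ℝ (Fin d)) :
    G.batchGrad x i ϑ w = ∑ y, (batchOcc γ x y * G.critic w y) • G.score i ϑ y.1 (y.2 i) := by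
  have h1 := sum_batchOcc_smul (γ := γ) x fun y => G.critic w y • G.score i ϑ y.1 (y.2 i)
  simp_rw [smul_smul] at h1
  rw [h1]
  rfl

end Empirical

variable {K : Constants} {G : Problem S A p d K.γ} {W r : ℝ} {θ : Param p} {x : Batch S A b h}

theorem sum_abs_batchOcc_sub_le (hx : G.Accurate θ r x) :
    ∑ y, |batchOcc K.γ x y - G.occ θ y| ≤ Fintype.card (Joint S × Joint A) * r := by
  refine (Finset.sum_le_sum fun y _ => hx.1 y).trans_eq ?_
  rw [Finset.sum_const, Finset.card_univ, nsmul_eq_mul]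

theorem abs_empReward_sub_le (hG : G.Assumptions K W) (hx : G.Accurate θ r x) (i : ι)
    (z : S i × A i) :
    |G.empReward x i z - gradient (G.util i) (G.locOcc θ i) z| ≤
      K.L_lam * (Fintype.card (Joint S × Joint A) * r) := by
  refine (hG.util_lip i _ (G.empOcc_mem_massRegion x i K.γ_nonneg K.γ_lt_one) _
    (locOcc_mem_massRegion K.γ_nonneg K.γ_lt_one θ i) z).trans
    (mul_le_mul_of_nonneg_left ?_ K.L_lam_pos.le)
  refine le_trans ?_ (sum_abs_batchOcc_sub_le hx)
  rw [empOcc_eq, locOcc, ← margL_apply, ← margL_apply, ← map_sub]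
  exact norm_marg_le i _

variable (S A K) in
/-- The error of the critic target of an agent on a batch of accuracy `r` is at most `r` times
this constant. -/
noncomputable def targetConst : ℝ :=
  (Fintype.card (Joint S × Joint A) : ℝ) ^ 2 * (K.C_F + (1 / (1 - K.γ)) ^ 2 *
    (K.L_lam * Fintype.card (Joint S × Joint A))) * K.C_φ

omit [∀ i, DecidableEq (S i)] [∀ i, DecidableEq (A i)] in
theorem targetConst_nonneg : 0 ≤ targetConst S A K := by
  have := K.C_F_pos
  have := K.L_lam_pos
  have := K.C_φ_pos
  unfold targetConst
  positivity

/-- A product of two estimates is compared with a product of exact values: the reward error is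
weighted by bounded pair frequencies, the frequency error by exact rewards bounded by `C_F`. No
independence between the two estimates is involved. -/
theorem norm_batchTarget_sub_le (hG : G.Assumptions K W) (hx : G.Accurate θ r x) (i : ι) :
    ‖G.batchTarget x i - G.critTarget i θ‖ ≤ targetConst S A K * r := by
  have hL := K.L_lam_pos
  set n : ℝ := (Fintype.card (Joint S × Joint A) : ℝ) with hn
  rw [batchTarget, critTarget, featSum_sub]
  refine (norm_featSum_le (norm_featSA_le hG) _).trans ?_
  have key (y : Joint S × Joint A) :
      |∑ z, batchPair K.γ x y z * G.empReward x i (z.1 i, z.2 i) -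
        G.occ θ y * G.locShadowQ θ i y| ≤
      n * ((1 / (1 - K.γ)) ^ 2 * (K.L_lam * (n * r)) + r * K.C_F) := by
    rw [locShadowQ, qValue_eq θ K.γ_nonneg K.γ_lt_one, Finset.mul_sum, ← Finset.sum_sub_distrib]
    refine (Finset.abs_sum_le_sum_abs _ _).trans ?_
    rw [hn, ← nsmul_eq_mul, ← Finset.card_univ, ← Finset.sum_const]
    refine Finset.sum_le_sum fun z _ => ?_
    set g := gradient (G.util i) (G.locOcc θ i) (z.1 i, z.2 i)
    have e : batchPair K.γ x y z * G.empReward x i (z.1 i, z.2 i) -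
        G.occ θ y * (G.resolvent θ y z * g) =
        batchPair K.γ x y z * (G.empReward x i (z.1 i, z.2 i) - g) +
        (batchPair K.γ x y z - G.occ θ y * G.resolvent θ y z) * g := by ring
    rw [e]
    refine (abs_add_le _ _).trans (add_le_add ?_ ?_)
    · rw [abs_mul]
      exact mul_le_mul (abs_batchPair_le K.γ_nonneg K.γ_lt_one x y z)
        (abs_empReward_sub_le hG hx i _) (abs_nonneg _) (sq_nonneg _)
    · rw [abs_mul]
      exact mul_le_mul (hx.2 y z) (hG.util_bound θ i _) (abs_nonneg _)
        ((abs_nonneg _).trans (hx.2 y z))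
  calc _ ≤ (∑ y : Joint S × Joint A,
        n * ((1 / (1 - K.γ)) ^ 2 * (K.L_lam * (n * r)) + r * K.C_F)) * K.C_φ :=
        mul_le_mul_of_nonneg_right (Finset.sum_le_sum fun y _ => key y) K.C_φ_pos.le
    _ = targetConst S A K * r := by
        rw [Finset.sum_const, Finset.card_univ, nsmul_eq_mul, targetConst, ← hn]
        ring

theorem norm_critTarget_le (hG : G.Assumptions K W) (i : ι) :
    ‖G.critTarget i θ‖ ≤ K.C_F / (1 - K.γ) ^ 2 * K.C_φ := by
  refine (norm_featSum_le (norm_featSA_le hG) _).trans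
    (mul_le_mul_of_nonneg_right ?_ K.C_φ_pos.le)
  calc _ ≤ ∑ y, G.occ θ y * (K.C_F / (1 - K.γ)) := by
        refine Finset.sum_le_sum fun y _ => ?_
        have h0 := occ_nonneg (G := G) θ K.γ_nonneg K.γ_lt_one y
        rw [abs_mul, abs_of_nonneg h0]
        exact mul_le_mul_of_nonneg_left (abs_locShadowQ_le hG θ i y) h0
    _ = _ := by
        rw [← Finset.sum_mul, sum_occ θ K.γ_nonneg K.γ_lt_one]
        have : 1 - K.γ ≠ 0 := by linarith [K.γ_lt_one]
        field_simp

theorem avg_critTarget : avg (fun i => G.critTarget i θ) =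
    featSum G.featSA fun y => G.occ θ y * G.avgQ θ y := by
  simp_rw [avg, critTarget, featSum]
  rw [Finset.sum_comm, Finset.smul_sum]
  refine Finset.sum_congr rfl fun y _ => ?_
  rw [← Finset.sum_smul, smul_smul, ← Finset.mul_sum, avgQ]
  congr 1
  ring

theorem norm_featCov_batchOcc_sub_le (hG : G.Assumptions K W) (hx : G.Accurate θ r x)
    (w : EuclideanSpace ℝ (Fin d)) :
    ‖featCov G.featSA (batchOcc K.γ x) w - featCov G.featSA (G.occ θ) w‖ ≤
      Fintype.card (Joint S × Joint A) * r * (K.C_φ ^ 2 * ‖w‖) := by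
  rw [featCov_sub]
  exact (norm_featCov_le (norm_featSA_le hG) _ w).trans
    (mul_le_mul_of_nonneg_right (sum_abs_batchOcc_sub_le hx) (by positivity))

theorem coercive_batchOcc (hG : G.Assumptions K W) (hx : G.Accurate θ r x)
    (hθ : StrongConvexOn Set.univ K.μ_w (G.criticObj θ)) (w : EuclideanSpace ℝ (Fin d)) :
    (K.μ_w - Fintype.card (Joint S × Joint A) * r * K.C_φ ^ 2) * ‖w‖ ^ 2 ≤
      inner ℝ (featCov G.featSA (batchOcc K.γ x) w) w := by
  have h1 := G.coercive_of_strongConvexOn hθ w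
  have h2 := norm_featCov_batchOcc_sub_le hG hx w
  have h3 := abs_real_inner_le_norm
    (featCov G.featSA (batchOcc K.γ x) w - featCov G.featSA (G.occ θ) w) w
  have h4 := mul_le_mul_of_nonneg_right h2 (norm_nonneg w)
  rw [inner_sub_left] at h3
  have h5 := neg_le_of_abs_le h3
  nlinarith

/-- The change of critic is measured under the empirical measure, whose mass is at most `1 / (1 -
γ)`; the change of measure is then felt only by the fixed critic `w'`. -/
theorem norm_batchGrad_sub_le (hG : G.Assumptions K W) (hx : G.Accurate θ r x) (i : ι)
    (w w' : EuclideanSpace ℝ (Fin d)) :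
    ‖G.batchGrad x i (θ i) w - G.polGrad θ w' i‖ ≤
      K.C_φ * K.C_π / (1 - K.γ) * ‖w - w'‖ +
        Fintype.card (Joint S × Joint A) * r * (K.C_φ * ‖w'‖ * K.C_π) := by
  have hπ := K.C_π_pos
  have hφ := K.C_φ_pos
  have e : G.batchGrad x i (θ i) w - G.polGrad θ w' i =
      ∑ y, (batchOcc K.γ x y * G.critic (w - w') y) • G.score i (θ i) y.1 (y.2 i) +
      ∑ y, ((batchOcc K.γ x y - G.occ θ y) * G.critic w' y) • G.score i (θ i) y.1 (y.2 i) := by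
    rw [batchGrad_eq, polGrad, ← Finset.sum_sub_distrib, ← Finset.sum_add_distrib]
    refine Finset.sum_congr rfl fun y _ => ?_
    rw [← sub_smul, ← add_smul, critic_eq, critic_eq, critic_eq, inner_sub_right]
    congr 1
    ring
  have hterm (v : Joint S × Joint A → ℝ) (u : EuclideanSpace ℝ (Fin d)) :
      ‖∑ y, (v y * G.critic u y) • G.score i (θ i) y.1 (y.2 i)‖ ≤
        (∑ y, |v y|) * (K.C_φ * ‖u‖ * K.C_π) := by
    rw [Finset.sum_mul]
    refine (norm_sum_le _ _).trans (Finset.sum_le_sum fun y _ => ?_)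
    rw [norm_smul, Real.norm_eq_abs, abs_mul, mul_assoc]
    refine mul_le_mul_of_nonneg_left ?_ (abs_nonneg _)
    exact mul_le_mul (abs_inner_feat_le (norm_featSA_le hG) y u) (hG.score_bound _ _ _ _)
      (norm_nonneg _) (by positivity)
  rw [e]
  refine (norm_add_le _ _).trans (add_le_add ((hterm _ _).trans ?_) ((hterm _ _).trans ?_))
  · have : ∑ y, |batchOcc K.γ x y| ≤ 1 / (1 - K.γ) := by
      simp_rw [abs_of_nonneg (batchOcc_nonneg K.γ_nonneg x _)]
      exact sum_batchOcc_le K.γ_nonneg K.γ_lt_one x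
    calc _ ≤ 1 / (1 - K.γ) * (K.C_φ * ‖w - w'‖ * K.C_π) :=
          mul_le_mul_of_nonneg_right this (by positivity)
      _ = _ := by ring
  · exact mul_le_mul_of_nonneg_right (sum_abs_batchOcc_sub_le hx) (by positivity)

end Problem
end DSAC

/-! ### One iteration of the algorithm on an accurate batch -/

namespace DSAC

open Finset

theorem Constants.L_w_pos (K : Constants) : 0 < K.L_w := by
  have := K.C_φ_pos
  have : 0 < 1 - K.γ := by linarith [K.γ_lt_one]
  unfold Constants.L_w
  positivity

theorem Constants.L_w_eq (K : Constants) : K.L_w = K.C_φ ^ 2 * (1 / (1 - K.γ)) := by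
  rw [Constants.L_w]; ring

/-- A bound on the norm of the optimal critic. -/
noncomputable def Constants.critRadius (K : Constants) : ℝ :=
  K.C_F * K.C_φ / ((1 - K.γ) ^ 2 * K.μ_w)

theorem Constants.critRadius_pos (K : Constants) : 0 < K.critRadius := by
  have := K.C_F_pos
  have := K.C_φ_pos
  have := K.μ_w_pos
  have : 0 < 1 - K.γ := by linarith [K.γ_lt_one]
  unfold Constants.critRadius
  positivity

/-- The contraction margin of the critic step on accurate batches. -/
noncomputable def Constants.margin (K : Constants) : ℝ := 9 / 20 * (K.μ_w / K.L_w)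

theorem Constants.margin_pos (K : Constants) : 0 < K.margin := by
  have := K.L_w_pos
  have := K.μ_w_pos
  unfold Constants.margin
  positivity

/-- The sensitivity of the actor direction to the critic. -/
noncomputable def Constants.actorSens (K : Constants) : ℝ := K.C_φ * K.C_π / (1 - K.γ)

theorem Constants.actorSens_pos (K : Constants) : 0 < K.actorSens := by
  have := K.C_φ_pos
  have := K.C_π_pos
  have : 0 < 1 - K.γ := by linarith [K.γ_lt_one]
  unfold Constants.actorSens
  positivity

theorem Constants.actorStep_pos (K : Constants) {N : ℕ} (hN : 0 < N) {C_w : ℝ} (hC : 0 < C_w) :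
    0 < K.actorStep N C_w := by
  have := K.L_w_pos
  have := K.μ_w_pos
  have := K.C_φ_pos
  have := K.C_π_pos
  have := K.L_θ_pos
  have : 0 < 1 - K.γ := by linarith [K.γ_lt_one]
  have : 0 < max (4 * √(3 * (N : ℝ))) (6 * √10) := lt_max_of_lt_right (by positivity)
  unfold Constants.actorStep
  exact lt_min (by positivity) (by positivity)

theorem Constants.actorStep_le (K : Constants) (N : ℕ) (C_w : ℝ) :
    K.actorStep N C_w ≤ 1 / (4 * K.L_θ) := min_le_right _ _

/-- The entry `4 √(3 N)` of the maximum is made for this: its square cancels the factor `3 N`, and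
the remaining factors of the step cancel `C_w` and the actor sensitivity. -/
theorem Constants.actorStep_sq_le (K : Constants) {N : ℕ} (hN : 0 < N) {C_w : ℝ} (hC : 0 < C_w) :
    3 * K.actorSens ^ 2 * N * (C_w * K.actorStep N C_w) ^ 2 ≤ (K.μ_w / K.L_w) ^ 2 / 16 := by
  have hL := K.L_w_pos
  have hμ := K.μ_w_pos
  have hφ := K.C_φ_pos
  have hπ := K.C_π_pos
  have h1 : 0 < 1 - K.γ := by linarith [K.γ_lt_one]
  have hN' : (0 : ℝ) < N := by exact_mod_cast hN
  have hs : 0 < 4 * √(3 * (N : ℝ)) := by positivity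
  have hstep := (K.actorStep_pos hN hC).le
  have h2 : K.actorStep N C_w ≤
      ((1 - K.γ) * K.μ_w / K.L_w) / (C_w * K.C_φ * K.C_π) * (1 / (4 * √(3 * N))) := by
    refine (min_le_left _ _).trans ?_
    gcongr
    exact le_max_left _ _
  calc _ ≤ 3 * K.actorSens ^ 2 * N *
        (C_w * (((1 - K.γ) * K.μ_w / K.L_w) / (C_w * K.C_φ * K.C_π) * (1 / (4 * √(3 * N))))) ^ 2 := by
        gcongr
    _ = (K.μ_w / K.L_w) ^ 2 * (3 * N / (√(3 * N)) ^ 2) / 16 := by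
        rw [Constants.actorSens]
        field_simp
        ring
    _ = _ := by rw [Real.sq_sqrt (by positivity), div_self (by positivity), mul_one]

namespace Problem

variable {ι : Type*} [Fintype ι] [DecidableEq ι] [Nonempty ι] {S A : ι → Type*}
  [∀ i, Fintype (S i)] [∀ i, DecidableEq (S i)] [∀ i, Fintype (A i)] [∀ i, DecidableEq (A i)]
  {p : ι → ℕ} {d b h : ℕ}

/-- Because all agents apply the same linear map, their average performs exactly one gradient step
with the averaged target. -/
theorem avg_sub_smul (w v : ι → EuclideanSpace ℝ (Fin d)) (c : ℝ)
    (f : EuclideanSpace ℝ (Fin d) →ₗ[ℝ] EuclideanSpace ℝ (Fin d)) :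
    avg (fun i => w i - c • (f (w i) - v i)) = avg w - c • (f (avg w) - avg v) := by
  simp only [avg, Finset.sum_sub_distrib, ← Finset.smul_sum, map_smul, map_sum, smul_sub]
  simp only [smul_comm c]

theorem norm_avg_le {v : ι → EuclideanSpace ℝ (Fin d)} {M : ℝ} (hv : ∀ i, ‖v i‖ ≤ M) :
    ‖avg v‖ ≤ M := by
  have hN : (0 : ℝ) < Fintype.card ι := by exact_mod_cast Fintype.card_pos
  rw [avg, norm_smul, Real.norm_of_nonneg (by positivity), one_div, inv_mul_le_iff₀ hN]
  refine (norm_sum_le _ _).trans ((Finset.sum_le_sum fun i _ => hv i).trans_eq ?_)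
  rw [Finset.sum_const, Finset.card_univ, nsmul_eq_mul]

theorem avg_sub (v v' : ι → EuclideanSpace ℝ (Fin d)) :
    avg (fun i => v i - v' i) = avg v - avg v' := by
  simp only [avg, Finset.sum_sub_distrib, smul_sub]

variable {K : Constants} {G : Problem S A p d K.γ} {W r ε : ℝ} {θ : Param p} {x : Batch S A b h}
  {w : ι → EuclideanSpace ℝ (Fin d)} {m : ℕ}

theorem criticUpdate_eq (G : Problem S A p d K.γ) (x : Batch S A b h) (η : ℝ) (m : ℕ)
    (w : ι → EuclideanSpace ℝ (Fin d)) :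
    G.criticUpdate x η m w = G.mixRound^[m] fun i =>
      w i - η • (featCov G.featSA (batchOcc K.γ x) (w i) - G.batchTarget x i) := by
  simp_rw [criticUpdate, G.mean_criticGradTraj]

variable (G K) in
theorem norm_sub_smul_batchCov_le (hG : G.Assumptions K W) (x : Batch S A b h)
    (v : EuclideanSpace ℝ (Fin d)) :
    ‖v - (1 / K.L_w) • featCov G.featSA (batchOcc K.γ x) v‖ ≤ ‖v‖ := by
  have hL := K.L_w_pos
  rw [K.L_w_eq] at hL ⊢
  exact norm_sub_smul_featCov_le (norm_featSA_le hG) (batchOcc_nonneg K.γ_nonneg x)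
    (sum_batchOcc_le K.γ_nonneg K.γ_lt_one x) hL v

/-- Accuracy costs at most a tenth of the strong convexity, so one gradient step multiplies squared
norms by at most `1 - (9/10) μ_w / L_w = 1 - 2α`, and `1 - 2α ≤ (1 - α)²`. This is the origin of the
`9/20` in `margin`. -/
theorem norm_sub_smul_batchCov_le_mul (hG : G.Assumptions K W) (hx : G.Accurate θ r x)
    (hθ : StrongConvexOn Set.univ K.μ_w (G.criticObj θ))
    (hr : Fintype.card (Joint S × Joint A) * r * K.C_φ ^ 2 ≤ K.μ_w / 10)
    (v : EuclideanSpace ℝ (Fin d)) :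
    ‖v - (1 / K.L_w) • featCov G.featSA (batchOcc K.γ x) v‖ ≤ (1 - K.margin) * ‖v‖ := by
  have hL := K.L_w_pos
  have h1 := norm_sub_smul_featCov_sq_le (norm_featSA_le hG) (batchOcc_nonneg K.γ_nonneg x)
    (sum_batchOcc_le K.γ_nonneg K.γ_lt_one x) (K.L_w_eq ▸ hL) v
  rw [← K.L_w_eq] at h1
  have h2 := coercive_batchOcc hG hx hθ v
  set q := ‖v - (1 / K.L_w) • featCov G.featSA (batchOcc K.γ x) v‖
  have h3 : q ^ 2 ≤ (1 - 2 * K.margin) * ‖v‖ ^ 2 := by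
    have h4 : 9 / 10 * K.μ_w * ‖v‖ ^ 2 ≤ inner ℝ (featCov G.featSA (batchOcc K.γ x) v) v :=
      le_trans (mul_le_mul_of_nonneg_right (by linarith) (sq_nonneg _)) h2
    have h5 := mul_le_mul_of_nonneg_left h4 (one_div_pos.mpr hL).le
    have e : 2 * K.margin * ‖v‖ ^ 2 = 1 / K.L_w * (9 / 10 * K.μ_w * ‖v‖ ^ 2) := by
      rw [Constants.margin]; ring
    linarith
  have hq : 0 ≤ q := norm_nonneg _
  rcases (norm_nonneg v).eq_or_lt with h0 | h0
  · rw [← h0] at h3 ⊢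
    nlinarith
  · have h6 : 0 ≤ 1 - 2 * K.margin := by
      by_contra hc
      push Not at hc
      have := mul_neg_of_neg_of_pos hc (pow_pos h0 2)
      linarith [sq_nonneg q]
    have h7 : 0 ≤ 1 - K.margin := by linarith [K.margin_pos]
    refine (sq_le_sq₀ hq (by positivity)).mp ?_
    rw [mul_pow]
    refine h3.trans (mul_le_mul_of_nonneg_right ?_ (sq_nonneg _))
    nlinarith [sq_nonneg K.margin]

/-- One iteration contracts the disagreement of the critics, up to a perturbation. -/
theorem disagreement_criticUpdate_le (hG : G.Assumptions K W) (hx : G.Accurate θ r x)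
    (hm : G.rho ^ m ≤ ε) :
    disagreement (G.criticUpdate x (1 / K.L_w) m w) ≤ ε ^ 2 * (2 * disagreement w +
      2 * (1 / K.L_w) ^ 2 * (Fintype.card ι *
        (K.C_F / (1 - K.γ) ^ 2 * K.C_φ + targetConst S A K * r) ^ 2)) := by
  have hL := K.L_w_pos
  set D := featCov G.featSA (batchOcc K.γ x)
  rw [criticUpdate_eq]
  refine (G.disagreement_mixRound_iterate_le hG.mix_stoch hG.rho_lt_one m _).trans ?_
  have hρ := pow_nonneg G.rho_nonneg m
  refine mul_le_mul (pow_le_pow_left₀ hρ hm 2) ?_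
    (Finset.sum_nonneg fun i _ => sq_nonneg _) (sq_nonneg _)
  -- Any common reference point bounds the disagreement. A target-free step from the average leaves
  -- the nonexpansive image of `w i - avg w` plus the scaled target of agent `i`.
  refine (disagreement_le_sum_norm_sub_sq _ (avg w - (1 / K.L_w) • D (avg w))).trans ?_
  have hterm (i : ι) : ‖w i - (1 / K.L_w) • (D (w i) - G.batchTarget x i) -
      (avg w - (1 / K.L_w) • D (avg w))‖ ^ 2 ≤ 2 * ‖w i - avg w‖ ^ 2 + 2 * (1 / K.L_w) ^ 2 *
        (K.C_F / (1 - K.γ) ^ 2 * K.C_φ + targetConst S A K * r) ^ 2 := by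
    have e : w i - (1 / K.L_w) • (D (w i) - G.batchTarget x i) -
        (avg w - (1 / K.L_w) • D (avg w)) =
        ((w i - avg w) - (1 / K.L_w) • D (w i - avg w)) + (1 / K.L_w) • G.batchTarget x i := by
      rw [map_sub, smul_sub, smul_sub]; abel
    have h1 := norm_sub_smul_batchCov_le K G hG x (w i - avg w)
    have h2 : ‖(1 / K.L_w) • G.batchTarget x i‖ ≤
        1 / K.L_w * (K.C_F / (1 - K.γ) ^ 2 * K.C_φ + targetConst S A K * r) := by
      rw [norm_smul, Real.norm_of_nonneg (by positivity)]
      refine mul_le_mul_of_nonneg_left ?_ (by positivity)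
      have h3 := norm_batchTarget_sub_le hG hx i
      have h4 := norm_critTarget_le (θ := θ) hG i
      have h5 := norm_sub_norm_le (G.batchTarget x i) (G.critTarget i θ)
      linarith
    rw [e]
    calc _ ≤ (‖w i - avg w‖ +
          1 / K.L_w * (K.C_F / (1 - K.γ) ^ 2 * K.C_φ + targetConst S A K * r)) ^ 2 :=
          pow_le_pow_left₀ (norm_nonneg _) ((norm_add_le _ _).trans (add_le_add h1 h2)) 2
      _ ≤ _ := (add_sq_le).trans_eq (by ring)
  refine (Finset.sum_le_sum fun i _ => hterm i).trans_eq ?_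
  rw [Finset.sum_add_distrib, ← Finset.mul_sum, Finset.sum_const, Finset.card_univ, nsmul_eq_mul,
    disagreement]
  ring

variable (S A K) in
/-- The noise of the critic step on a batch of accuracy `r` is at most `r` times this constant. -/
noncomputable def critNoise : ℝ :=
  1 / K.L_w * (targetConst S A K +
    Fintype.card (Joint S × Joint A) * (K.C_φ ^ 2 * K.critRadius))

omit [Nonempty ι] [∀ i, DecidableEq (S i)] [∀ i, DecidableEq (A i)] in
theorem critNoise_nonneg : 0 ≤ critNoise S A K := by
  have := K.L_w_pos
  have := K.critRadius_pos
  have := targetConst_nonneg (S := S) (A := A) (K := K)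
  unfold critNoise
  positivity

/-- One iteration contracts the distance of the average critic to the optimal critic, up to a
perturbation. -/
theorem norm_avg_criticUpdate_sub_le (hG : G.Assumptions K W) (hr0 : 0 ≤ r)
    (hx : G.Accurate θ r x)
    (hθ : StrongConvexOn Set.univ K.μ_w (G.criticObj θ))
    (hr : Fintype.card (Joint S × Joint A) * r * K.C_φ ^ 2 ≤ K.μ_w / 10)
    {u : EuclideanSpace ℝ (Fin d)} (hu : G.IsOptCritic θ u) :
    ‖avg (G.criticUpdate x (1 / K.L_w) m w) - u‖ ≤
      (1 - K.margin) * ‖avg w - u‖ + critNoise S A K * r := by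
  have hL := K.L_w_pos
  set D := featCov G.featSA (batchOcc K.γ x)
  have h1 := norm_sub_smul_batchCov_le_mul hG hx hθ hr (avg w - u)
  have hopt := (G.isOptCritic_iff K.γ_nonneg K.γ_lt_one θ u).mp hu
  rw [← avg_critTarget] at hopt
  -- The normal equation for `u` is inserted, so the noise is the target error minus the covariance
  -- error at `u`; both vanish for exact statistics.
  have e : avg (G.criticUpdate x (1 / K.L_w) m w) - u =
      ((avg w - u) - (1 / K.L_w) • D (avg w - u)) +
      (1 / K.L_w) • (avg (fun i => G.batchTarget x i - G.critTarget i θ) -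
        (D u - featCov G.featSA (G.occ θ) u)) := by
    rw [criticUpdate_eq, G.avg_mixRound_iterate hG.mix_stoch, avg_sub_smul, avg_sub, hopt, map_sub]
    simp only [smul_sub]
    abel
  have h2 := norm_avg_le fun i => norm_batchTarget_sub_le hG hx i
  have h3 := norm_featCov_batchOcc_sub_le hG hx u
  have h4 : ‖u‖ ≤ K.critRadius := norm_isOptCritic_le hG hθ hu
  have hφ := K.C_φ_pos
  rw [e]
  refine (norm_add_le _ _).trans (add_le_add h1 ?_)
  rw [norm_smul, Real.norm_of_nonneg (by positivity), critNoise, mul_assoc]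
  refine mul_le_mul_of_nonneg_left ?_ (by positivity)
  calc _ ≤ _ := norm_sub_le _ _
    _ ≤ targetConst S A K * r +
        Fintype.card (Joint S × Joint A) * r * (K.C_φ ^ 2 * ‖u‖) := add_le_add h2 h3
    _ ≤ targetConst S A K * r +
        Fintype.card (Joint S × Joint A) * r * (K.C_φ ^ 2 * K.critRadius) := by gcongr
    _ = _ := by ring

/-- The joint actor direction computed from a batch with the critics `w`. -/
noncomputable def jointGrad (G : Problem S A p d K.γ) (x : Batch S A b h) (θ : Param p)
    (w : ι → EuclideanSpace ℝ (Fin d)) : Param p :=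
  WithLp.toLp 2 fun i => G.batchGrad x i (θ i) (w i)

theorem actorUpdate_eq (η : ℝ) : G.actorUpdate x η θ w = θ + η • G.jointGrad x θ w := rfl

/-- Critic error, sampling error and mis-specification each enter with the factor `3`. Summed over
the agents, the squared critic errors split into `N` times that of the average plus the
disagreement. -/
theorem norm_jointGrad_sub_sq_le (hG : G.Assumptions K W) (hr0 : 0 ≤ r) (hx : G.Accurate θ r x)
    (hθ : StrongConvexOn Set.univ K.μ_w (G.criticObj θ))
    {u : EuclideanSpace ℝ (Fin d)} (hu : G.IsOptCritic θ u) :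
    ‖G.jointGrad x θ w - gradient G.objective θ‖ ^ 2 ≤
      3 * K.actorSens ^ 2 * Fintype.card ι * ‖avg w - u‖ ^ 2 +
      (3 * K.actorSens ^ 2 * disagreement w + 3 * Fintype.card ι *
        (Fintype.card (Joint S × Joint A) * r * (K.C_φ * K.critRadius * K.C_π)) ^ 2 + 3 * W) := by
  have hφ := K.C_φ_pos
  have hπ := K.C_π_pos
  have hu' : ‖u‖ ≤ K.critRadius := norm_isOptCritic_le hG hθ hu
  set s := Fintype.card (Joint S × Joint A) * r * (K.C_φ * K.critRadius * K.C_π) with hs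
  have hterm (i : ι) : ‖(G.jointGrad x θ w - gradient G.objective θ) i‖ ^ 2 ≤
      3 * K.actorSens ^ 2 * ‖w i - u‖ ^ 2 + 3 * s ^ 2 +
        3 * ‖gradient G.objective θ i - G.polGrad θ u i‖ ^ 2 := by
    have h1 : ‖G.batchGrad x i (θ i) (w i) - G.polGrad θ u i‖ ≤ K.actorSens * ‖w i - u‖ + s := by
      refine (norm_batchGrad_sub_le hG hx i (w i) u).trans (add_le_add le_rfl ?_)
      rw [hs]
      gcongr
    have h2 : ‖(G.jointGrad x θ w - gradient G.objective θ) i‖ ≤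
        K.actorSens * ‖w i - u‖ + s + ‖gradient G.objective θ i - G.polGrad θ u i‖ := by
      have e : (G.jointGrad x θ w - gradient G.objective θ) i =
          (G.batchGrad x i (θ i) (w i) - G.polGrad θ u i) -
          (gradient G.objective θ i - G.polGrad θ u i) := by
        rw [sub_sub_sub_cancel_right]; rfl
      rw [e]
      exact (norm_sub_le _ _).trans (add_le_add h1 le_rfl)
    refine (pow_le_pow_left₀ (norm_nonneg _) h2 2).trans ?_
    set a := K.actorSens * ‖w i - u‖ with ha
    set c := ‖gradient G.objective θ i - G.polGrad θ u i‖
    have : 3 * K.actorSens ^ 2 * ‖w i - u‖ ^ 2 = 3 * a ^ 2 := by rw [ha]; ring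
    rw [this]
    nlinarith [sq_nonneg (a - s), sq_nonneg (a - c), sq_nonneg (s - c)]
  rw [PiLp.norm_sq_eq_of_L2]
  refine (Finset.sum_le_sum fun i _ => hterm i).trans ?_
  rw [Finset.sum_add_distrib, Finset.sum_add_distrib, ← Finset.mul_sum, ← Finset.mul_sum,
    ← Finset.mul_sum, Finset.sum_const, Finset.card_univ, nsmul_eq_mul, sum_norm_sub_sq]
  have := hG.misspec θ u hu
  nlinarith

/-- Polarization turns `⟪∇J, v⟫` into half of `‖∇J‖² + ‖v‖² - ‖v - ∇J‖²`. For `η ≤ 1 / (4 L_θ)` the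
smoothness term costs at most `1/8 ‖v‖²`; the remaining `3/8 ‖v‖²` is kept to pay for the drift of
the optimal critic. -/
theorem objective_actorUpdate_ge (hG : G.Assumptions K W) {η : ℝ} (hη : 0 ≤ η)
    (hη' : η ≤ 1 / (4 * K.L_θ)) (v : Param p) :
    G.objective θ + η * (1 / 2 * ‖gradient G.objective θ‖ ^ 2 + 3 / 8 * ‖v‖ ^ 2 -
      1 / 2 * ‖v - gradient G.objective θ‖ ^ 2) ≤ G.objective (θ + η • v) := by
  have hL := K.L_θ_pos
  have h1 := quadratic_lower_bound hG.obj_diff hG.obj_lip θ (η • v)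
  rw [inner_smul_right, norm_smul, Real.norm_of_nonneg hη, mul_pow] at h1
  have h2 := norm_sub_sq_real v (gradient G.objective θ)
  rw [real_inner_comm] at h2
  have h3 : K.L_θ * η ≤ 1 / 4 := by
    rw [le_div_iff₀ (by positivity)] at hη'
    linarith
  have h4 : K.L_θ / 2 * (η ^ 2 * ‖v‖ ^ 2) ≤ η * (1 / 8 * ‖v‖ ^ 2) := by
    have := mul_le_mul_of_nonneg_left h3 (mul_nonneg hη (sq_nonneg ‖v‖))
    nlinarith
  rw [h2]
  linarith

end Problem
end DSAC

/-! ### The coupled actor and critic recursions -/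

namespace DSAC

open Finset

/-- Square summation of a perturbed contraction. -/
theorem sum_sq_le_of_contraction {α ξ : ℝ} (hα : 0 < α) (hα1 : α ≤ 1) {e u : ℕ → ℝ}
    (he : ∀ k, 0 ≤ e k) (hu : ∀ k, 0 ≤ u k) (hξ : 0 ≤ ξ) {n : ℕ}
    (h : ∀ k < n, e (k + 1) ≤ (1 - α) * (e k + u k) + ξ) :
    ∑ k ∈ range (n + 1), e k ^ 2 ≤
      e 0 ^ 2 / α + 2 / α ^ 2 * ∑ k ∈ range n, u k ^ 2 + 2 / α ^ 2 * (n * ξ ^ 2) := by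
  have hstep (k : ℕ) (hk : k < n) :
      e (k + 1) ^ 2 ≤ (1 - α) * e k ^ 2 + 2 / α * (u k ^ 2 + ξ ^ 2) := by
    -- The recursion becomes a convex combination of `e k` and `y`, to which convexity of the square
    -- applies. The squared perturbation is thereby divided by `α` only once.
    set y := (u k + ξ) / α with hy
    have hy0 : 0 ≤ y := div_nonneg (add_nonneg (hu k) hξ) hα.le
    have hαy : α * y = u k + ξ := by rw [hy]; field_simp
    have h1 : e (k + 1) ≤ (1 - α) * e k + α * y := by
      have := h k hk
      have := mul_nonneg hα.le (hu k)
      rw [hαy]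
      linarith
    have h2 : e (k + 1) ^ 2 ≤ ((1 - α) * e k + α * y) ^ 2 := pow_le_pow_left₀ (he _) h1 2
    have h3 : ((1 - α) * e k + α * y) ^ 2 ≤ (1 - α) * e k ^ 2 + α * y ^ 2 := by
      have : 0 ≤ α * (1 - α) * (e k - y) ^ 2 :=
        mul_nonneg (mul_nonneg hα.le (by linarith)) (sq_nonneg _)
      nlinarith
    have h4 : α * y ^ 2 = (u k + ξ) ^ 2 / α := by rw [hy]; field_simp
    have h5 : (u k + ξ) ^ 2 / α ≤ 2 / α * (u k ^ 2 + ξ ^ 2) := by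
      rw [div_mul_eq_mul_div]
      exact div_le_div_of_nonneg_right add_sq_le hα.le
    linarith
  -- The last square is carried with full weight so that the induction closes; `α ≤ 1` finally
  -- merges it into the sum.
  have hsum (j : ℕ) (hj : j ≤ n) : α * ∑ k ∈ range j, e k ^ 2 + e j ^ 2 ≤
      e 0 ^ 2 + 2 / α * (∑ k ∈ range j, u k ^ 2 + j * ξ ^ 2) := by
    induction j with
    | zero => simp
    | succ j ih =>
      have h1 := ih (Nat.le_of_succ_le hj)
      have h2 := hstep j hj
      rw [Finset.sum_range_succ, Finset.sum_range_succ, Nat.cast_succ]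
      have e1 : 2 / α * (∑ k ∈ range j, u k ^ 2 + u j ^ 2 + ((j : ℝ) + 1) * ξ ^ 2) =
          2 / α * (∑ k ∈ range j, u k ^ 2 + j * ξ ^ 2) + 2 / α * (u j ^ 2 + ξ ^ 2) := by ring
      rw [e1]
      linarith
  have h1 := hsum n le_rfl
  have h2 : α * ∑ k ∈ range (n + 1), e k ^ 2 ≤
      e 0 ^ 2 + 2 / α * (∑ k ∈ range n, u k ^ 2 + n * ξ ^ 2) := by
    rw [Finset.sum_range_succ, mul_add]
    have := mul_le_mul_of_nonneg_right hα1 (sq_nonneg (e n))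
    linarith
  have h3 : ∑ k ∈ range (n + 1), e k ^ 2 ≤
      (e 0 ^ 2 + 2 / α * (∑ k ∈ range n, u k ^ 2 + n * ξ ^ 2)) / α := by
    rw [le_div_iff₀ hα]; linarith
  refine h3.trans_eq ?_
  field_simp
  ring

/-- The descent argument for coupled actor and critic recursions. -/
theorem sum_sq_le_of_descent {α η P Q c ξ D : ℝ} (hα : 0 < α) (hη : 0 < η) (hP : 0 ≤ P)
    (hc : P * c ^ 2 ≤ (20 / 9 * α) ^ 2 / 16) {n : ℕ} {J g u e : ℕ → ℝ}
    (hJ : ∀ k ≤ n, J k + η * (1 / 2 * g k ^ 2 + 3 / 8 * u k ^ 2 - 1 / 2 * (P * e k ^ 2 + Q)) ≤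
      J (k + 1)) (hD : J (n + 1) - J 0 ≤ D)
    (he : ∑ k ∈ range (n + 1), e k ^ 2 ≤
      e 0 ^ 2 / α + 2 / α ^ 2 * ∑ k ∈ range n, (c * u k) ^ 2 + 2 / α ^ 2 * (n * ξ ^ 2)) :
    ∑ k ∈ range (n + 1), g k ^ 2 ≤
      2 * D / η + P * e 0 ^ 2 / α + (n + 1) * Q + 2 * P / α ^ 2 * (n * ξ ^ 2) := by
  have htel : ∑ k ∈ range (n + 1),
      (η * (1 / 2 * g k ^ 2 + 3 / 8 * u k ^ 2 - 1 / 2 * (P * e k ^ 2 + Q))) ≤ J (n + 1) - J 0 := by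
    rw [← Finset.sum_range_sub]
    refine Finset.sum_le_sum fun k hk => ?_
    have := hJ k (Nat.lt_succ_iff.mp (Finset.mem_range.mp hk))
    linarith
  rw [← Finset.mul_sum, Finset.sum_sub_distrib, Finset.sum_add_distrib, ← Finset.mul_sum,
    ← Finset.mul_sum, ← Finset.mul_sum, Finset.sum_add_distrib, ← Finset.mul_sum, Finset.sum_const,
    Finset.card_range, nsmul_eq_mul, Nat.cast_succ] at htel
  simp_rw [mul_pow, ← Finset.mul_sum] at he
  set U := ∑ k ∈ range n, u k ^ 2 with hU
  have hU0 : 0 ≤ U := Finset.sum_nonneg fun k _ => sq_nonneg _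
  have hUle : U ≤ ∑ k ∈ range (n + 1), u k ^ 2 := by
    rw [Finset.sum_range_succ]; exact le_add_of_nonneg_right (sq_nonneg _)
  set E := ∑ k ∈ range (n + 1), e k ^ 2
  -- Half of `3/4 U` is exactly the surplus `3/8` of the ascent inequality. The step size gives `2 P
  -- c² / α² ≤ 2 (20/9)² / 16 = 50/81`, which is below `3/4`.
  have hPE : P * E ≤ P * e 0 ^ 2 / α + 3 / 4 * U + 2 * P / α ^ 2 * (n * ξ ^ 2) := by
    have h1 := mul_le_mul_of_nonneg_left he hP
    have h2 : P * (2 / α ^ 2 * (c ^ 2 * U)) ≤ 3 / 4 * U := by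
      have h3 : P * (2 / α ^ 2 * (c ^ 2 * U)) = 2 / α ^ 2 * (P * c ^ 2) * U := by ring
      rw [h3]
      refine mul_le_mul_of_nonneg_right ?_ hU0
      have h4 : 2 / α ^ 2 * (P * c ^ 2) ≤ 2 / α ^ 2 * ((20 / 9 * α) ^ 2 / 16) :=
        mul_le_mul_of_nonneg_left hc (by positivity)
      refine h4.trans ?_
      have h5 : 2 / α ^ 2 * ((20 / 9 * α) ^ 2 / 16) = 50 / 81 := by
        field_simp; norm_num
      rw [h5]; norm_num
    have e1 : P * (e 0 ^ 2 / α + 2 / α ^ 2 * (c ^ 2 * U) + 2 / α ^ 2 * (n * ξ ^ 2)) =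
        P * e 0 ^ 2 / α + P * (2 / α ^ 2 * (c ^ 2 * U)) + 2 * P / α ^ 2 * (n * ξ ^ 2) := by ring
    linarith
  have hdiv : 1 / 2 * ∑ k ∈ range (n + 1), g k ^ 2 + 3 / 8 * ∑ k ∈ range (n + 1), u k ^ 2 -
      1 / 2 * (P * E + (n + 1) * Q) ≤ D / η := by
    rw [le_div_iff₀ hη, mul_comm]
    exact htel.trans hD
  have e2 : 2 * D / η = 2 * (D / η) := by ring
  rw [e2]
  linarith

namespace Problem

variable {ι : Type*} [Fintype ι] [DecidableEq ι] [Nonempty ι] {S A : ι → Type*}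
  [∀ i, Fintype (S i)] [∀ i, DecidableEq (S i)] [∀ i, Fintype (A i)] [∀ i, DecidableEq (A i)]
  {p : ι → ℕ} {d : ℕ}

variable {K : Constants} {G : Problem S A p d K.γ} {W r ε : ℝ}

/-- The coercivity constant cannot exceed the operator bound, so `μ_w ≤ L_w`. A nonzero test vector
is needed, so the feature dimension `0` has to be treated apart. -/
theorem margin_le_one (hG : G.Assumptions K W) {θ : Param p}
    (hθ : StrongConvexOn Set.univ K.μ_w (G.criticObj θ)) {v : EuclideanSpace ℝ (Fin d)}
    (hv : v ≠ 0) : K.margin ≤ 1 := by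
  have hL := K.L_w_pos
  have h1 := G.coercive_of_strongConvexOn hθ v
  have h2 := norm_featCov_le (norm_featSA_le hG) (G.occ θ) v
  have h3 : ∑ x, |G.occ θ x| = 1 / (1 - K.γ) := by
    simp_rw [abs_of_nonneg (occ_nonneg (G := G) θ K.γ_nonneg K.γ_lt_one _)]
    exact sum_occ θ K.γ_nonneg K.γ_lt_one
  rw [h3, ← mul_assoc, mul_comm (1 / (1 - K.γ)), ← K.L_w_eq] at h2
  have h4 := (h1.trans (real_inner_le_norm _ _)).trans
    (mul_le_mul_of_nonneg_right h2 (norm_nonneg v))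
  have h5 : 0 < ‖v‖ ^ 2 := pow_pos (norm_pos_iff.mpr hv) 2
  have h6 : K.μ_w ≤ K.L_w := by
    refine le_of_mul_le_mul_right ?_ h5
    rw [mul_assoc, ← sq] at h4
    exact h4
  have h7 : K.μ_w / K.L_w ≤ 1 := (div_le_one hL).mpr h6
  rw [Constants.margin]
  linarith

variable (S A K) in
/-- A bound on the disagreement of the critics, on batches of accuracy at most `κ`. -/
noncomputable def disagreementConst (κ : ℝ) : ℝ :=
  2 * (1 / K.L_w) ^ 2 * (Fintype.card ι *
    (K.C_F / (1 - K.γ) ^ 2 * K.C_φ + targetConst S A K * κ) ^ 2)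

omit [Nonempty ι] [∀ i, DecidableEq (S i)] [∀ i, DecidableEq (A i)] in
theorem disagreementConst_nonneg (κ : ℝ) : 0 ≤ disagreementConst S A K κ := by
  unfold disagreementConst
  positivity

/-- The sum of the squared gradients along a path all of whose batches are accurate. -/
theorem sum_sq_gradient_le (hG : G.Assumptions K W) {I : Input p d} {m T : ℕ} {C_w κ : ℝ}
    (hC_w : 0 < C_w) (hI : I.rounds = m) (hIw : ∀ k, I.stepw k = 1 / K.L_w)
    (hIθ : ∀ k, I.stepθ k = K.actorStep (Fintype.card ι) C_w)
    (x : ∀ k, Batch S A (I.batch k) (I.len k)) (hr0 : 0 ≤ r) (hrκ : r ≤ κ)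
    (hr : Fintype.card (Joint S × Joint A) * r * K.C_φ ^ 2 ≤ K.μ_w / 10)
    (hε : 0 < ε) (hε2 : ε ≤ 1 / 2) (hm : G.rho ^ m ≤ ε)
    (hx : ∀ k ≤ T, G.Accurate (G.iter I x k).1 r (x k))
    (hθ : ∀ k ≤ T, StrongConvexOn Set.univ K.μ_w (G.criticObj (G.iter I x k).1))
    (hlip : ∀ k < T, ∀ w w', G.IsOptCritic (G.iter I x k).1 w →
      G.IsOptCritic (G.iter I x (k + 1)).1 w' →
      ‖w' - w‖ ≤ C_w * ‖(G.iter I x (k + 1)).1 - (G.iter I x k).1‖) :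
    ∑ k ∈ range (T + 1), ‖gradient G.objective (G.iter I x k).1‖ ^ 2 ≤
      2 * (utilLip S A K * (2 / (1 - K.γ))) / K.actorStep (Fintype.card ι) C_w +
      3 * K.actorSens ^ 2 * Fintype.card ι *
        (‖I.w₀‖ + K.critRadius + critNoise S A K * r) ^ 2 / K.margin +
      (T + 1) * (3 * K.actorSens ^ 2 * (3 * disagreementConst S A K κ * ε) +
        3 * Fintype.card ι *
          (Fintype.card (Joint S × Joint A) * r * (K.C_φ * K.critRadius * K.C_π)) ^ 2 + 3 * W) +
      2 * (3 * K.actorSens ^ 2 * Fintype.card ι) / K.margin ^ 2 *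
        (T * (critNoise S A K * r) ^ 2) := by
  set θ : ℕ → Param p := fun k => (G.iter I x k).1 with hθdef
  set w : ℕ → ι → EuclideanSpace ℝ (Fin d) := fun k => (G.iter I x k).2 with hw
  set η := K.actorStep (Fintype.card ι) C_w with hη
  have hN : 0 < Fintype.card ι := Fintype.card_pos
  have hη0 : 0 < η := K.actorStep_pos hN hC_w
  have hα := K.margin_pos
  have hsens := K.actorSens_pos
  have hnoise : 0 ≤ critNoise S A K * r := mul_nonneg critNoise_nonneg hr0
  have hw0 : w 0 = fun _ => I.w₀ := rfl
  have hwS (k : ℕ) : w (k + 1) = G.criticUpdate (x k) (1 / K.L_w) m (w k) := by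
    rw [← hIw k, ← hI]; rfl
  have hθS (k : ℕ) : θ (k + 1) = θ k + η • G.jointGrad (x k) (θ k) (w (k + 1)) := by
    rw [← actorUpdate_eq, ← hIθ k]; rfl
  have hexists (k : ℕ) : ∃ u, k ≤ T → G.IsOptCritic (θ k) u := by
    by_cases hk : k ≤ T
    · obtain ⟨u, hu⟩ := exists_isOptCritic (hθ k hk)
      exact ⟨u, fun _ => hu⟩
    · exact ⟨0, fun h => absurd h hk⟩
  choose u hu using hexists
  set B := disagreementConst S A K κ with hB
  have hB0 : 0 ≤ B := disagreementConst_nonneg κ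
  -- The factor `3` is `2 B` from the old disagreement plus `B` from the targets. As `3 ε² ≤ 1` for
  -- `ε ≤ 1/2`, the bound `B` then propagates along the run.
  have hdis (k : ℕ) (hk : k ≤ T) (h : disagreement (w k) ≤ B) :
      disagreement (w (k + 1)) ≤ 3 * B * ε ^ 2 := by
    have h1 := disagreement_criticUpdate_le (w := w k) hG (hx k hk) hm
    rw [← hwS] at h1
    have h2 : 2 * (1 / K.L_w) ^ 2 * (Fintype.card ι *
        (K.C_F / (1 - K.γ) ^ 2 * K.C_φ + targetConst S A K * r) ^ 2) ≤ B := by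
      have := targetConst_nonneg (S := S) (A := A) (K := K)
      have := K.C_F_pos
      have := K.C_φ_pos
      have := K.L_w_pos
      rw [hB, disagreementConst]
      gcongr
    have h3 := mul_le_mul_of_nonneg_left (add_le_add (mul_le_mul_of_nonneg_left h zero_le_two) h2)
      (sq_nonneg ε)
    linarith
  have hε4 : ε ^ 2 ≤ 1 / 2 * ε := by nlinarith
  have hdisB (k : ℕ) (hk : k ≤ T) : disagreement (w k) ≤ B := by
    induction k with
    | zero =>
      have : disagreement (w 0) = 0 := by
        have h1 : avg (w 0) = I.w₀ := by
          rw [hw0, avg, Finset.sum_const, Finset.card_univ, ← Nat.cast_smul_eq_nsmul ℝ, smul_smul,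
            one_div_mul_cancel (by exact_mod_cast hN.ne'), one_smul]
        rw [disagreement, h1, hw0]
        simp
      rw [this]; exact hB0
    | succ k ih =>
      have h1 := hdis k (Nat.le_of_succ_le hk) (ih (Nat.le_of_succ_le hk))
      have h2 : ε ^ 2 ≤ 1 / 4 := by linarith
      nlinarith
  -- The index is shifted because the actor at `θ^k` already uses the updated critic `w^(k+1)`.
  set e : ℕ → ℝ := fun k => ‖avg (w (k + 1)) - u k‖ with he
  have hestep (k : ℕ) (hk : k ≤ T) :
      e k ≤ (1 - K.margin) * ‖avg (w k) - u k‖ + critNoise S A K * r := by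
    have := norm_avg_criticUpdate_sub_le (m := m) (w := w k) hG hr0 (hx k hk) (hθ k hk) hr (hu k hk)
    rwa [← hwS] at this
  have hu0 : ‖u 0‖ ≤ K.critRadius :=
    norm_isOptCritic_le hG (hθ 0 (Nat.zero_le _)) (hu 0 (Nat.zero_le _))
  have he0 : e 0 ≤ ‖I.w₀‖ + K.critRadius + critNoise S A K * r := by
    have h1 : ‖avg (w 0)‖ ≤ ‖I.w₀‖ := norm_avg_le fun i => by rw [hw0]
    have h2 := norm_sub_le (avg (w 0)) (u 0)
    have h3 := hestep 0 (Nat.zero_le _)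
    have h4 := mul_nonneg hα.le (norm_nonneg (avg (w 0) - u 0))
    linarith
  set v : ℕ → ℝ := fun k => ‖G.jointGrad (x k) (θ k) (w (k + 1))‖ with hv
  have hmove (k : ℕ) (hk : k < T) : ‖u (k + 1) - u k‖ ≤ C_w * η * v k := by
    have h1 := hlip k hk (u k) (u (k + 1)) (hu k hk.le) (hu (k + 1) hk)
    refine h1.trans_eq ?_
    have : θ (k + 1) - θ k = η • G.jointGrad (x k) (θ k) (w (k + 1)) := by
      rw [hθS]; abel
    rw [this, norm_smul, Real.norm_of_nonneg hη0.le, mul_assoc]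
  have hesum : ∑ k ∈ range (T + 1), e k ^ 2 ≤ e 0 ^ 2 / K.margin +
      2 / K.margin ^ 2 * ∑ k ∈ range T, (C_w * η * v k) ^ 2 +
      2 / K.margin ^ 2 * (T * (critNoise S A K * r) ^ 2) := by
    -- In dimension `0` all critic errors vanish; otherwise `margin_le_one` provides the contraction
    -- factor.
    rcases subsingleton_or_nontrivial (EuclideanSpace ℝ (Fin d)) with hsub | hnon
    · have h0 (k : ℕ) : e k = 0 := by
        simp only [he]
        rw [Subsingleton.elim (avg (w (k + 1)) - u k) 0, norm_zero]
      simp only [h0]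
      have := Finset.sum_nonneg fun k (_ : k ∈ range T) => sq_nonneg (C_w * η * v k)
      simp only [ne_eq, OfNat.ofNat_ne_zero, not_false_eq_true, zero_pow, Finset.sum_const_zero]
      positivity
    · obtain ⟨z, hz⟩ := exists_ne (0 : EuclideanSpace ℝ (Fin d))
      have hα1 := margin_le_one hG (hθ 0 (Nat.zero_le _)) hz
      refine sum_sq_le_of_contraction hα hα1 (fun k => norm_nonneg _)
        (fun k => by positivity) hnoise fun k hk => ?_
      refine (hestep (k + 1) hk).trans (add_le_add_left (mul_le_mul_of_nonneg_left ?_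
        (by linarith)) _)
      have h1 : avg (w (k + 1)) - u (k + 1) = (avg (w (k + 1)) - u k) - (u (k + 1) - u k) := by abel
      rw [h1]
      exact (norm_sub_le _ _).trans (add_le_add le_rfl (hmove k hk))
  have hfinal := sum_sq_le_of_descent (n := T) (α := K.margin) (η := η)
    (P := 3 * K.actorSens ^ 2 * Fintype.card ι)
    (Q := 3 * K.actorSens ^ 2 * (3 * B * ε) + 3 * Fintype.card ι *
          (Fintype.card (Joint S × Joint A) * r * (K.C_φ * K.critRadius * K.C_π)) ^ 2 + 3 * W)
    (c := C_w * η) (ξ := critNoise S A K * r) (D := utilLip S A K * (2 / (1 - K.γ)))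
    (J := fun k => G.objective (θ k)) (g := fun k => ‖gradient G.objective (θ k)‖) (u := v) (e := e)
    hα hη0 (by positivity) ?_ ?_ ?_ hesum
  · refine hfinal.trans ?_
    gcongr
  · refine (K.actorStep_sq_le hN hC_w).trans_eq ?_
    rw [Constants.margin]
    ring
  · intro k hk
    have h1 := objective_actorUpdate_ge hG hη0.le (K.actorStep_le _ _)
      (G.jointGrad (x k) (θ k) (w (k + 1))) (θ := θ k)
    rw [← hθS] at h1
    refine le_trans ?_ h1
    have h2 := norm_jointGrad_sub_sq_le (w := w (k + 1)) hG hr0 (hx k hk) (hθ k hk) (hu k hk)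
    have h3 : disagreement (w (k + 1)) ≤ 3 * B * ε := by
      have := hdis k hk (hdisB k hk)
      nlinarith
    have h4 : 3 * K.actorSens ^ 2 * disagreement (w (k + 1)) ≤
        3 * K.actorSens ^ 2 * (3 * B * ε) := mul_le_mul_of_nonneg_left h3 (by positivity)
    refine add_le_add le_rfl (mul_le_mul_of_nonneg_left ?_ hη0.le)
    simp only [hv, he]
    linarith
  · exact (le_abs_self _).trans (abs_objective_sub_le_const hG _ _)

end Problem
end DSAC

/-! ### Sample count, averaging and the final probability bound -/

namespace DSAC

open Finset

/-- The number of samples is of order `ε⁻²` up to logarithms. -/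
theorem samples_le {N T B H : ℕ} {γ c ε δ : ℝ} (hN : 0 < N) (hγ : 0 ≤ γ) (hγ' : γ < 1) (hc : 1 ≤ c)
    (hε : 0 < ε) (hε1 : ε < 1) (hδ : 0 < δ) (hδ1 : δ < 1) (hT : T = ⌈1 / ε⌉₊)
    (hB : B = ⌈Real.log (1 / (δ / (3 * N * (T + 1)))) / ε⌉₊)
    (hH : H ≤ c * (1 + Real.log (1 / ε) / (1 - γ))) :
    ((T : ℝ) + 1) * (B * (H + 1)) ≤ 6 * c * (Real.log (9 * N) + 1) / (1 - γ) * (1 / ε ^ 2) *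
      (1 + Real.log (1 / ε)) * (1 + Real.log (1 / (ε * δ))) := by
  have h1 : 0 < 1 - γ := by linarith
  have hN1 : (1 : ℝ) ≤ N := by exact_mod_cast hN
  have hεinv : 1 < 1 / ε := by rw [lt_div_iff₀ hε]; linarith
  have hl : 0 ≤ Real.log (1 / ε) := Real.log_nonneg hεinv.le
  have hεδ : ε * δ < 1 := by nlinarith
  have hl2 : 0 ≤ Real.log (1 / (ε * δ)) := by
    refine Real.log_nonneg ?_
    rw [le_div_iff₀ (by positivity)]; linarith
  have hl9 : 0 ≤ Real.log (9 * N) := Real.log_nonneg (by linarith)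
  have hT1 : (T : ℝ) + 1 ≤ 3 / ε := by
    have h2 : (T : ℝ) < 1 / ε + 1 := by rw [hT]; exact Nat.ceil_lt_add_one (by positivity)
    have : 3 / ε = 1 / ε + 2 * (1 / ε) := by ring
    linarith
  -- The union bound over the iterations enters only inside the logarithm: `T + 1 ≤ 3 / ε` turns `1
  -- / δ_k` into at most `9 N / (ε δ)`.
  have hlog : Real.log (1 / (δ / (3 * N * (T + 1)))) ≤
      Real.log (9 * N) + Real.log (1 / (ε * δ)) := by
    rw [← Real.log_mul (by positivity) (by positivity)]
    refine Real.log_le_log (by positivity) ?_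
    rw [one_div_div]
    calc 3 * N * ((T : ℝ) + 1) / δ ≤ 3 * N * (3 / ε) / δ := by gcongr
      _ = 9 * N * (1 / (ε * δ)) := by field_simp; ring
  have hlog0 : 0 ≤ Real.log (1 / (δ / (3 * N * (T + 1)))) := by
    refine Real.log_nonneg ?_
    rw [one_div_div, le_div_iff₀ hδ]
    have : (0 : ℝ) ≤ T := Nat.cast_nonneg T
    nlinarith
  have hB1 : (B : ℝ) ≤ (Real.log (9 * N) + 1) * (1 + Real.log (1 / (ε * δ))) / ε := by
    have h2 : (B : ℝ) < Real.log (1 / (δ / (3 * N * (T + 1)))) / ε + 1 := by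
      rw [hB]; exact Nat.ceil_lt_add_one (by positivity)
    calc (B : ℝ) ≤ (Real.log (9 * N) + Real.log (1 / (ε * δ))) / ε + 1 / ε := by
          have := div_le_div_of_nonneg_right hlog hε.le
          linarith
      _ = (Real.log (9 * N) + Real.log (1 / (ε * δ)) + 1) / ε := by ring
      _ ≤ _ := by
          refine div_le_div_of_nonneg_right ?_ hε.le
          nlinarith [mul_nonneg hl9 hl2]
  have hH1 : (H : ℝ) + 1 ≤ 2 * c / (1 - γ) * (1 + Real.log (1 / ε)) := by
    have h2 : 1 ≤ 1 / (1 - γ) := by rw [le_div_iff₀ h1]; linarith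
    have h3 : c * 1 ≤ c * (1 / (1 - γ)) := mul_le_mul_of_nonneg_left h2 (by linarith)
    have h4 : 0 ≤ c * (1 / (1 - γ)) * Real.log (1 / ε) := by positivity
    have e1 : c * (1 + Real.log (1 / ε) / (1 - γ)) =
      c + c * (1 / (1 - γ)) * Real.log (1 / ε) := by ring
    have e2 : 2 * c / (1 - γ) * (1 + Real.log (1 / ε)) =
      2 * (c * (1 / (1 - γ))) + 2 * (c * (1 / (1 - γ)) * Real.log (1 / ε)) := by ring
    rw [e1] at hH
    rw [e2]
    linarith
  calc _ ≤ 3 / ε * ((Real.log (9 * N) + 1) * (1 + Real.log (1 / (ε * δ))) / ε *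
        (2 * c / (1 - γ) * (1 + Real.log (1 / ε)))) := by gcongr
    _ = _ := by field_simp; ring

/-- Averaging uses `T + 1 ≤ 2 T` and `1 / T ≤ ε`. The spare term `g` lets the same constant serve
the regime of large `ε`. -/
theorem mean_le_of_sum_le {s T ε W D Z Q V g : ℝ} (hT : 1 ≤ T) (hTε : 1 / T ≤ ε) (hε : 0 ≤ ε)
    (hW : 0 ≤ W) (hD : 0 ≤ D) (hZ : 0 ≤ Z) (hQ : 0 ≤ Q) (hV : 0 ≤ V) (hg : 0 ≤ g)
    (hs : s ≤ D + Z + (T + 1) * (Q * ε + 3 * W) + T * (V * ε)) :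
    1 / T * s ≤ (D + Z + 2 * Q + V + 6 + g) * (ε + W) := by
  have hT0 : 0 < T := by linarith
  have hQW : 0 ≤ Q * ε + 3 * W := by positivity
  calc _ ≤ 1 / T * (D + Z + 2 * T * (Q * ε + 3 * W) + T * (V * ε)) := by
        refine mul_le_mul_of_nonneg_left ?_ (by positivity)
        have := mul_le_mul_of_nonneg_right (by linarith : T + 1 ≤ 2 * T) hQW
        linarith
    _ = 1 / T * (D + Z) + 2 * (Q * ε + 3 * W) + V * ε := by field_simp
    _ ≤ ε * (D + Z) + 2 * (Q * ε + 3 * W) + V * ε := by gcongr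
    _ ≤ ε * (D + Z) + 2 * (Q * ε + 3 * W) + V * ε +
        ((D + Z + 2 * Q + V + g) * W + (6 + g) * ε) := le_add_of_nonneg_right (by positivity)
    _ = _ := by ring

namespace Problem

/-- The average squared gradient along a path all of whose batches are accurate. -/
theorem exists_mean_sq_gradient_le {ι : Type*} [Fintype ι] [DecidableEq ι] [Nonempty ι]
    (S A : ι → Type*) [∀ i, Fintype (S i)] [∀ i, DecidableEq (S i)] [∀ i, Fintype (A i)]
    [∀ i, DecidableEq (A i)] (p : ι → ℕ) (d : ℕ) (K : Constants) {C_w κ : ℝ}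
    (w₀ : EuclideanSpace ℝ (Fin d)) (hC_w : 0 < C_w) (hκ : 0 < κ) :
    ∃ C : ℝ, 0 < C ∧ ∀ (G : Problem S A p d K.γ) (W : ℝ), G.Assumptions K W →
      ∀ (ε : ℝ) (T m : ℕ), 0 < ε → ε < 1 → T = ⌈1 / ε⌉₊ → G.rho ^ m ≤ ε →
      ∀ I : Input p d, I.w₀ = w₀ → I.rounds = m → (∀ k, I.stepw k = 1 / K.L_w) →
        (∀ k, I.stepθ k = K.actorStep (Fintype.card ι) C_w) →
      ∀ x : ∀ k, Batch S A (I.batch k) (I.len k),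
        (∀ k ≤ T, G.Accurate (G.iter I x k).1 (κ * √ε) (x k)) →
        (∀ k ≤ T, StrongConvexOn Set.univ K.μ_w (G.criticObj (G.iter I x k).1)) →
        (∀ k < T, ∀ w w', G.IsOptCritic (G.iter I x k).1 w →
          G.IsOptCritic (G.iter I x (k + 1)).1 w' →
          ‖w' - w‖ ≤ C_w * ‖(G.iter I x (k + 1)).1 - (G.iter I x k).1‖) →
        (1 / (T : ℝ)) * ∑ k ∈ Finset.Icc 1 T, ‖gradient G.objective (G.iter I x k).1‖ ^ 2 ≤
          C * (ε + W) := by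
  have hμ := K.μ_w_pos
  have hφ := K.C_φ_pos
  have hα := K.margin_pos
  have hγ : 0 < 1 - K.γ := by linarith [K.γ_lt_one]
  have hstep := K.actorStep_pos (Fintype.card_pos (α := ι)) hC_w
  set n : ℝ := (Fintype.card (Joint S × Joint A) : ℝ) with hn
  have hn0 : 0 ≤ n := Nat.cast_nonneg _
  set N : ℝ := (Fintype.card ι : ℝ) with hN
  have hN0 : 0 ≤ N := Nat.cast_nonneg _
  -- Below `ε₀` the accuracy `κ √ε` perturbs the covariance by at most `μ_w / 10`, and `ε ≤ 1/2`
  -- keeps the disagreement bounded. The added `1` avoids a zero denominator.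
  set ε₀ := min (1 / 2) ((K.μ_w / (10 * (n * κ * K.C_φ ^ 2 + 1))) ^ 2) with hε₀
  have hε₀pos : 0 < ε₀ := lt_min (by norm_num) (by positivity)
  set gb := utilLip S A K * (n * K.l_lam)
  set D := 2 * (utilLip S A K * (2 / (1 - K.γ))) / K.actorStep (Fintype.card ι) C_w
  have hD : 0 ≤ D := div_nonneg (mul_nonneg zero_le_two
    (mul_nonneg utilLip_nonneg (by positivity))) hstep.le
  set P := 3 * K.actorSens ^ 2 * N with hP
  have hP0 : 0 ≤ P := by positivity
  set ν := critNoise S A K * κ with hν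
  have hν0 : 0 ≤ ν := mul_nonneg critNoise_nonneg hκ.le
  set Z := P * (‖w₀‖ + K.critRadius + ν) ^ 2 / K.margin
  have hZ : 0 ≤ Z := by positivity
  set Q := 3 * K.actorSens ^ 2 * (3 * disagreementConst S A K κ) +
    3 * N * (n * κ * (K.C_φ * K.critRadius * K.C_π)) ^ 2 with hQ
  have hQ0 : 0 ≤ Q := by
    have := disagreementConst_nonneg (S := S) (A := A) (K := K) κ
    positivity
  set V := 2 * P / K.margin ^ 2 * ν ^ 2
  have hV : 0 ≤ V := by positivity
  refine ⟨D + Z + 2 * Q + V + 6 + gb ^ 2 / ε₀, by positivity, ?_⟩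
  intro G W hG ε T m hε hε1 hT hm I hI₀ hIm hIw hIθ x hx hθ hlip
  -- `W` dominates a sum of squares as soon as one optimal critic exists.
  have hW : 0 ≤ W := by
    obtain ⟨u, hu⟩ := exists_isOptCritic (hθ 0 (Nat.zero_le _))
    exact le_trans (Finset.sum_nonneg fun i _ => sq_nonneg _) (hG.misspec _ u hu)
  have hTε : 1 / ε ≤ T := by rw [hT]; exact Nat.le_ceil _
  have hT0 : (0 : ℝ) < T := lt_of_lt_of_le (by positivity) hTε
  have hT1 : (1 : ℝ) ≤ T := by
    have : 0 < T := by exact_mod_cast hT0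
    exact_mod_cast this
  have hTinv : 1 / (T : ℝ) ≤ ε := by
    rw [div_le_iff₀ hT0]
    rw [div_le_iff₀ hε] at hTε
    linarith
  have hgb : 0 ≤ gb ^ 2 / ε₀ := by positivity
  -- For `ε > ε₀` the uniform gradient bound gives `gb² = (gb² / ε₀) ε₀ ≤ C ε`.
  rcases le_or_gt ε ε₀ with hsmall | hlarge
  · have hs0 : 0 < √ε := Real.sqrt_pos.mpr hε
    have hs1 : √ε ≤ 1 := Real.sqrt_le_iff.mpr ⟨zero_le_one, by simpa using hε1.le⟩
    have hs2 : √ε ^ 2 = ε := Real.sq_sqrt hε.le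
    have hr : n * (κ * √ε) * K.C_φ ^ 2 ≤ K.μ_w / 10 := by
      have h1 : √ε ≤ K.μ_w / (10 * (n * κ * K.C_φ ^ 2 + 1)) :=
        Real.sqrt_le_iff.mpr ⟨by positivity, hsmall.trans (min_le_right _ _)⟩
      rw [le_div_iff₀ (by positivity)] at h1
      nlinarith
    have hsum := sum_sq_gradient_le (κ := κ) hG hC_w hIm hIw hIθ x
      (by positivity : 0 ≤ κ * √ε) (mul_le_of_le_one_right hκ.le hs1) hr hε
      (hsmall.trans (min_le_left _ _)) hm hx hθ hlip
    rw [hI₀, ← hn, ← hN, ← hP] at hsum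
    have hsub : ∑ k ∈ Finset.Icc 1 T, ‖gradient G.objective (G.iter I x k).1‖ ^ 2 ≤
        ∑ k ∈ range (T + 1), ‖gradient G.objective (G.iter I x k).1‖ ^ 2 :=
      Finset.sum_le_sum_of_subset_of_nonneg
        (fun k hk => Finset.mem_range.mpr (Nat.lt_succ_of_le (Finset.mem_Icc.mp hk).2))
        fun k _ _ => sq_nonneg _
    have hνr : critNoise S A K * (κ * √ε) = ν * √ε := by rw [hν]; ring
    rw [hνr] at hsum
    have hZ' : P * (‖w₀‖ + K.critRadius + ν * √ε) ^ 2 / K.margin ≤ Z := by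
      have := K.critRadius_pos
      have : ν * √ε ≤ ν := mul_le_of_le_one_right hν0 hs1
      have : 0 ≤ ν * √ε := by positivity
      simp only [Z]
      gcongr
    have eQ : 3 * K.actorSens ^ 2 * (3 * disagreementConst S A K κ * ε) +
        3 * N * (n * (κ * √ε) * (K.C_φ * K.critRadius * K.C_π)) ^ 2 + 3 * W = Q * ε + 3 * W := by
      have : (n * (κ * √ε) * (K.C_φ * K.critRadius * K.C_π)) ^ 2 =
          (n * κ * (K.C_φ * K.critRadius * K.C_π)) ^ 2 * √ε ^ 2 := by ring
      rw [this, hs2, hQ]; ring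
    have eV : 2 * P / K.margin ^ 2 * (T * (ν * √ε) ^ 2) = T * (V * ε) := by
      rw [mul_pow, hs2]; simp only [V]; ring
    rw [eQ, eV] at hsum
    exact mean_le_of_sum_le hT1 hTinv hε.le hW hD hZ hQ0 hV hgb
      ((hsub.trans hsum).trans (by linarith))
  · have hgrad (k : ℕ) : ‖gradient G.objective (G.iter I x k).1‖ ^ 2 ≤ gb ^ 2 :=
      pow_le_pow_left₀ (norm_nonneg _) (norm_gradient_objective_le hG _) 2
    calc _ ≤ 1 / (T : ℝ) * ∑ k ∈ Finset.Icc 1 T, gb ^ 2 :=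
          mul_le_mul_of_nonneg_left (Finset.sum_le_sum fun k _ => hgrad k) (by positivity)
      _ = gb ^ 2 / ε₀ * ε₀ := by
          rw [Finset.sum_const, Nat.card_Icc, nsmul_eq_mul, Nat.add_sub_cancel]
          field_simp
      _ ≤ gb ^ 2 / ε₀ * ε := mul_le_mul_of_nonneg_left hlarge.le hgb
      _ ≤ _ := by
          refine mul_le_mul ?_ (by linarith) hε.le (by positivity)
          linarith

end Problem

end DSAC

theorem corollary2 {ι : Type*} [Fintype ι] [DecidableEq ι] [Nonempty ι] (S A : ι → Type*)
    [∀ i, Fintype (S i)] [∀ i, DecidableEq (S i)] [∀ i, Fintype (A i)] [∀ i, DecidableEq (A i)]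
    (p : ι → ℕ) (d : ℕ) (K : DSAC.Constants) :
    -- the Lipschitz constant `C_w` of the optimal critic, which enters the actor step, exists
    (∃ C_w : ℝ, 0 < C_w ∧ ∀ (G : DSAC.Problem S A p d K.γ) (W : ℝ), G.Assumptions K W →
      ∀ θ θ' w w', StrongConvexOn Set.univ K.μ_w (G.criticObj θ) →
        StrongConvexOn Set.univ K.μ_w (G.criticObj θ') →
        G.IsOptCritic θ w → G.IsOptCritic θ' w' → ‖w' - w‖ ≤ C_w * ‖θ' - θ‖) ∧
    ∀ (C_w c : ℝ) (w₀ : EuclideanSpace ℝ (Fin d)), 0 < C_w → 1 ≤ c →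
    ∃ C : ℝ, 0 < C ∧
      ∀ (G : DSAC.Problem S A p d K.γ) (W : ℝ), G.Assumptions K W →
      ∀ (θ₀ : DSAC.Param p) (ε δ : ℝ), 0 < ε → ε < 1 → 0 < δ → δ < 1 →
      ∀ T B H m : ℕ,
        T = ⌈1 / ε⌉₊ →
        -- `B = log(1/δ_k)/ε` with `δ_k = δ/(3N(T+1))`
        B = ⌈Real.log (1 / (δ / (3 * Fintype.card ι * (T + 1)))) / ε⌉₊ →
        -- `H` is of order `log(1/ε)/(1-γ)`
        Real.log (1 / ε) / (1 - K.γ) ≤ H → H ≤ c * (1 + Real.log (1 / ε) / (1 - K.γ)) →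
        -- `m` is of order `log(1/ε)/(1-ρ)`
        Real.log (1 / ε) / (1 - G.rho) ≤ m → m ≤ c * (1 + Real.log (1 / ε) / (1 - G.rho)) →
      ∀ I : DSAC.Input p d,
        I = { θ₀ := θ₀, w₀ := w₀, batch := fun _ => B, len := fun _ => H, rounds := m,
              stepw := fun _ => 1 / K.L_w,
              stepθ := fun _ => K.actorStep (Fintype.card ι) C_w } →
      (I.totalSamples T : ℝ) ≤
          C * (1 / ε ^ 2) * (1 + Real.log (1 / ε)) * (1 + Real.log (1 / (ε * δ))) ∧
      ∀ (Ω : Type*) [MeasurableSpace Ω] (μ : MeasureTheory.Measure Ω)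
        [MeasureTheory.IsProbabilityMeasure μ]
        (τ : ∀ k, Ω → DSAC.Batch S A (I.batch k) (I.len k)), G.IsRun I μ τ →
        -- the critic objectives of the iterates are strongly convex
        (∀ᵐ ω ∂μ, ∀ k ≤ T, StrongConvexOn Set.univ K.μ_w (G.criticObj (G.runParam I τ k ω))) →
        -- `C_w` is a Lipschitz constant of the optimal critic along the iterates
        (∀ᵐ ω ∂μ, ∀ k < T, ∀ w w', G.IsOptCritic (G.runParam I τ k ω) w →
          G.IsOptCritic (G.runParam I τ (k + 1) ω) w' →
          ‖w' - w‖ ≤ C_w * ‖G.runParam I τ (k + 1) ω - G.runParam I τ k ω‖) →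
        1 - δ ≤ μ.real {ω | (1 / (T : ℝ)) *
          ∑ k ∈ Finset.Icc 1 T, ‖gradient G.objective (G.runParam I τ k ω)‖ ^ 2
            ≤ C * (ε + W)} := by
  classical
  obtain ⟨κ, hκ, hacc⟩ :=
    DSAC.Problem.exists_sum_not_accurate_le S A p d K.γ_nonneg K.γ_lt_one
  refine ⟨DSAC.Problem.exists_lipschitz_isOptCritic S A p d K, ?_⟩
  intro C_w c w₀ hC_w hc
  obtain ⟨C, hC, hmain⟩ :=
    DSAC.Problem.exists_mean_sq_gradient_le S A p d K w₀ hC_w hκ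
  have hN : 0 < Fintype.card ι := Fintype.card_pos
  have hN1 : (1 : ℝ) ≤ Fintype.card ι := by exact_mod_cast hN
  have hγ : 0 < 1 - K.γ := by linarith [K.γ_lt_one]
  set C' := 6 * c * (Real.log (9 * Fintype.card ι) + 1) / (1 - K.γ) with hC'
  have hC'0 : 0 ≤ C' := by
    have : 0 ≤ Real.log (9 * Fintype.card ι) := Real.log_nonneg (by linarith)
    positivity
  refine ⟨C + C', by positivity, ?_⟩
  intro G W hG θ₀ ε δ hε hε1 hδ hδ1 T B H m hT hB hH hH' hm _ I hI
  have hIb (k : ℕ) : I.batch k = B := by rw [hI]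
  have hIl (k : ℕ) : I.len k = H := by rw [hI]
  have hlogε : 0 ≤ Real.log (1 / ε) := Real.log_nonneg (by rw [le_div_iff₀ hε]; linarith)
  have hlogεδ : 0 ≤ Real.log (1 / (ε * δ)) := by
    refine Real.log_nonneg ?_
    rw [le_div_iff₀ (by positivity)]
    nlinarith
  refine ⟨?_, ?_⟩
  · have h := DSAC.samples_le hN K.γ_nonneg K.γ_lt_one hc hε hε1 hδ hδ1 hT hB hH'
    have e : (I.totalSamples T : ℝ) = ((T : ℝ) + 1) * (B * (H + 1)) := by
      simp [DSAC.Input.totalSamples, hIb, hIl]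
    rw [e]
    refine h.trans ?_
    gcongr
    linarith
  · intro Ω _ μ _ τ hτ hsc hlip
    set q := δ / (3 * Fintype.card ι * (T + 1)) with hq
    have hq0 : 0 < q := by positivity
    have hT0 : (0 : ℝ) ≤ T := Nat.cast_nonneg T
    have hT1 : (1 : ℝ) ≤ T := by
      have h1 : 1 < 1 / ε := by rw [lt_div_iff₀ hε]; linarith
      have h2 : 1 / ε ≤ T := by rw [hT]; exact Nat.le_ceil _
      linarith
    -- Here `1 / q = 3 N (T + 1) / δ` is at least `6`, which exceeds `e`.
    have hlogq : 1 ≤ Real.log (1 / q) := by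
      rw [Real.le_log_iff_exp_le (by positivity), hq, one_div_div, le_div_iff₀ hδ]
      have h1 := Real.exp_one_lt_d9
      have h2 := Real.exp_pos 1
      nlinarith
    have hγH : K.γ ^ H ≤ ε := DSAC.pow_le_of_log_le K.γ_nonneg K.γ_lt_one hε hH
    have hρm : G.rho ^ m ≤ ε := DSAC.pow_le_of_log_le G.rho_nonneg hG.rho_lt_one hε hm
    let bad : ℕ → Set Ω := fun k =>
      {ω | ¬ G.Accurate (G.runParam I τ k ω) (κ * √ε) (τ k ω)}
    have hbad (k : ℕ) : μ.real (bad k) ≤ q :=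
      hτ.measureReal_le k (fun θ x => ¬ G.Accurate θ (κ * √ε) x) fun θ => by
        convert hacc G θ ε q (I.batch k) (I.len k) hε hε1.le (by rw [hIl]; exact hγH) hq0 hlogq
          (by rw [hIb, hB]; exact Nat.le_ceil _)
    set good := {ω | (1 / (T : ℝ)) *
      ∑ k ∈ Finset.Icc 1 T, ‖gradient G.objective (G.runParam I τ k ω)‖ ^ 2
        ≤ (C + C') * (ε + W)} with hgood
    have hae := hsc.and hlip
    set N := {ω | ¬ ((∀ k ≤ T, StrongConvexOn Set.univ K.μ_w
      (G.criticObj (G.runParam I τ k ω))) ∧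
      ∀ k < T, ∀ w w', G.IsOptCritic (G.runParam I τ k ω) w →
        G.IsOptCritic (G.runParam I τ (k + 1) ω) w' →
        ‖w' - w‖ ≤ C_w * ‖G.runParam I τ (k + 1) ω - G.runParam I τ k ω‖)}
    have hN0 : μ.real N = 0 := by
      rw [MeasureTheory.measureReal_def, MeasureTheory.ae_iff.mp hae, ENNReal.toReal_zero]
    -- Off the bad batches and the null set the deterministic bound applies. Covering the whole
    -- space needs no measurability of the good event, only subadditivity.
    have hcover : Set.univ ⊆ good ∪ ((⋃ k ∈ Finset.range (T + 1), bad k) ∪ N) := by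
      intro ω _
      by_contra hω
      simp only [Set.mem_union, Set.mem_iUnion, not_or, not_exists] at hω
      obtain ⟨h1, h2, h3⟩ := hω
      obtain ⟨hs, hl⟩ := not_not.mp h3
      have hx (k : ℕ) (hk : k ≤ T) : G.Accurate (G.runParam I τ k ω) (κ * √ε) (τ k ω) :=
        not_not.mp (h2 k (Finset.mem_range.mpr (Nat.lt_succ_of_le hk)))
      have hW : 0 ≤ W := by
        obtain ⟨u, hu⟩ := DSAC.Problem.exists_isOptCritic (hs 0 (Nat.zero_le _))
        exact le_trans (Finset.sum_nonneg fun i _ => sq_nonneg _) (hG.misspec _ u hu)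
      have h4 := hmain G W hG ε T m hε hε1 hT hρm I (by rw [hI]) (by rw [hI]) (fun _ => by rw [hI])
        (fun _ => by rw [hI]) (fun j => τ j ω) hx hs hl
      refine h1 (h4.trans (mul_le_mul_of_nonneg_right ?_ (by linarith)))
      linarith
    have h1 := MeasureTheory.measureReal_mono hcover (MeasureTheory.measure_ne_top μ _)
    rw [MeasureTheory.probReal_univ] at h1
    have h2 := MeasureTheory.measureReal_union_le (μ := μ) good
      ((⋃ k ∈ Finset.range (T + 1), bad k) ∪ N)
    have h3 := MeasureTheory.measureReal_union_le (μ := μ)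
      (⋃ k ∈ Finset.range (T + 1), bad k) N
    -- There are `T + 1` batches, each failing with probability at most `δ / (3 N (T + 1))`, so the
    -- total is at most `δ / (3 N)`.
    have h4 : μ.real (⋃ k ∈ Finset.range (T + 1), bad k) ≤ δ := by
      refine (MeasureTheory.measureReal_biUnion_finset_le _ _).trans
        ((Finset.sum_le_sum fun k _ => hbad k).trans ?_)
      rw [Finset.sum_const, Finset.card_range, nsmul_eq_mul, Nat.cast_succ, hq, mul_div_assoc',
        div_le_iff₀ (by positivity)]
      nlinarith [mul_pos hδ (by linarith : (0 : ℝ) < T + 1)]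
    linarith
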